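/- Let $(M,\omega)$ be a closed symplectic manifold of dimension $2n$, and let $\phi:SU(2)\times M\to M$ be a smooth action with $\phi(g,\cdot)^*\omega=\omega$ for all $g\in SU(2)$. Identify $SU(2)$ with the group of unit quaternions, let $U(\mathbb H^2)=\{(v_1,v_2)\in\mathbb H^2 : |v_1|^2+|v_2|^2=1\}$, and let $$P^0_\phi=\bigl(U(\mathbb H^2)\times M\bigr)/SU(2),\qquad g\cdot\bigl((v_1,v_2),x\bigr)=\bigl((v_1g^{-1},v_2g^{-1}),\phi(g,x)\bigr),$$ be the associated smooth $M$-bundle over $S^4=\mathbb{HP}^1=U(\mathbb H^2)/SU(2)$. In the coordinates $q=v_1v_2^{-1}$ over $v_2\neq0$ and $q'=v_2v_1^{-1}$ over $v_1\ne 0$ it is obtained by gluing two copies of $\mathbb H\times M$ by $(q,y)\mapsto\bigl(q^{-1},\phi(q/|q|,y)\bigr)$, $q\neq0$, that is, by clutching with $\phi$. The fiber over $[v]$, $v\in U(\mathbb H^2)$, is identified with $M$ by $x\mapsto[v,x]$. On $P^0_\phi$ consider the action of $SU(2)$ and the two circle actions $$h\cdot[(v_1,v_2),x]=[(h^{-1}v_1,v_2),x],\qquad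 e^{i\theta}\cdot[(v_1,v_2),x]=[(e^{-i\theta}v_1,v_2),x],\qquad e^{i\theta}\ast[(v_1,v_2),x]=[(v_1,e^{i\theta}v_2),x],$$ where $e^{i\theta}\in\mathbb C\subset\mathbb H$; the last one commutes with the $SU(2)$-action. Then there is a smooth closed $2$-form $\omega_{S^4}$ on $P^0_\phi$ that is invariant under the $SU(2)$-action and under both circle actions and whose restriction to every fiber is $\omega$. Moreover, its cohomology class is uniquely determined: every smooth closed $2$-form on $P^0_\phi$ whose restriction to every fiber is $\omega$ (in particular, every one that is also invariant) represents the same de Rham cohomology class as $\omega_{S^4}$. -/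

import Mathlib

open scoped Quaternion Manifold ContDiff

namespace SU2Bundle

noncomputable section

section Forms

variable {E E' : Type*} [NormedAddCommGroup E] [NormedSpace ℝ E]
  [NormedAddCommGroup E'] [NormedSpace ℝ E']
  {N N' : Type*} [TopologicalSpace N] [ChartedSpace E N]
  [TopologicalSpace N'] [ChartedSpace E' N'] {k : ℕ}

/-- A (not necessarily smooth) differential `k`-form on a manifold `N` without boundary
modelled on `E`: an alternating `k`-linear form on every tangent space. -/
abbrev DForm (E : Type*) [NormedAddCommGroup E] [NormedSpace ℝ E]
    (N : Type*) [TopologicalSpace N] [ChartedSpace E N] (k : ℕ) : Type _ :=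
  (x : N) → (TangentSpace 𝓘(ℝ, E) x) [⋀^Fin k]→L[ℝ] ℝ

/-- The pullback `f^* η`. -/
def pullback (f : N → N') (η : DForm E' N' k) : DForm E N k :=
  fun x => (η (f x)).compContinuousLinearMap (mfderiv 𝓘(ℝ, E) 𝓘(ℝ, E') f x)

/-- The coordinate expression of `η` in the preferred chart `e` at `x₀`, i.e. the pullback of `η`
by `e⁻¹`. It is meaningful on the target of `e`. -/
def localRep (η : DForm E N k) (x₀ : N) : E → E [⋀^Fin k]→L[ℝ] ℝ :=
  pullback (E := E) (E' := E) (chartAt E x₀).symm η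

/-- Smoothness of a form: all coordinate expressions are smooth. -/
def IsSmoothForm (η : DForm E N k) : Prop :=
  ∀ x₀ : N, ContDiffOn ℝ ∞ (localRep η x₀) (chartAt E x₀).target

/-- The exterior derivative, computed at `x` in the preferred chart at `x`. -/
def extD (η : DForm E N k) : DForm E N (k + 1) :=
  fun x => (extDeriv (localRep η x) (chartAt E x x)).compContinuousLinearMap
    (mfderiv 𝓘(ℝ, E) 𝓘(ℝ, E) (chartAt E x) x)

/-- `η` is a smooth form with `dη = 0`. -/
structure IsClosedForm (η : DForm E N k) : Prop where
  smooth : IsSmoothForm η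
  closed : extD η = 0

/-- `η` and `η'` differ by the exterior derivative of a smooth form; for closed forms this is
equality of their de Rham cohomology classes. -/
def Cohomologous (η η' : DForm E N (k + 1)) : Prop :=
  ∃ α : DForm E N k, IsSmoothForm α ∧ extD α = η - η'

/-- A symplectic form: a closed nondegenerate `2`-form. -/
structure IsSymplecticForm (σ : DForm E N 2) : Prop extends IsClosedForm σ where
  nondegenerate : ∀ (x : N) (v : TangentSpace 𝓘(ℝ, E) x),
    (∀ w : TangentSpace 𝓘(ℝ, E) x, σ x ![v, w] = 0) → v = 0

end Forms

/-- `SU(2)`, as the group of unit quaternions. -/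
abbrev SU2 : Type := Metric.sphere (0 : ℍ[ℝ]) 1

instance instFactFinrankQuaternion : Fact (Module.finrank ℝ ℍ[ℝ] = 3 + 1) :=
  ⟨Quaternion.finrank_eq_four⟩


instance instGroupSU2 : Group SU2 := Metric.unitSphere.instGroup

instance instMonoidSU2 : Monoid SU2 := DivInvMonoid.toMonoid

/-- `U(ℍ²)`, the set of unit vectors `(v₁, v₂)` of `ℍ²`. -/
@[ext] structure UnitPairs where
  fst : ℍ[ℝ]
  snd : ℍ[ℝ]
  norm_eq : ‖fst‖ ^ 2 + ‖snd‖ ^ 2 = 1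

namespace UnitPairs

/-- The topology of `U(ℍ²)` as a subspace of `ℍ²`. -/
instance : TopologicalSpace UnitPairs := .induced (fun v => (v.fst, v.snd)) inferInstance

theorem continuous_fst : Continuous UnitPairs.fst :=
  _root_.continuous_fst.comp (continuous_induced_dom (f := fun v : UnitPairs => (v.fst, v.snd)))

theorem continuous_snd : Continuous UnitPairs.snd :=
  _root_.continuous_snd.comp (continuous_induced_dom (f := fun v : UnitPairs => (v.fst, v.snd)))

theorem continuous_of {X : Type*} [TopologicalSpace X] {f : X → UnitPairs}
    (h1 : Continuous fun x => (f x).fst) (h2 : Continuous fun x => (f x).snd) : Continuous f :=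
  continuous_induced_rng.2 (h1.prodMk h2)

/-- The structure group acts on `U(ℍ²)` by `g • (v₁, v₂) = (v₁ g⁻¹, v₂ g⁻¹)`. -/
instance : MulAction SU2 UnitPairs where
  smul g v := ⟨v.fst * (g : ℍ[ℝ])⁻¹, v.snd * (g : ℍ[ℝ])⁻¹, by
    simpa only [norm_mul, norm_inv, norm_eq_of_mem_sphere, inv_one, mul_one] using v.norm_eq⟩
  one_smul v := by
    ext1
    · change v.fst * _ = _; simp
    · change v.snd * _ = _; simp
  mul_smul g h v := by
    ext1
    · change v.fst * _ = v.fst * _ * _; simp [mul_assoc]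
    · change v.snd * _ = v.snd * _ * _; simp [mul_assoc]

theorem smul_fst (g : SU2) (v : UnitPairs) : (g • v).fst = v.fst * (g : ℍ[ℝ])⁻¹ := rfl

theorem smul_snd (g : SU2) (v : UnitPairs) : (g • v).snd = v.snd * (g : ℍ[ℝ])⁻¹ := rfl

instance : ContinuousConstSMul SU2 UnitPairs where
  continuous_const_smul _ :=
    continuous_of (continuous_fst.mul continuous_const) (continuous_snd.mul continuous_const)

/-- `(v₁, v₂) ↦ (a v₁, b v₂)` for unit quaternions `a`, `b`. -/
def leftMul (a b : SU2) (v : UnitPairs) : UnitPairs :=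
  ⟨(a : ℍ[ℝ]) * v.fst, (b : ℍ[ℝ]) * v.snd, by
    simpa only [norm_mul, norm_eq_of_mem_sphere, one_mul] using v.norm_eq⟩

theorem leftMul_smul (a b g : SU2) (v : UnitPairs) :
    leftMul a b (g • v) = g • leftMul a b v :=
  UnitPairs.ext (mul_assoc _ _ _).symm (mul_assoc _ _ _).symm

/-- `(v₁, v₂) ↦ (v₂, v₁)`. -/
def swap (v : UnitPairs) : UnitPairs := ⟨v.snd, v.fst, by rw [add_comm]; exact v.norm_eq⟩

theorem swap_smul (g : SU2) (v : UnitPairs) : swap (g • v) = g • swap v := rfl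

theorem continuous_swap : Continuous swap := continuous_of continuous_snd continuous_fst

theorem fst_ne_zero {v : UnitPairs} (h : v.snd = 0) : v.fst ≠ 0 := by
  intro h'
  have := v.norm_eq
  simp [h, h'] at this

end UnitPairs

open Classical in
/-- `q / |q|` (and `1` for `q = 0`). -/
def unitPart (q : ℍ[ℝ]) : SU2 :=
  if h : q = 0 then 1 else ⟨‖q‖⁻¹ • q, by
    rw [mem_sphere_zero_iff_norm, norm_smul, norm_inv, norm_norm,
      inv_mul_cancel₀ (norm_ne_zero_iff.2 h)]⟩

theorem coe_unitPart {q : ℍ[ℝ]} (h : q ≠ 0) : (unitPart q : ℍ[ℝ]) = ‖q‖⁻¹ • q := by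
  simp [unitPart, h]

theorem unitPart_mul_inv {q : ℍ[ℝ]} (h : q ≠ 0) (g : SU2) :
    unitPart (q * (g : ℍ[ℝ])⁻¹) = unitPart q * g⁻¹ := by
  have hg : (g : ℍ[ℝ]) ≠ 0 := ne_zero_of_mem_unit_sphere g
  apply Subtype.ext
  rw [coe_unitPart (mul_ne_zero h (inv_ne_zero hg))]
  simp [coe_unitPart h, norm_mul]

theorem contMDiffAt_unitPart {q : ℍ[ℝ]} (h : q ≠ 0) :
    ContMDiffAt 𝓘(ℝ, ℍ[ℝ]) (𝓡 3) ∞ unitPart q := by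
  let U : TopologicalSpace.Opens ℍ[ℝ] := ⟨{q | q ≠ 0}, isOpen_ne⟩
  have key : ContMDiff 𝓘(ℝ, ℍ[ℝ]) (𝓡 3) ∞ (fun q : U => unitPart q) := by
    have h1 : ContMDiff 𝓘(ℝ, ℍ[ℝ]) 𝓘(ℝ, ℍ[ℝ]) ∞ (fun q : U => ‖(q : ℍ[ℝ])‖⁻¹ • (q : ℍ[ℝ])) := by
      intro q
      refine (contMDiffAt_subtype_iff (f := fun q : ℍ[ℝ] => ‖q‖⁻¹ • q)).2 ?_
      refine ContDiffAt.contMDiffAt ?_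
      exact ((contDiffAt_norm ℝ q.2).inv (norm_ne_zero_iff.2 q.2)).smul contDiffAt_id
    have h2 : ∀ q : U, ‖(q : ℍ[ℝ])‖⁻¹ • (q : ℍ[ℝ]) ∈ Metric.sphere (0 : ℍ[ℝ]) 1 := fun q => by
      rw [← coe_unitPart q.2]; exact (unitPart q).2
    have h3 := h1.codRestrict_sphere (n := 3) h2
    exact h3.congr fun q => Subtype.ext (coe_unitPart q.2)
  exact contMDiffAt_subtype_iff.1 (key ⟨q, h⟩)

/-- The `M`-bundle associated with the principal bundle `U(ℍ²) → S⁴ = ℍP¹`: the quotient of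
`U(ℍ²) × M` by the action `g • (v₁, v₂, x) = (v₁ g⁻¹, v₂ g⁻¹, φ(g, x))`. -/
def TotalSpace (M : Type*) [MulAction SU2 M] : Type _ :=
  MulAction.orbitRel.Quotient SU2 (UnitPairs × M)

/-- The base `S⁴ = ℍP¹ = U(ℍ²) / SU(2)`. -/
def Base : Type := MulAction.orbitRel.Quotient SU2 UnitPairs


namespace TotalSpace

open UnitPairs (fst_ne_zero smul_fst smul_snd leftMul_smul swap_smul)

section Basic

variable {M : Type*} [MulAction SU2 M]

/-- The point `[v, x]` of the bundle. -/
def mk (v : UnitPairs) (x : M) : TotalSpace M := Quotient.mk _ (v, x)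

theorem mk_smul (g : SU2) (v : UnitPairs) (x : M) : mk (g • v) (g • x) = mk v x :=
  Quotient.sound ⟨g, rfl⟩

theorem mk_eq_mk {v w : UnitPairs} {x y : M} :
    mk v x = mk w y ↔ ∃ g : SU2, g • w = v ∧ g • y = x := by
  constructor
  · intro h
    obtain ⟨g, hg⟩ := Quotient.exact h
    exact ⟨g, congrArg Prod.fst hg, congrArg Prod.snd hg⟩
  · rintro ⟨g, rfl, rfl⟩
    exact mk_smul g w y

theorem exists_mk (p : TotalSpace M) : ∃ v x, mk v x = p := by
  obtain ⟨⟨v, x⟩, rfl⟩ := Quotient.exists_rep p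
  exact ⟨v, x, rfl⟩

/-- Descends an `SU(2)`-invariant function on `U(ℍ²) × M` to the bundle. -/
def lift {α : Type*} (f : UnitPairs → M → α)
    (hf : ∀ (g : SU2) v x, f (g • v) (g • x) = f v x) : TotalSpace M → α :=
  Quotient.lift (fun p => f p.1 p.2) (by rintro _ ⟨v, x⟩ ⟨g, rfl⟩; exact hf g v x)

theorem lift_mk {α : Type*} (f : UnitPairs → M → α) (hf) (v : UnitPairs) (x : M) :
    lift f hf (mk v x) = f v x := rfl

/-- The bundle projection onto `S⁴`. -/
def proj : TotalSpace M → Base :=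
  lift (fun v _ => Quotient.mk _ v) fun g _ _ => Quotient.sound ⟨g, rfl⟩

/-- `x ↦ [v, x]` is a bijection of `M` onto the fiber of the bundle over `[v]`. -/
theorem bijOn_mk (v : UnitPairs) :
    Set.BijOn (mk (M := M) v) Set.univ (proj ⁻¹' {(Quotient.mk _ v : Base)}) := by
  refine ⟨fun x _ => rfl, fun x _ y _ h => ?_, fun p hp => ?_⟩
  · obtain ⟨g, hg, rfl⟩ := mk_eq_mk.1 h
    have : g = 1 := by
      have h1 : v.fst * (g : ℍ[ℝ])⁻¹ = v.fst := congrArg (fun w : UnitPairs => w.fst) hg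
      have h2 : v.snd * (g : ℍ[ℝ])⁻¹ = v.snd := congrArg (fun w : UnitPairs => w.snd) hg
      have h3 : (g : ℍ[ℝ])⁻¹ = 1 := by
        by_cases h : v.snd = 0
        · exact (mul_eq_left₀ (fst_ne_zero h)).1 h1
        · exact (mul_eq_left₀ h).1 h2
      exact Subtype.ext (inv_eq_one.1 h3)
    rw [this, one_smul]
  · obtain ⟨w, x, rfl⟩ := exists_mk p
    obtain ⟨g, rfl⟩ := Quotient.exact (show Quotient.mk _ w = Quotient.mk _ v from hp)
    exact ⟨g⁻¹ • x, trivial, by rw [← mk_smul g, smul_inv_smul]⟩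

/-- `[(v₁, v₂), x] ↦ [(a v₁, b v₂), x]` for unit quaternions `a`, `b`. -/
def leftMul (a b : SU2) : TotalSpace M → TotalSpace M :=
  lift (fun v x => mk (v.leftMul a b) x) fun g v x => by rw [leftMul_smul, mk_smul]

/-- The `SU(2)`-action on the bundle: `(h, [(v₁, v₂), x]) ↦ [(h⁻¹ v₁, v₂), x]`. -/
def su2Act (h : SU2) : TotalSpace M → TotalSpace M := leftMul h⁻¹ 1

/-- `e^{iθ}` as a unit quaternion. Left multiplication by it on `ℍ = ℂ ⊕ ℂ j ≅ ℂ²` is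
multiplication by the scalar matrix `e^{iθ} I₂`, and commutes with all right multiplications. -/
def circleToSU2 (z : Circle) : SU2 :=
  ⟨((z : ℂ) : ℍ[ℝ]), by
    have h : ‖((z : ℂ) : ℍ[ℝ])‖ ^ 2 = 1 := by
      rw [sq, ← Quaternion.normSq_eq_norm_mul_self, Quaternion.normSq_def']
      have := Circle.normSq_coe z
      rw [Complex.normSq_apply] at this
      simp
      linarith
    rw [mem_sphere_zero_iff_norm]
    exact (pow_eq_one_iff_of_nonneg (norm_nonneg _) two_ne_zero).1 h⟩

/-- The circle action `(e^{iθ}, [(v₁, v₂), x]) ↦ [(e^{-iθ} v₁, v₂), x]`. -/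
def circleAct (z : Circle) : TotalSpace M → TotalSpace M := leftMul (circleToSU2 z)⁻¹ 1

/-- The circle action `(e^{iθ}, [(v₁, v₂), x]) ↦ [(v₁, e^{iθ} v₂), x]`, which commutes with the
`SU(2)`-action; it covers `q ↦ q e^{-iθ}` in the coordinate `q = v₁ v₂⁻¹` of the base, as the
`SU(2)`-action covers `q ↦ h⁻¹ q`. -/
def circleAct' (z : Circle) : TotalSpace M → TotalSpace M := leftMul 1 (circleToSU2 z)

/-- `[(v₁, v₂), x] ↦ [(v₂, v₁), x]`. -/
def swap : TotalSpace M → TotalSpace M :=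
  lift (fun v x => mk v.swap x) fun g v x => by rw [swap_smul, mk_smul]

theorem swap_swap (p : TotalSpace M) : swap (swap p) = p := by
  obtain ⟨v, x, rfl⟩ := exists_mk p
  rfl

open Classical in
/-- The unit quaternion `v₂ / |v₂|`, where `v₂ ≠ 0`. -/
def phase (v : UnitPairs) : SU2 := if v.snd = 0 then unitPart v.fst else unitPart v.snd

theorem phase_smul (g : SU2) (v : UnitPairs) : phase (g • v) = phase v * g⁻¹ := by
  have hg : (g : ℍ[ℝ]) ≠ 0 := ne_zero_of_mem_unit_sphere g
  by_cases h : v.snd = 0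
  · simp [phase, smul_fst, smul_snd, h, unitPart_mul_inv (fst_ne_zero h)]
  · simp [phase, smul_snd, h, hg, unitPart_mul_inv h]

/-- The trivialization `[(v₁, v₂), x] ↦ (v₁ v₂⁻¹, φ(v₂ / |v₂|, x))` over `v₂ ≠ 0`. -/
def trivFun : TotalSpace M → ℍ[ℝ] × M :=
  lift (fun v x => (v.fst * v.snd⁻¹, phase v • x)) fun g v x => by
    have hg : (g : ℍ[ℝ]) ≠ 0 := ne_zero_of_mem_unit_sphere g
    rw [phase_smul, mul_smul, inv_smul_smul, smul_fst, smul_snd, mul_inv_rev, inv_inv,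
      mul_assoc, inv_mul_cancel_left₀ hg]

/-- The point `(q, 1) / |(q, 1)|` of `U(ℍ²)`. -/
def affine (q : ℍ[ℝ]) : UnitPairs :=
  ⟨(√(1 + ‖q‖ ^ 2))⁻¹ • q, (√(1 + ‖q‖ ^ 2))⁻¹ • 1, by
    have h : 0 < 1 + ‖q‖ ^ 2 := by positivity
    simp only [norm_smul, norm_inv, Real.norm_eq_abs, abs_of_nonneg (Real.sqrt_nonneg _),
      mul_pow, inv_pow, Real.sq_sqrt h.le, norm_one, one_pow]
    field_simp
    ring⟩

theorem sqrt_ne_zero (q : ℍ[ℝ]) : √(1 + ‖q‖ ^ 2) ≠ 0 := by positivity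

theorem affine_snd_ne_zero (q : ℍ[ℝ]) : (affine q).snd ≠ 0 :=
  smul_ne_zero (inv_ne_zero (sqrt_ne_zero q)) one_ne_zero

theorem phase_affine (q : ℍ[ℝ]) : phase (affine q) = 1 := by
  apply Subtype.ext
  rw [phase, if_neg (affine_snd_ne_zero q), coe_unitPart (affine_snd_ne_zero q)]
  simp [affine, norm_smul, abs_of_nonneg (Real.sqrt_nonneg _), smul_smul,
    mul_inv_cancel₀ (sqrt_ne_zero q)]

theorem trivFun_mk_affine (q : ℍ[ℝ]) (y : M) : trivFun (mk (affine q) y) = (q, y) := by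
  refine Prod.ext ?_ ?_
  · change (affine q).fst * (affine q).snd⁻¹ = q
    simp [affine, smul_inv₀, smul_smul, mul_inv_cancel₀ (sqrt_ne_zero q)]
  · change phase (affine q) • y = y
    rw [phase_affine, one_smul]

theorem affine_eq {v : UnitPairs} (h : v.snd ≠ 0) :
    affine (v.fst * v.snd⁻¹) = phase v • v := by
  have hn : ‖v.snd‖ ≠ 0 := norm_ne_zero_iff.2 h
  have hs : √(1 + ‖v.fst * v.snd⁻¹‖ ^ 2) = ‖v.snd‖⁻¹ := by
    rw [Real.sqrt_eq_iff_eq_sq (by positivity) (by positivity), norm_mul, norm_inv]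
    have := v.norm_eq
    field_simp
    linarith
  have hp : (phase v : ℍ[ℝ])⁻¹ = ‖v.snd‖ • v.snd⁻¹ := by
    rw [phase, if_neg h, coe_unitPart h, smul_inv₀, inv_inv]
  refine UnitPairs.ext ?_ ?_
  · rw [smul_fst, hp]
    simp only [affine, hs, inv_inv, mul_smul_comm]
  · rw [smul_snd, hp]
    simp only [affine, hs, inv_inv, mul_smul_comm, mul_inv_cancel₀ h]

/-- The part of the bundle over `v₂ ≠ 0`. -/
def trivSource (M : Type*) [MulAction SU2 M] : Set (TotalSpace M) :=
  {p | lift (fun v _ => v.snd ≠ 0) (fun g v _ => by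
    have hg : (g : ℍ[ℝ]) ≠ 0 := ne_zero_of_mem_unit_sphere g
    simp [smul_snd, hg]) p}

theorem mk_mem_trivSource {v : UnitPairs} {x : M} : mk v x ∈ trivSource M ↔ v.snd ≠ 0 := Iff.rfl

theorem mk_affine_trivFun {p : TotalSpace M} (hp : p ∈ trivSource M) :
    mk (affine (trivFun p).1) (trivFun p).2 = p := by
  obtain ⟨v, x, rfl⟩ := exists_mk p
  change mk (affine (v.fst * v.snd⁻¹)) (phase v • x) = mk v x
  rw [affine_eq hp, mk_smul]

/-- The transition function `(q, y) ↦ (q⁻¹, φ(q / |q|, y))` between the two trivializations. -/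
theorem trivFun_swap_mk_affine {q : ℍ[ℝ]} (hq : q ≠ 0) (y : M) :
    trivFun (swap (mk (affine q) y)) = (q⁻¹, unitPart q • y) := by
  have hs := sqrt_ne_zero q
  refine Prod.ext ?_ ?_
  · change (affine q).snd * (affine q).fst⁻¹ = q⁻¹
    simp [affine, smul_inv₀, smul_smul, mul_inv_cancel₀ (sqrt_ne_zero q)]
  · change phase (affine q).swap • y = unitPart q • y
    congr 1
    have h1 : (√(1 + ‖q‖ ^ 2))⁻¹ • q ≠ 0 := smul_ne_zero (inv_ne_zero hs) hq
    apply Subtype.ext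
    rw [phase, if_neg (show (affine q).swap.snd ≠ 0 from h1), coe_unitPart hq,
      coe_unitPart (show (affine q).swap.snd ≠ 0 from h1)]
    change ‖(√(1 + ‖q‖ ^ 2))⁻¹ • q‖⁻¹ • ((√(1 + ‖q‖ ^ 2))⁻¹ • q) = _
    rw [norm_smul, norm_inv, Real.norm_of_nonneg (Real.sqrt_nonneg _), smul_smul]
    congr 1
    field_simp

end Basic

section Topology

variable {M : Type*} [TopologicalSpace M] [MulAction SU2 M]

/-- The quotient topology. -/
instance : TopologicalSpace (TotalSpace M) :=
  inferInstanceAs (TopologicalSpace (Quotient (MulAction.orbitRel SU2 (UnitPairs × M))))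

theorem continuous_mk : Continuous fun p : UnitPairs × M => mk p.1 p.2 := continuous_quot_mk

variable [ContinuousSMul SU2 M]

theorem isOpenQuotientMap_mk : IsOpenQuotientMap fun p : UnitPairs × M => mk p.1 p.2 :=
  MulAction.isOpenQuotientMap_quotientMk (Γ := SU2) (T := UnitPairs × M)

theorem continuous_swap' : Continuous (swap (M := M)) :=
  isOpenQuotientMap_mk.continuous_comp_iff.1 <|
    continuous_mk.comp (UnitPairs.continuous_swap.prodMap continuous_id)

theorem continuous_affine : Continuous affine := by
  have h : Continuous fun q : ℍ[ℝ] => (√(1 + ‖q‖ ^ 2))⁻¹ :=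
    Continuous.inv₀ (by fun_prop) sqrt_ne_zero
  exact UnitPairs.continuous_of (h.smul continuous_id) (h.smul continuous_const)

/-- The exchange of `v₁` and `v₂` as a homeomorphism. -/
def swapHomeo : TotalSpace M ≃ₜ TotalSpace M where
  toFun := swap
  invFun := swap
  left_inv := swap_swap
  right_inv := swap_swap
  continuous_toFun := continuous_swap'
  continuous_invFun := continuous_swap'

theorem isOpen_trivSource : IsOpen (trivSource M) := by
  rw [← isOpenQuotientMap_mk.isQuotientMap.isOpen_preimage]
  have h : Continuous fun p : UnitPairs × M => p.1.snd :=
    UnitPairs.continuous_snd.comp continuous_fst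
  exact isOpen_ne_fun h continuous_const

theorem continuousAt_phase {v : UnitPairs} (h : v.snd ≠ 0) : ContinuousAt phase v := by
  have hc : Continuous fun v : UnitPairs => v.snd := UnitPairs.continuous_snd
  have h1 : ContinuousAt (fun v : UnitPairs => unitPart v.snd) v :=
    ContinuousAt.comp (f := fun v : UnitPairs => v.snd)
      (contMDiffAt_unitPart h).continuousAt hc.continuousAt
  refine h1.congr ?_
  filter_upwards [hc.continuousAt.eventually_ne h] with w hw
  rw [phase, if_neg hw]

variable (M) in
/-- The trivialization of the bundle over `v₂ ≠ 0`. -/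
def triv : OpenPartialHomeomorph (TotalSpace M) (ℍ[ℝ] × M) where
  toFun := trivFun
  invFun p := mk (affine p.1) p.2
  source := trivSource M
  target := Set.univ
  map_source' _ _ := trivial
  map_target' p _ := affine_snd_ne_zero p.1
  left_inv' _ hp := mk_affine_trivFun hp
  right_inv' p _ := trivFun_mk_affine p.1 p.2
  open_source := isOpen_trivSource
  open_target := isOpen_univ
  continuousOn_toFun p hp := by
    obtain ⟨v, x, rfl⟩ := exists_mk p
    refine ContinuousAt.continuousWithinAt ?_
    refine (isOpenQuotientMap_mk.continuousAt_comp_iff (x := (v, x)) (g := trivFun)).1 ?_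
    change ContinuousAt (fun p : UnitPairs × M => (p.1.fst * p.1.snd⁻¹, phase p.1 • p.2)) (v, x)
    refine ContinuousAt.prodMk ?_ ?_
    · exact (UnitPairs.continuous_fst.comp continuous_fst).continuousAt.mul
        ((UnitPairs.continuous_snd.comp continuous_fst).continuousAt.inv₀ hp)
    · exact ((continuousAt_phase hp).comp_of_eq continuousAt_fst rfl).smul continuousAt_snd
  continuousOn_invFun :=
    (continuous_mk.comp (continuous_affine.prodMap continuous_id)).continuousOn

variable (M) in
/-- The trivializations over `v₂ ≠ 0` and over `v₁ ≠ 0`. -/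
def trivs : Bool → OpenPartialHomeomorph (TotalSpace M) (ℍ[ℝ] × M)
  | true => triv M
  | false => swapHomeo.transOpenPartialHomeomorph (triv M)

theorem mem_trivs_source (p : TotalSpace M) (h : p ∉ (trivs M true).source) :
    p ∈ (trivs M false).source := by
  obtain ⟨v, x, rfl⟩ := exists_mk p
  exact fst_ne_zero (not_not.1 h)

end Topology

section Manifold

variable {E : Type*} [NormedAddCommGroup E] [NormedSpace ℝ E] {M : Type*} [TopologicalSpace M]
  [ChartedSpace E M] [MulAction SU2 M] [ContinuousSMul SU2 M]

/-- The chart of the bundle given by a trivialization and a chart of `M`. -/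
def chart (i : Bool) (e : OpenPartialHomeomorph M E) :
    OpenPartialHomeomorph (TotalSpace M) (ℍ[ℝ] × E) :=
  (trivs M i).trans ((OpenPartialHomeomorph.refl ℍ[ℝ]).prod e)

open Classical in
/-- The atlas of the bundle given by its two trivializations and the atlas of `M`. -/
instance : ChartedSpace (ℍ[ℝ] × E) (TotalSpace M) where
  atlas := {c | ∃ i, ∃ e ∈ atlas E M, c = chart i e}
  chartAt p :=
    let i : Bool := decide (p ∈ (trivs M true).source)
    chart i (chartAt E (trivs M i p).2)
  mem_chart_source p := by
    by_cases h : p ∈ (trivs M true).source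
    · simp [h, chart]
    · simp [h, chart, mem_trivs_source p h]
  chart_mem_atlas p := ⟨_, _, chart_mem_atlas E _, rfl⟩

theorem contDiffAt_quaternion_inv {q : ℍ[ℝ]} (hq : q ≠ 0) :
    ContDiffAt ℝ ∞ (fun q : ℍ[ℝ] => q⁻¹) q := by
  have h := contDiffAt_ringInverse (n := ∞) ℝ (Units.mk0 q hq)
  simpa only [Ring.inverse_eq_inv'] using! h

theorem contMDiffOn_transition [ContMDiffSMul (𝓡 3) 𝓘(ℝ, E) ∞ SU2 M] (i j : Bool) :
    ContMDiffOn (𝓘(ℝ, ℍ[ℝ]).prod 𝓘(ℝ, E)) (𝓘(ℝ, ℍ[ℝ]).prod 𝓘(ℝ, E)) ∞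
      (trivs M j ∘ (trivs M i).symm) ((trivs M i).symm.trans (trivs M j)).source := by
  have key : ContMDiffOn (𝓘(ℝ, ℍ[ℝ]).prod 𝓘(ℝ, E)) (𝓘(ℝ, ℍ[ℝ]).prod 𝓘(ℝ, E)) ∞
      (fun p : ℍ[ℝ] × M => (p.1⁻¹, unitPart p.1 • p.2)) {p | p.1 ≠ 0} := by
    intro p hp
    refine ContMDiffAt.contMDiffWithinAt (ContMDiffAt.prodMk ?_ ?_)
    · exact (contDiffAt_quaternion_inv hp).contMDiffAt.comp p contMDiffAt_fst
    · exact ((contMDiffAt_unitPart hp).comp p contMDiffAt_fst).smul contMDiffAt_snd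
  have hne : ∀ p : ℍ[ℝ] × M, swap (mk (affine p.1) p.2) ∈ trivSource M → p.1 ≠ 0 := by
    intro p hp h0
    apply hp
    change (√(1 + ‖p.1‖ ^ 2))⁻¹ • p.1 = 0
    rw [h0, smul_zero]
  rcases i <;> rcases j
  · refine (contMDiffOn_id (I := 𝓘(ℝ, ℍ[ℝ]).prod 𝓘(ℝ, E))).congr fun p hp => ?_
    exact (trivs M false).right_inv hp.1
  · have hne' : ((trivs M false).symm.trans (trivs M true)).source ⊆ {p | p.1 ≠ 0} :=
      fun p hp => hne p hp.2
    exact (key.mono hne').congr fun p hp => trivFun_swap_mk_affine (hne' hp) p.2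
  · have hne' : ((trivs M true).symm.trans (trivs M false)).source ⊆ {p | p.1 ≠ 0} :=
      fun p hp => hne p hp.2
    exact (key.mono hne').congr fun p hp => trivFun_swap_mk_affine (hne' hp) p.2
  · refine (contMDiffOn_id (I := 𝓘(ℝ, ℍ[ℝ]).prod 𝓘(ℝ, E))).congr fun p hp => ?_
    exact (trivs M true).right_inv hp.1

/-- The bundle is a smooth manifold. -/
instance [IsManifold 𝓘(ℝ, E) ∞ M] [ContMDiffSMul (𝓡 3) 𝓘(ℝ, E) ∞ SU2 M] :
    IsManifold 𝓘(ℝ, ℍ[ℝ] × E) ∞ (TotalSpace M) := by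
  apply isManifold_of_contDiffOn
  rintro _ _ ⟨i, e, he, rfl⟩ ⟨j, e', he', rfl⟩
  have he := contMDiffOn_symm_of_mem_maximalAtlas (I := 𝓘(ℝ, E)) (n := ∞)
    (IsManifold.subset_maximalAtlas he)
  have he' := contMDiffOn_of_mem_maximalAtlas (I := 𝓘(ℝ, E)) (n := ∞)
    (IsManifold.subset_maximalAtlas he')
  have h1 := (contMDiffOn_id (I := 𝓘(ℝ, ℍ[ℝ])) (M := ℍ[ℝ]) (n := ∞) (s := Set.univ)).prodMap he
  have h2 := (contMDiffOn_id (I := 𝓘(ℝ, ℍ[ℝ])) (M := ℍ[ℝ]) (n := ∞) (s := Set.univ)).prodMap he'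
  have h3 := h2.comp' ((contMDiffOn_transition i j).comp' h1)
  rw [← modelWithCornersSelf_prod, chartedSpaceSelf_prod, contMDiffOn_iff_contDiffOn] at h3
  refine h3.mono fun p hp => ?_
  obtain ⟨⟨h4, h5⟩, h6, h7⟩ := hp.1
  exact ⟨⟨h4, ⟨h5, h6⟩⟩, h7⟩

end Manifold

end TotalSpace

end

end SU2Bundle

open SU2Bundle

/-! Write P for the bundle and `(q, y)` for the coordinates of its trivialization over `v₂ ≠ 0`.
Over `q ≠ 0` the fiber coordinate of the other trivialization is `ψ(q, y) = φ(q/|q|, y)`.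

Existence. On the two halves of P the form `σ` extends as `nearForm σ`, the pullback of `σ` by `y`,
and as `farForm σ`, which over the overlap is `ψ^*σ`. They need not agree, but their difference on
the overlap is exact, with a primitive built from a moment map. With `X_u` the vector field of `u ∈
su(2)` on `M`, closedness and invariance of `σ` give `d(σ(X_x, X_y)) = σ(X_[x,y], ·)`. Since `su(2)`
is spanned by brackets, the functions `F_u` determined by `F_[x,y] = σ(X_x, X_y)` satisfy `dF_u =
σ(X_u, ·)`; this is `commDual_fderiv`. Pairing `F` with the Maurer–Cartan form `q⁻¹ dq` gives the
1-form `transgression σ = -F(q⁻¹ dq)`, and `extD_transgression` shows `d(transgression σ) = farForm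
σ - nearForm σ`. With a cutoff `χ` depending on `|q|` only, equal to `0` near `q = 0` and to `1` for
`|q| ≥ 1`, the form `nearForm σ + d(χ · transgression σ)` continues smoothly by `farForm σ`. It is
closed, and it restricts to `σ` on fibers because the transgression has no fiber component. Every
ingredient is invariant under `(v₁, v₂) ↦ (a v₁, b v₂)` for all unit `a`, `b`
(`pullback_leftMul_couplingForm`); the `SU(2)`-action and both circle actions are restrictions of
this `SU(2) × SU(2)`-action.

Uniqueness. The difference `β` of two closed extensions vanishes on fibers, and it is exact by a
Mayer–Vietoris argument (`exists_primitive_of_fiberwise_zero`). The relative Poincaré lemma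
(`extDeriv_coneOp`) gives primitives `a₀`, `a₁` of `β` on the two halves. Then `a₁ - a₀` is a closed
1-form over `ℍ ∖ {0}`, which is simply connected, so it is `df + ρ` with `ρ` pulled back from the
fiber over `q = 1` (`exists_primitive_of_overlap`). The form `ρ` is closed on the whole first half,
so `a₀` can be replaced by `a₀ + ρ`; the two primitives now differ by `df` and are glued by the same
cutoff. -/

namespace SU2Bundle

open Filter Topology

set_option linter.unusedSectionVars false

noncomputable section

/-! ### Smooth families of alternating forms -/

section LinearAlgebra

variable {E E' V : Type*} [NormedAddCommGroup E] [NormedSpace ℝ E]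
  [NormedAddCommGroup E'] [NormedSpace ℝ E'] [NormedAddCommGroup V] [NormedSpace ℝ V] {k : ℕ}

/-- A family of alternating forms on a finite-dimensional space is smooth if all its values on
constant vectors are. -/
theorem contDiffAt_form_iff [FiniteDimensional ℝ E] {A : V → E [⋀^Fin k]→L[ℝ] ℝ} {x : V}
    {n : WithTop ℕ∞} :
    ContDiffAt ℝ n A x ↔ ∀ v : Fin k → E, ContDiffAt ℝ n (fun y => A y v) x := by
  constructor
  · intro h v
    exact (ContinuousAlternatingMap.apply ℝ E ℝ v).contDiff.contDiffAt.comp x h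
  · intro h
    let b := Module.finBasis ℝ E
    let ev : (E [⋀^Fin k]→L[ℝ] ℝ) →ₗ[ℝ] ((Fin k → Fin (Module.finrank ℝ E)) → ℝ) :=
      { toFun := fun A s => A fun i => b (s i)
        map_add' := fun A B => by ext s; simp
        map_smul' := fun c A => by ext s; simp }
    have hev : LinearMap.ker ev = ⊥ := by
      rw [LinearMap.ker_eq_bot]
      intro A B hAB
      apply ContinuousAlternatingMap.toAlternatingMap_injective
      refine AlternatingMap.coe_multilinearMap_injective ?_
      refine Module.Basis.ext_multilinear (fun _ => b) fun s => ?_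
      exact congrFun hAB s
    obtain ⟨g, hg⟩ := ev.exists_leftInverse_of_injective hev
    have h1 : ContDiffAt ℝ n (fun y => ev (A y)) x :=
      contDiffAt_pi.2 fun s => h fun i => b (s i)
    have h2 := (LinearMap.toContinuousLinearMap g).contDiff.contDiffAt.comp x h1
    refine h2.congr_of_eventuallyEq (Eventually.of_forall fun y => ?_)
    exact (LinearMap.congr_fun hg (A y)).symm

theorem contDiffAt_compContinuousLinearMap [FiniteDimensional ℝ E]
    {A : V → E' [⋀^Fin k]→L[ℝ] ℝ} {L : V → E →L[ℝ] E'} {x : V} {n : WithTop ℕ∞}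
    (hA : ContDiffAt ℝ n A x) (hL : ContDiffAt ℝ n L x) :
    ContDiffAt ℝ n (fun y => (A y).compContinuousLinearMap (L y)) x := by
  rw [contDiffAt_form_iff]
  intro v
  have h1 : ContDiffAt ℝ n (fun y => (A y).toContinuousMultilinearMap) x :=
    (ContinuousAlternatingMap.toContinuousMultilinearMapCLM ℝ :
      (E' [⋀^Fin k]→L[ℝ] ℝ) →L[ℝ] _).contDiff.contDiffAt.comp x hA
  have h2 : ContDiffAt ℝ n (fun y =>
      ContinuousMultilinearMap.compContinuousLinearMapContinuousMultilinear ℝ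
        (fun _ : Fin k => E) (fun _ : Fin k => E') ℝ (fun _ => L y)) x :=
    (ContinuousMultilinearMap.contDiff _).contDiffAt.comp x (contDiffAt_pi.2 fun _ => hL)
  exact (ContinuousMultilinearMap.apply ℝ (fun _ : Fin k => E) ℝ v).contDiff.contDiffAt.comp x
    (h2.clm_apply h1)

/-- The moving vectors are the images of the standard basis of `ℝ^k` under a smooth family of linear
maps `L y`, so the claim reduces to a pulled-back family evaluated on constant vectors. -/
theorem contDiffAt_form_apply {A : V → E [⋀^Fin k]→L[ℝ] ℝ} {v : V → Fin k → E} {x : V}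
    {n : WithTop ℕ∞} (hA : ContDiffAt ℝ n A x) (hv : ∀ i, ContDiffAt ℝ n (fun y => v y i) x) :
    ContDiffAt ℝ n (fun y => A y (v y)) x := by
  let L : V → (Fin k → ℝ) →L[ℝ] E := fun y =>
    ∑ i, (ContinuousLinearMap.proj (R := ℝ) (φ := fun _ : Fin k => ℝ) i).smulRight (v y i)
  have hL : ContDiffAt ℝ n L x :=
    ContDiffAt.sum fun i _ => contDiffAt_const.smulRight (hv i)
  have h := contDiffAt_form_iff.1 (contDiffAt_compContinuousLinearMap hA hL)
    (fun i => Pi.single i 1)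
  refine h.congr_of_eventuallyEq (Eventually.of_forall fun y => ?_)
  simp only [ContinuousAlternatingMap.compContinuousLinearMap_apply]
  congr 1
  ext i
  simp [L, Pi.single_apply]

end LinearAlgebra

/-! ### Calculus of forms on manifolds through the preferred charts -/

section FormCalculus

variable {E E' E'' : Type*} [NormedAddCommGroup E] [NormedSpace ℝ E]
  [NormedAddCommGroup E'] [NormedSpace ℝ E'] [NormedAddCommGroup E''] [NormedSpace ℝ E'']
  {N N' N'' : Type*} [TopologicalSpace N] [ChartedSpace E N]
  [TopologicalSpace N'] [ChartedSpace E' N'] [TopologicalSpace N''] [ChartedSpace E'' N'']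
  {k : ℕ}

theorem form_apply_congr (η : DForm E N k) {x y : N} (h : x = y) (w : Fin k → E) :
    (η x : E [⋀^Fin k]→L[ℝ] ℝ) w = (η y : E [⋀^Fin k]→L[ℝ] ℝ) w := by
  subst h; rfl

theorem pullback_comp_apply {g : N' → N''} {f : N → N'} {x : N}
    (hg : MDifferentiableAt 𝓘(ℝ, E') 𝓘(ℝ, E'') g (f x))
    (hf : MDifferentiableAt 𝓘(ℝ, E) 𝓘(ℝ, E') f x) (η : DForm E'' N'' k) :
    pullback (E := E) (g ∘ f) η x = pullback (E := E) f (pullback (E := E') g η) x := by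
  simp only [pullback]
  rw [mfderiv_comp x hg hf]
  rfl

theorem pullback_congr {f g : N → N'} {x : N} (h : f =ᶠ[𝓝 x] g) (η : DForm E' N' k) :
    pullback (E := E) f η x = pullback (E := E) g η x := by
  have hd : (mfderiv 𝓘(ℝ, E) 𝓘(ℝ, E') f x : E →L[ℝ] E') = mfderiv 𝓘(ℝ, E) 𝓘(ℝ, E') g x :=
    h.mfderiv_eq
  have h1 : ((η (f x) : E' [⋀^Fin k]→L[ℝ] ℝ)).compContinuousLinearMap
      (mfderiv 𝓘(ℝ, E) 𝓘(ℝ, E') f x : E →L[ℝ] E') =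
      ((η (g x) : E' [⋀^Fin k]→L[ℝ] ℝ)).compContinuousLinearMap
      (mfderiv 𝓘(ℝ, E) 𝓘(ℝ, E') g x : E →L[ℝ] E') := by
    rw [hd]
    ext w
    exact form_apply_congr η h.eq_of_nhds _
  exact h1

theorem pullback_id_apply (η : DForm E N k) (x : N) : pullback (fun y : N => y) η x = η x := by
  have h : mfderiv 𝓘(ℝ, E) 𝓘(ℝ, E) (fun y : N => y) x = ContinuousLinearMap.id ℝ _ := mfderiv_id
  simp only [pullback]
  rw [h]
  rfl

/-- A form at a point of the image only matters through its value there. -/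
theorem pullback_congr_form {f : N → N'} {x : N} {η η' : DForm E' N' k} (h : η (f x) = η' (f x)) :
    pullback (E := E) f η x = pullback (E := E) f η' x := by
  simp only [pullback, h]

theorem pullback_eq_fderiv (F : E → E') (A : E' → E' [⋀^Fin k]→L[ℝ] ℝ) (z : E) :
    pullback (E := E) (E' := E') F A z = (A (F z)).compContinuousLinearMap (fderiv ℝ F z) := by
  rw [← mfderiv_eq_fderiv]; rfl

variable [IsManifold 𝓘(ℝ, E) ∞ N] [IsManifold 𝓘(ℝ, E') ∞ N'] [IsManifold 𝓘(ℝ, E'') ∞ N'']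


theorem contMDiffAt_chart_symm {x : N} {z : E} (hz : z ∈ (chartAt E x).target) :
    ContMDiffAt 𝓘(ℝ, E) 𝓘(ℝ, E) ∞ (chartAt E x).symm z :=
  (contMDiffOn_chart_symm (I := 𝓘(ℝ, E)) (n := ∞) (x := x)).contMDiffAt
    ((chartAt E x).open_target.mem_nhds hz)

theorem contMDiffAt_chart {x y : N} (hy : y ∈ (chartAt E x).source) :
    ContMDiffAt 𝓘(ℝ, E) 𝓘(ℝ, E) ∞ (chartAt E x) y :=
  (contMDiffOn_chart (I := 𝓘(ℝ, E)) (n := ∞) (x := x)).contMDiffAt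
    ((chartAt E x).open_source.mem_nhds hy)

theorem mdifferentiableAt_of_contMDiffAt {f : N → N'} {x : N}
    (hf : ContMDiffAt 𝓘(ℝ, E) 𝓘(ℝ, E') ∞ f x) : MDifferentiableAt 𝓘(ℝ, E) 𝓘(ℝ, E') f x :=
  hf.mdifferentiableAt (by simp)

/-- The map `f` in the preferred charts at `x` and `y`. -/
def inCharts (f : N → N') (x : N) (y : N') : E → E' := chartAt E' y ∘ f ∘ (chartAt E x).symm

theorem contDiffAt_inCharts {f : N → N'} {x : N} {y : N'} {z : E}
    (hz : z ∈ (chartAt E x).target) (hy : f ((chartAt E x).symm z) ∈ (chartAt E' y).source)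
    (hf : ContMDiffAt 𝓘(ℝ, E) 𝓘(ℝ, E') ∞ f ((chartAt E x).symm z)) :
    ContDiffAt ℝ ∞ (inCharts (E := E) (E' := E') f x y) z :=
  contMDiffAt_iff_contDiffAt.1 <|
    (contMDiffAt_chart hy).comp z (hf.comp z (contMDiffAt_chart_symm hz))

/-- Functoriality of pullback, applied to the two factorizations of `f ∘ (chartAt E x).symm`. These
agree only near `z`, where the image stays in the source of the chart at `y`. -/
theorem localRep_pullback {f : N → N'} {x : N} {y : N'} {z : E}
    (hz : z ∈ (chartAt E x).target) (hy : f ((chartAt E x).symm z) ∈ (chartAt E' y).source)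
    (hf : MDifferentiableAt 𝓘(ℝ, E) 𝓘(ℝ, E') f ((chartAt E x).symm z)) (η : DForm E' N' k) :
    localRep (pullback f η) x z = (localRep η y (inCharts (E := E) (E' := E') f x y z)).compContinuousLinearMap
      (fderiv ℝ (inCharts (E := E) (E' := E') f x y) z) := by
  have hs := mdifferentiableAt_of_contMDiffAt (contMDiffAt_chart_symm hz)
  have hfs : MDifferentiableAt 𝓘(ℝ, E) 𝓘(ℝ, E') (f ∘ (chartAt E x).symm) z := hf.comp z hs
  have hc := mdifferentiableAt_of_contMDiffAt (contMDiffAt_chart hy)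
  have hF : MDifferentiableAt 𝓘(ℝ, E) 𝓘(ℝ, E') (inCharts (E := E) (E' := E') f x y) z := hc.comp z hfs
  have hs' := mdifferentiableAt_of_contMDiffAt
    (contMDiffAt_chart_symm (x := y) (z := inCharts (E := E) (E' := E') f x y z) ((chartAt E' y).map_source hy))
  rw [← pullback_eq_fderiv]
  unfold localRep
  rw [← pullback_comp_apply hf hs, ← pullback_comp_apply hs' hF]
  apply pullback_congr
  filter_upwards [hfs.continuousAt.preimage_mem_nhds ((chartAt E' y).open_source.mem_nhds hy)]
    with w hw
  exact ((chartAt E' y).left_inv hw).symm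

theorem eventually_mdifferentiableAt {f : N → N'} {x : N}
    (hf : ContMDiffAt 𝓘(ℝ, E) 𝓘(ℝ, E') ∞ f x) :
    ∀ᶠ y in 𝓝 x, MDifferentiableAt 𝓘(ℝ, E) 𝓘(ℝ, E') f y := by
  -- Smoothness of finite order at a point spreads to a neighbourhood, so the order is lowered to
  -- `1`.
  have h : ContMDiffAt 𝓘(ℝ, E) 𝓘(ℝ, E') 1 f x := hf.of_le (by norm_cast)
  obtain ⟨u, hu, h⟩ := (contMDiffAt_iff_contMDiffOn_nhds (by simp)).1 h
  filter_upwards [eventually_mem_nhds_iff.2 hu] with y hy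
  exact (h.contMDiffAt hy).mdifferentiableAt (by simp)

theorem localRep_pullback_eventuallyEq {f : N → N'} {x : N} {y : N'} {z : E}
    (hz : z ∈ (chartAt E x).target) (hy : f ((chartAt E x).symm z) ∈ (chartAt E' y).source)
    (hf : ContMDiffAt 𝓘(ℝ, E) 𝓘(ℝ, E') ∞ f ((chartAt E x).symm z)) (η : DForm E' N' k) :
    localRep (pullback f η) x =ᶠ[𝓝 z] fun z =>
      (localRep η y (inCharts (E := E) (E' := E') f x y z)).compContinuousLinearMap (fderiv ℝ (inCharts (E := E) (E' := E') f x y) z) := by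
  have hc : ContinuousAt (chartAt E x).symm z := (contMDiffAt_chart_symm hz).continuousAt
  have hfc : ContinuousAt (f ∘ (chartAt E x).symm) z := hf.continuousAt.comp hc
  filter_upwards [(chartAt E x).open_target.mem_nhds hz,
    hfc.preimage_mem_nhds ((chartAt E' y).open_source.mem_nhds hy),
    hc.eventually (eventually_mdifferentiableAt hf)] with w h1 h2 h3
  exact localRep_pullback h1 h2 h3 η

/-- A form is smooth at a point if its expression in the preferred chart there is. -/
def SmoothFormAt (η : DForm E N k) (x : N) : Prop :=
  ContDiffAt ℝ ∞ (localRep η x) (chartAt E x x)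

theorem contDiffAt_localRep_pullback [FiniteDimensional ℝ E] {f : N → N'} {x : N} {y : N'} {z : E}
    (hz : z ∈ (chartAt E x).target) (hy : f ((chartAt E x).symm z) ∈ (chartAt E' y).source)
    (hf : ContMDiffAt 𝓘(ℝ, E) 𝓘(ℝ, E') ∞ f ((chartAt E x).symm z)) {η : DForm E' N' k}
    (hη : ContDiffAt ℝ ∞ (localRep η y) (chartAt E' y (f ((chartAt E x).symm z)))) :
    ContDiffAt ℝ ∞ (localRep (pullback f η) x) z := by
  have hF := contDiffAt_inCharts hz hy hf
  exact (contDiffAt_compContinuousLinearMap (ContDiffAt.comp z hη hF)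
    (hF.fderiv_right (m := ∞) (by simp))).congr_of_eventuallyEq
      (localRep_pullback_eventuallyEq hz hy hf η)

theorem pullback_id (η : DForm E N k) : pullback (fun y : N => y) η = η :=
  funext (pullback_id_apply η)

/-- `SmoothFormAt` refers to the chart centred at the point itself. Pulling back by the identity,
read from another chart, transports smoothness to that chart. -/
theorem SmoothFormAt.contDiffAt_localRep [FiniteDimensional ℝ E] {η : DForm E N k} {x : N} {z : E}
    (hz : z ∈ (chartAt E x).target) (h : SmoothFormAt η ((chartAt E x).symm z)) :
    ContDiffAt ℝ ∞ (localRep η x) z := by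
  have := contDiffAt_localRep_pullback (f := fun y : N => y) (η := η) hz
    (mem_chart_source E ((chartAt E x).symm z)) contMDiffAt_id h
  rwa [pullback_id] at this

theorem isSmoothForm_iff [FiniteDimensional ℝ E] {η : DForm E N k} :
    IsSmoothForm η ↔ ∀ x, SmoothFormAt η x := by
  constructor
  · intro h x
    exact (h x).contDiffAt ((chartAt E x).open_target.mem_nhds (mem_chart_target E x))
  · intro h x z hz
    exact ((h _).contDiffAt_localRep hz).contDiffWithinAt

theorem SmoothFormAt.pullback [FiniteDimensional ℝ E] [FiniteDimensional ℝ E'] {f : N → N'} {x : N}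
    {η : DForm E' N' k} (hη : SmoothFormAt η (f x)) (hf : ContMDiffAt 𝓘(ℝ, E) 𝓘(ℝ, E') ∞ f x) :
    SmoothFormAt (SU2Bundle.pullback (E := E) f η) x := by
  have h0 : (chartAt E x).symm (chartAt E x x) = x := (chartAt E x).left_inv (mem_chart_source E x)
  exact contDiffAt_localRep_pullback (y := f x) (mem_chart_target E x)
    (by rw [h0]; exact mem_chart_source E' _) (by rwa [h0]) (by rwa [h0])

theorem localRep_congr {η η' : DForm E N k} {x : N} {z : E}
    (h : η ((chartAt E x).symm z) = η' ((chartAt E x).symm z)) :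
    localRep η x z = localRep η' x z :=
  pullback_congr_form h

theorem localRep_eventuallyEq {η η' : DForm E N k} {x : N} {z : E}
    (hz : z ∈ (chartAt E x).target) (h : ∀ᶠ y in 𝓝 ((chartAt E x).symm z), η y = η' y) :
    localRep η x =ᶠ[𝓝 z] localRep η' x := by
  filter_upwards [((chartAt E x).symm.continuousAt hz).eventually h] with w hw
  exact localRep_congr hw

theorem localRep_eventuallyEq_self {η η' : DForm E N k} {x : N}
    (h : ∀ᶠ y in 𝓝 x, η y = η' y) :
    localRep η x =ᶠ[𝓝 (chartAt E x x)] localRep η' x :=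
  localRep_eventuallyEq (mem_chart_target E x)
    (by rwa [(chartAt E x).left_inv (mem_chart_source E x)])

theorem SmoothFormAt.congr {η η' : DForm E N k} {x : N} (hη : SmoothFormAt η x)
    (h : ∀ᶠ y in 𝓝 x, η y = η' y) : SmoothFormAt η' x :=
  ContDiffAt.congr_of_eventuallyEq hη (localRep_eventuallyEq_self h).symm

theorem extD_congr {η η' : DForm E N k} {x : N} (h : ∀ᶠ y in 𝓝 x, η y = η' y) :
    extD η x = extD η' x := by
  simp only [extD]
  rw [(localRep_eventuallyEq_self h).extDeriv_eq]

theorem contDiffAt_differentiableAt {V W : Type*} [NormedAddCommGroup V] [NormedSpace ℝ V]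
    [NormedAddCommGroup W] [NormedSpace ℝ W] {f : V → W} {x : V} (h : ContDiffAt ℝ ∞ f x) :
    DifferentiableAt ℝ f x := h.differentiableAt (by simp)

theorem localRep_add (η η' : DForm E N k) (x : N) : localRep (η + η') x =
    localRep η x + localRep η' x := rfl

theorem localRep_sub (η η' : DForm E N k) (x : N) : localRep (η - η') x =
    localRep η x - localRep η' x := rfl

theorem SmoothFormAt.add {η η' : DForm E N k} {x : N} (h : SmoothFormAt η x)
    (h' : SmoothFormAt η' x) : SmoothFormAt (η + η') x := ContDiffAt.add h h'

theorem SmoothFormAt.sub {η η' : DForm E N k} {x : N} (h : SmoothFormAt η x)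
    (h' : SmoothFormAt η' x) : SmoothFormAt (η - η') x := ContDiffAt.sub h h'

theorem extD_add {η η' : DForm E N k} {x : N} (h : SmoothFormAt η x) (h' : SmoothFormAt η' x) :
    extD (η + η') x = extD η x + extD η' x := by
  simp only [extD, localRep_add]
  rw [extDeriv_add (contDiffAt_differentiableAt h) (contDiffAt_differentiableAt h')]
  rfl

theorem extD_sub {η η' : DForm E N k} {x : N} (h : SmoothFormAt η x) (h' : SmoothFormAt η' x) :
    extD (η - η') x = extD η x - extD η' x := by
  have h2 := extD_add (h.sub h') h'
  rw [sub_add_cancel] at h2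
  rw [h2, add_sub_cancel_right]

theorem extD_zero_form : extD (0 : DForm E N k) = 0 := by
  have h0 : ∀ x : N, SmoothFormAt (0 : DForm E N k) x := fun x =>
    show ContDiffAt ℝ ∞ (fun _ => (0 : E [⋀^Fin k]→L[ℝ] ℝ)) _ from contDiffAt_const
  have h := fun x : N => extD_sub (h0 x) (h0 x)
  funext x
  have := h x
  rwa [sub_self, sub_self] at this

end FormCalculus

/-! ### The exterior derivative: independence of charts, naturality, d ∘ d = 0 -/

section ExteriorDerivative

variable {E E' : Type*} [NormedAddCommGroup E] [NormedSpace ℝ E]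
  [NormedAddCommGroup E'] [NormedSpace ℝ E']
  {N N' : Type*} [TopologicalSpace N] [ChartedSpace E N]
  [TopologicalSpace N'] [ChartedSpace E' N'] {k : ℕ}

theorem SmoothFormAt.smul {η : DForm E N k} {f : N → ℝ} {x : N} (h : SmoothFormAt η x)
    (hf : ContDiffAt ℝ ∞ (f ∘ (chartAt E x).symm) (chartAt E x x)) :
    SmoothFormAt (fun y => f y • η y) x :=
  ContDiffAt.smul (f := f ∘ (chartAt E x).symm) hf h

/-- A function, as a `0`-form. -/
def funForm (E : Type*) [NormedAddCommGroup E] [NormedSpace ℝ E] {N : Type*} [TopologicalSpace N]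
    [ChartedSpace E N] (f : N → ℝ) : DForm E N 0 :=
  fun x => ContinuousAlternatingMap.constOfIsEmpty ℝ (TangentSpace 𝓘(ℝ, E) x) (Fin 0) (f x)

theorem localRep_funForm (f : N → ℝ) (x : N) : localRep (funForm E f) x =
    fun z => ContinuousAlternatingMap.constOfIsEmpty ℝ E (Fin 0) (f ((chartAt E x).symm z)) := rfl

theorem smoothFormAt_funForm {f : N → ℝ} {x : N}
    (hf : ContDiffAt ℝ ∞ (f ∘ (chartAt E x).symm) (chartAt E x x)) :
    SmoothFormAt (funForm E f) x :=
  (ContinuousAlternatingMap.constOfIsEmptyLIE ℝ E ℝ (Fin 0)).contDiff.contDiffAt.comp _ hf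

theorem minSmoothness_two_le_infty : minSmoothness ℝ 2 ≤ ∞ := by
  rw [minSmoothness_of_isRCLikeNormedField]
  exact WithTop.coe_le_coe.2 (le_top : (2 : ℕ∞) ≤ ⊤)

variable [IsManifold 𝓘(ℝ, E) ∞ N] [IsManifold 𝓘(ℝ, E') ∞ N']

/-- `extD` uses a different chart at each point. Naturality of `extDeriv` under the transition map
`G` shows that the single chart at `x` computes it on its whole domain. -/
theorem localRep_extD {η : DForm E N k} {x : N} {z : E}
    (hz : z ∈ (chartAt E x).target) (h : SmoothFormAt η ((chartAt E x).symm z)) :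
    localRep (extD η) x z = extDeriv (localRep η x) z := by
  set y := (chartAt E x).symm z with hy
  have hs := contMDiffAt_chart_symm hz
  have hG : ContDiffAt ℝ ∞ (inCharts (E := E) (E' := E) (fun w : N => w) x y) z :=
    contDiffAt_inCharts hz (mem_chart_source E y) contMDiffAt_id
  set G := inCharts (E := E) (E' := E) (fun w : N => w) x y
  -- The coordinate derivative is treated as a form on the model space, so that functoriality of
  -- `pullback` applies to it.
  obtain ⟨B, hB⟩ : ∃ B : DForm E E (k + 1), B = fun z => extDeriv (localRep η y) z := ⟨_, rfl⟩
  have h1 : localRep (extD η) x z = pullback (E := E) (E' := E) G B z := by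
    have hc := mdifferentiableAt_of_contMDiffAt (contMDiffAt_chart (mem_chart_source E y))
    refine Eq.trans ?_
      (pullback_comp_apply hc (mdifferentiableAt_of_contMDiffAt hs) B).symm
    refine pullback_congr_form ?_
    rw [hB]; rfl
  have h2 := localRep_pullback_eventuallyEq (f := fun w : N => w) (y := y) hz
    (mem_chart_source E y) contMDiffAt_id η
  rw [pullback_id] at h2
  rw [h1, h2.extDeriv_eq]
  refine (pullback_eq_fderiv G B z).trans ?_
  rw [hB]
  have h' : ContDiffAt ℝ ∞ (localRep η y) (G z) := h
  exact (extDeriv_pullback (f := G) (contDiffAt_differentiableAt h') hG minSmoothness_two_le_infty).symm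

theorem extD_pullback {f : N → N'} {x : N} {η : DForm E' N' k} (hη : SmoothFormAt η (f x))
    (hf : ContMDiffAt 𝓘(ℝ, E) 𝓘(ℝ, E') ∞ f x) :
    extD (pullback (E := E) f η) x = pullback (E := E) f (extD η) x := by
  have h0 : (chartAt E x).symm (chartAt E x x) = x := (chartAt E x).left_inv (mem_chart_source E x)
  have hz := mem_chart_target E x
  have hf' : ContMDiffAt 𝓘(ℝ, E) 𝓘(ℝ, E') ∞ f ((chartAt E x).symm (chartAt E x x)) := by rwa [h0]
  have hy : f ((chartAt E x).symm (chartAt E x x)) ∈ (chartAt E' (f x)).source := by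
    rw [h0]; exact mem_chart_source E' (f x)
  obtain ⟨F, hFdef⟩ : ∃ F, F = inCharts (E := E) (E' := E') f x (f x) := ⟨_, rfl⟩
  obtain ⟨B, hB⟩ : ∃ B : DForm E' E' (k + 1), B = fun z => extDeriv (localRep η (f x)) z :=
    ⟨_, rfl⟩
  have hF : ContDiffAt ℝ ∞ F (chartAt E x x) := by
    rw [hFdef]; exact contDiffAt_inCharts hz hy hf'
  have hFx : F (chartAt E x x) = chartAt E' (f x) (f x) := by simp [hFdef, inCharts, h0]
  have h1 : extDeriv (localRep (pullback (E := E) f η) x) (chartAt E x x) =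
      pullback (E := E) (E' := E') F B (chartAt E x x) := by
    refine Eq.trans ?_ (pullback_eq_fderiv F B (chartAt E x x)).symm
    rw [(localRep_pullback_eventuallyEq hz hy hf' η).extDeriv_eq, ← hFdef, hB]
    refine extDeriv_pullback (contDiffAt_differentiableAt ?_) hF minSmoothness_two_le_infty
    rw [hFx]; exact hη
  have hc := contMDiffAt_chart (mem_chart_source E x)
  have hc' := contMDiffAt_chart (mem_chart_source E' (f x))
  have h2 : extD (pullback (E := E) f η) x =
      pullback (E := E) (E' := E') (F ∘ chartAt E x) B x := by
    rw [pullback_comp_apply (mdifferentiableAt_of_contMDiffAt hF.contMDiffAt)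
      (mdifferentiableAt_of_contMDiffAt hc)]
    exact (congrArg (fun A : E [⋀^Fin (k + 1)]→L[ℝ] ℝ => A.compContinuousLinearMap
      (mfderiv 𝓘(ℝ, E) 𝓘(ℝ, E) (chartAt E x) x)) h1)
  have h3 : F ∘ chartAt E x =ᶠ[𝓝 x] chartAt E' (f x) ∘ f := by
    filter_upwards [(chartAt E x).open_source.mem_nhds (mem_chart_source E x)] with w hw
    simp [hFdef, inCharts, (chartAt E x).left_inv hw]
  rw [h2, pullback_congr h3, pullback_comp_apply (mdifferentiableAt_of_contMDiffAt hc')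
    (mdifferentiableAt_of_contMDiffAt hf)]
  refine pullback_congr_form ?_
  rw [hB]
  rfl

theorem localRep_extD_eventuallyEq {η : DForm E N k} {x : N}
    (h : ∀ᶠ y in 𝓝 x, SmoothFormAt η y) :
    localRep (extD η) x =ᶠ[𝓝 (chartAt E x x)] extDeriv (localRep η x) := by
  have hz := mem_chart_target E x
  have hc := (chartAt E x).symm.continuousAt hz
  rw [ContinuousAt, (chartAt E x).left_inv (mem_chart_source E x)] at hc
  filter_upwards [hc.eventually h, (chartAt E x).open_target.mem_nhds hz] with w h1 h2
  exact localRep_extD h2 h1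

theorem SmoothFormAt.extD {η : DForm E N k} {x : N} (h : ∀ᶠ y in 𝓝 x, SmoothFormAt η y) :
    SmoothFormAt (SU2Bundle.extD η) x := by
  refine ContDiffAt.congr_of_eventuallyEq ?_ (localRep_extD_eventuallyEq h)
  have h1 : ContDiffAt ℝ ∞ (fderiv ℝ (localRep η x)) (chartAt E x x) :=
    ContDiffAt.fderiv_right (m := ∞) h.self_of_nhds (by simp)
  exact (ContinuousAlternatingMap.alternatizeUncurryFinCLM ℝ E ℝ).contDiff.contDiffAt.comp _ h1

theorem extD_extD {η : DForm E N k} {x : N} (h : ∀ᶠ y in 𝓝 x, SmoothFormAt η y) :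
    extD (extD η) x = 0 := by
  have h1 : extDeriv (localRep (extD η) x) (chartAt E x x) = 0 := by
    rw [(localRep_extD_eventuallyEq h).extDeriv_eq]
    exact extDeriv_extDeriv_apply (r := ∞) h.self_of_nhds minSmoothness_two_le_infty
  show (extDeriv (localRep (extD η) x) (chartAt E x x)).compContinuousLinearMap _ = 0
  rw [h1]
  rfl

theorem contDiffAt_comp_chart_symm {f : N → ℝ} {x : N}
    (hf : ContMDiffAt 𝓘(ℝ, E) 𝓘(ℝ, ℝ) ∞ f x) :
    ContDiffAt ℝ ∞ (f ∘ (chartAt E x).symm) (chartAt E x x) := by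
  refine contMDiffAt_iff_contDiffAt.1 (ContMDiffAt.comp _ ?_
    (contMDiffAt_chart_symm (mem_chart_target E x)))
  rwa [(chartAt E x).left_inv (mem_chart_source E x)]

/-- A form vanishing in every preferred chart vanishes. -/
theorem eq_of_localRep_eq {η η' : DForm E N k} {x : N}
    (h : localRep η x (chartAt E x x) = localRep η' x (chartAt E x x)) : η x = η' x := by
  have hc := mdifferentiableAt_of_contMDiffAt (contMDiffAt_chart (mem_chart_source E x))
  have hs := mdifferentiableAt_of_contMDiffAt (contMDiffAt_chart_symm (mem_chart_target E x))
  have key : ∀ ζ : DForm E N k, ζ x = pullback (E := E) (E' := E) (chartAt E x) (localRep ζ x) x := by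
    intro ζ
    rw [localRep, ← pullback_comp_apply hs hc, ← pullback_id_apply ζ x]
    apply pullback_congr
    filter_upwards [(chartAt E x).open_source.mem_nhds (mem_chart_source E x)] with w hw
    exact ((chartAt E x).left_inv hw).symm
  rw [key η, key η']
  exact pullback_congr_form h

end ExteriorDerivative

namespace TotalSpace

/-! ### Coordinates over v₂ ≠ 0 and the maps of the bundle in them -/

section Coordinates

variable {M : Type*} [MulAction SU2 M]

/-- The point with coordinates `(q, y)` in the trivialization over `v₂ ≠ 0`. -/
def ofCoords (q : ℍ[ℝ]) (y : M) : TotalSpace M := mk (affine q) y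

/-- The base coordinate `q = v₁ v₂⁻¹`. -/
def baseCoord (p : TotalSpace M) : ℍ[ℝ] := (trivFun p).1

/-- The fiber coordinate in the trivialization over `v₂ ≠ 0`. -/
def fiberCoord (p : TotalSpace M) : M := (trivFun p).2

@[simp] theorem baseCoord_ofCoords (q : ℍ[ℝ]) (y : M) : baseCoord (ofCoords q y) = q := by
  rw [baseCoord, ofCoords, trivFun_mk_affine]

@[simp] theorem fiberCoord_ofCoords (q : ℍ[ℝ]) (y : M) : fiberCoord (ofCoords q y) = y := by
  rw [fiberCoord, ofCoords, trivFun_mk_affine]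

theorem ofCoords_mem (q : ℍ[ℝ]) (y : M) : ofCoords q y ∈ trivSource M := affine_snd_ne_zero q

theorem ofCoords_coords {p : TotalSpace M} (hp : p ∈ trivSource M) :
    ofCoords (baseCoord p) (fiberCoord p) = p := mk_affine_trivFun hp

theorem swap_ofCoords_mem {q : ℍ[ℝ]} (y : M) : swap (ofCoords q y) ∈ trivSource M ↔ q ≠ 0 := by
  change (√(1 + ‖q‖ ^ 2))⁻¹ • q ≠ 0 ↔ q ≠ 0
  simp [sqrt_ne_zero]

theorem swap_mem_iff {p : TotalSpace M} (hp : p ∈ trivSource M) :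
    swap p ∈ trivSource M ↔ baseCoord p ≠ 0 := by
  rw [← swap_ofCoords_mem (fiberCoord p), ofCoords_coords hp]

theorem swap_mem_of_notMem {p : TotalSpace M} (hp : p ∉ trivSource M) :
    swap p ∈ trivSource M := by
  obtain ⟨v, x, rfl⟩ := exists_mk p
  exact UnitPairs.fst_ne_zero (not_not.1 hp)

theorem swap_ofCoords {q : ℍ[ℝ]} (hq : q ≠ 0) (y : M) :
    swap (ofCoords q y) = ofCoords q⁻¹ (unitPart q • y) := by
  rw [← ofCoords_coords ((swap_ofCoords_mem y).2 hq)]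
  have := trivFun_swap_mk_affine hq y
  rw [baseCoord, fiberCoord, show trivFun (swap (ofCoords q y)) = _ from this]

theorem baseCoord_swap {p : TotalSpace M} (hp : p ∈ trivSource M) (h : baseCoord p ≠ 0) :
    baseCoord (swap p) = (baseCoord p)⁻¹ := by
  rw [← ofCoords_coords hp, swap_ofCoords (by simpa using h)]; simp

theorem mk_eq_ofCoords {v : UnitPairs} (h : v.snd ≠ 0) (x : M) :
    mk v x = ofCoords (v.fst * v.snd⁻¹) (phase v • x) := by
  rw [ofCoords, affine_eq h, mk_smul]

theorem leftMul_mem (a b : SU2) {p : TotalSpace M} :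
    leftMul a b p ∈ trivSource M ↔ p ∈ trivSource M := by
  obtain ⟨v, x, rfl⟩ := exists_mk p
  change (b : ℍ[ℝ]) * v.snd ≠ 0 ↔ v.snd ≠ 0
  simp [ne_zero_of_mem_unit_sphere b]

theorem swap_leftMul (a b : SU2) (p : TotalSpace M) :
    swap (leftMul a b p) = leftMul b a (swap p) := by
  obtain ⟨v, x, rfl⟩ := exists_mk p
  rfl

theorem unitPart_mul (b : SU2) {q : ℍ[ℝ]} (hq : q ≠ 0) :
    unitPart (b * q) = b * unitPart q := by
  have hb : (b : ℍ[ℝ]) ≠ 0 := ne_zero_of_mem_unit_sphere b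
  apply Subtype.ext
  rw [coe_unitPart (mul_ne_zero hb hq)]
  simp [coe_unitPart hq, norm_mul]

theorem unitPart_coe (b : SU2) : unitPart (b : ℍ[ℝ]) = b := by
  have hb : (b : ℍ[ℝ]) ≠ 0 := ne_zero_of_mem_unit_sphere b
  apply Subtype.ext
  simp [coe_unitPart hb]

/-- Only `b` reaches the fiber coordinate, since it multiplies the phase of `v₂`. -/
theorem leftMul_ofCoords (a b : SU2) (q : ℍ[ℝ]) (y : M) :
    leftMul a b (ofCoords q y) = ofCoords (a * q * (b : ℍ[ℝ])⁻¹) (b • y) := by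
  have hb : (b : ℍ[ℝ]) ≠ 0 := ne_zero_of_mem_unit_sphere b
  change mk ((affine q).leftMul a b) y = _
  have h1 : ((affine q).leftMul a b).snd ≠ 0 := mul_ne_zero hb (affine_snd_ne_zero q)
  rw [mk_eq_ofCoords h1]
  have h2 : phase ((affine q).leftMul a b) = b := by
    have h3 : phase ((affine q).leftMul a b) = b * phase (affine q) := by
      rw [phase, if_neg h1, phase, if_neg (affine_snd_ne_zero q)]
      exact unitPart_mul b (affine_snd_ne_zero q)
    rw [h3, phase_affine, mul_one]
  rw [h2]
  congr 1
  change (a : ℍ[ℝ]) * (affine q).fst * ((b : ℍ[ℝ]) * (affine q).snd)⁻¹ = _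
  simp [affine, smul_inv₀, smul_smul, mul_inv_cancel₀ (sqrt_ne_zero q)]

theorem baseCoord_leftMul (a b : SU2) {p : TotalSpace M} (hp : p ∈ trivSource M) :
    baseCoord (leftMul a b p) = a * baseCoord p * (b : ℍ[ℝ])⁻¹ := by
  rw [← ofCoords_coords hp, leftMul_ofCoords]; simp

theorem fiberCoord_leftMul (a b : SU2) {p : TotalSpace M} (hp : p ∈ trivSource M) :
    fiberCoord (leftMul a b p) = b • fiberCoord p := by
  rw [← ofCoords_coords hp, leftMul_ofCoords]; simp

end Coordinates

/-! ### Smoothness of the coordinates, the exchange, the left multiplications and the fiber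
inclusions -/

section Smoothness

variable {E : Type*} [NormedAddCommGroup E] [NormedSpace ℝ E] {M : Type*} [TopologicalSpace M]
  [ChartedSpace E M] [MulAction SU2 M] [ContinuousSMul SU2 M]

-- All points of `trivSource M` use the same trivialization, so their charts contain whole copies of
-- `ℍ` in the base direction. Rays and segments of the base therefore stay in one chart.
open Classical in
theorem chartAt_of_mem {p : TotalSpace M} (hp : p ∈ trivSource M) :
    chartAt (ℍ[ℝ] × E) p = chart true (chartAt E (fiberCoord p)) := by
  have h : p ∈ (trivs M true).source := hp
  change chart (decide (p ∈ (trivs M true).source))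
    (chartAt E (trivs M (decide (p ∈ (trivs M true).source)) p).2) = _
  rw [decide_eq_true h]
  rfl

open Classical in
theorem chartAt_of_notMem {p : TotalSpace M} (hp : p ∉ trivSource M) :
    chartAt (ℍ[ℝ] × E) p = chart false (chartAt E (fiberCoord (swap p))) := by
  have h : p ∉ (trivs M true).source := hp
  change chart (decide (p ∈ (trivs M true).source))
    (chartAt E (trivs M (decide (p ∈ (trivs M true).source)) p).2) = _
  rw [decide_eq_false h]
  rfl

theorem chartAt_apply {p : TotalSpace M} (hp : p ∈ trivSource M) (p' : TotalSpace M) :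
    chartAt (ℍ[ℝ] × E) p p' = (baseCoord p', chartAt E (fiberCoord p) (fiberCoord p')) := by
  rw [chartAt_of_mem hp]; rfl

theorem chartAt_symm_apply {p : TotalSpace M} (hp : p ∈ trivSource M) (z : ℍ[ℝ] × E) :
    (chartAt (ℍ[ℝ] × E) p).symm z = ofCoords z.1 ((chartAt E (fiberCoord p)).symm z.2) := by
  rw [chartAt_of_mem hp]; rfl

theorem mem_chartAt_target {p : TotalSpace M} (hp : p ∈ trivSource M) {z : ℍ[ℝ] × E} :
    z ∈ (chartAt (ℍ[ℝ] × E) p).target ↔ z.2 ∈ (chartAt E (fiberCoord p)).target := by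
  rw [chartAt_of_mem hp]
  change (z.1 ∈ Set.univ ∧ z.2 ∈ _) ∧ _ ∈ Set.univ ↔ _
  simp

theorem mem_chartAt_source {p : TotalSpace M} (hp : p ∈ trivSource M) {p' : TotalSpace M} :
    p' ∈ (chartAt (ℍ[ℝ] × E) p).source ↔
      p' ∈ trivSource M ∧ fiberCoord p' ∈ (chartAt E (fiberCoord p)).source := by
  rw [chartAt_of_mem hp]
  change (p' ∈ trivSource M ∧ (baseCoord p' ∈ Set.univ ∧ fiberCoord p' ∈ _)) ↔ _
  simp

theorem chartAt_apply_of_notMem {p : TotalSpace M} (hp : p ∉ trivSource M) (p' : TotalSpace M) :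
    chartAt (ℍ[ℝ] × E) p p' =
      (baseCoord (swap p'), chartAt E (fiberCoord (swap p)) (fiberCoord (swap p'))) := by
  rw [chartAt_of_notMem hp]; rfl

theorem chartAt_symm_apply_of_notMem {p : TotalSpace M} (hp : p ∉ trivSource M) (z : ℍ[ℝ] × E) :
    (chartAt (ℍ[ℝ] × E) p).symm z =
      swap (ofCoords z.1 ((chartAt E (fiberCoord (swap p))).symm z.2)) := by
  rw [chartAt_of_notMem hp]; rfl

theorem mem_chartAt_target_of_notMem {p : TotalSpace M} (hp : p ∉ trivSource M) {z : ℍ[ℝ] × E} :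
    z ∈ (chartAt (ℍ[ℝ] × E) p).target ↔ z.2 ∈ (chartAt E (fiberCoord (swap p))).target := by
  rw [chartAt_of_notMem hp]
  change (z.1 ∈ Set.univ ∧ z.2 ∈ _) ∧ _ ∈ Set.univ ↔ _
  simp

theorem trivSource_mem_nhds {p : TotalSpace M} (hp : p ∈ trivSource M) : trivSource M ∈ 𝓝 p :=
  isOpen_trivSource.mem_nhds hp

variable [IsManifold 𝓘(ℝ, E) ∞ M] [ContMDiffSMul (𝓡 3) 𝓘(ℝ, E) ∞ SU2 M]

theorem contMDiffAt_baseCoord {p : TotalSpace M} (hp : p ∈ trivSource M) :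
    ContMDiffAt 𝓘(ℝ, ℍ[ℝ] × E) 𝓘(ℝ, ℍ[ℝ]) ∞ baseCoord p := by
  have h := contMDiffAt_chart (E := ℍ[ℝ] × E) (mem_chart_source (ℍ[ℝ] × E) p)
  have h1 : ContMDiffAt 𝓘(ℝ, ℍ[ℝ] × E) 𝓘(ℝ, ℍ[ℝ]) ∞ (fun z : ℍ[ℝ] × E => z.1)
    (chartAt (ℍ[ℝ] × E) p p) := contDiffAt_fst.contMDiffAt
  refine (h1.comp p h).congr_of_eventuallyEq (Eventually.of_forall fun p' => ?_)
  simp [chartAt_apply hp]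

theorem contMDiffAt_fiberCoord {p : TotalSpace M} (hp : p ∈ trivSource M) :
    ContMDiffAt 𝓘(ℝ, ℍ[ℝ] × E) 𝓘(ℝ, E) ∞ fiberCoord p := by
  have h := contMDiffAt_chart (E := ℍ[ℝ] × E) (mem_chart_source (ℍ[ℝ] × E) p)
  have h1 : ContMDiffAt 𝓘(ℝ, ℍ[ℝ] × E) 𝓘(ℝ, E) ∞ (fun z : ℍ[ℝ] × E => z.2)
    (chartAt (ℍ[ℝ] × E) p p) := contDiffAt_snd.contMDiffAt
  have h2 : ContMDiffAt 𝓘(ℝ, E) 𝓘(ℝ, E) ∞ (chartAt E (fiberCoord p)).symm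
      (chartAt (ℍ[ℝ] × E) p p).2 := contMDiffAt_chart_symm (by
    rw [chartAt_apply hp]; exact mem_chart_target E _)
  refine ((h2.comp _ h1).comp p h).congr_of_eventuallyEq ?_
  filter_upwards [(chartAt (ℍ[ℝ] × E) p).open_source.mem_nhds (mem_chart_source _ p)] with p' hp'
  rw [Function.comp_apply, Function.comp_apply, chartAt_apply hp,
    (chartAt E (fiberCoord p)).left_inv ((mem_chartAt_source hp).1 hp').2]

section Maps

variable {F : Type*} [NormedAddCommGroup F] [NormedSpace ℝ F] {N : Type*} [TopologicalSpace N]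
  [ChartedSpace F N]

theorem contMDiffAt_ofCoords {f : N → ℍ[ℝ]} {g : N → M} {x : N}
    (hf : ContMDiffAt 𝓘(ℝ, F) 𝓘(ℝ, ℍ[ℝ]) ∞ f x) (hg : ContMDiffAt 𝓘(ℝ, F) 𝓘(ℝ, E) ∞ g x) :
    ContMDiffAt 𝓘(ℝ, F) 𝓘(ℝ, ℍ[ℝ] × E) ∞ (fun y => ofCoords (f y) (g y)) x := by
  have hp := ofCoords_mem (f x) (g x)
  have he : fiberCoord (ofCoords (f x) (g x)) = g x := by simp
  have h1 : ContMDiffAt 𝓘(ℝ, F) 𝓘(ℝ, ℍ[ℝ] × E) ∞ (fun y => (f y, chartAt E (g x) (g y))) x :=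
    hf.prodMk_space ((contMDiffAt_chart (mem_chart_source E (g x))).comp x hg)
  have h2 : ContMDiffAt 𝓘(ℝ, ℍ[ℝ] × E) 𝓘(ℝ, ℍ[ℝ] × E) ∞
      (chartAt (ℍ[ℝ] × E) (ofCoords (f x) (g x))).symm (f x, chartAt E (g x) (g x)) :=
    contMDiffAt_chart_symm ((mem_chartAt_target hp).2 (by rw [he]; exact mem_chart_target E _))
  refine (h2.comp x h1).congr_of_eventuallyEq ?_
  filter_upwards [hg.continuousAt.preimage_mem_nhds
    ((chartAt E (g x)).open_source.mem_nhds (mem_chart_source E _))] with y hy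
  rw [Function.comp_apply, chartAt_symm_apply hp, he, (chartAt E (g x)).left_inv hy]

theorem contMDiffAt_swap (p : TotalSpace M) :
    ContMDiffAt 𝓘(ℝ, ℍ[ℝ] × E) 𝓘(ℝ, ℍ[ℝ] × E) ∞ swap p := by
  have hc := contMDiffAt_chart (E := ℍ[ℝ] × E) (mem_chart_source (ℍ[ℝ] × E) p)
  by_cases hp : p ∈ trivSource M
  · by_cases hs : swap p ∈ trivSource M
    · have hq := (swap_mem_iff hp).1 hs
      have hb := contMDiffAt_baseCoord (E := E) hp
      have h1 := (contDiffAt_quaternion_inv hq).contMDiffAt.comp p hb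
      have h2 := ((contMDiffAt_unitPart hq).comp p hb).smul (contMDiffAt_fiberCoord (E := E) hp)
      refine (contMDiffAt_ofCoords h1 h2).congr_of_eventuallyEq ?_
      filter_upwards [trivSource_mem_nhds hp,
        continuous_swap'.continuousAt.preimage_mem_nhds (trivSource_mem_nhds hs)] with w hw hw'
      conv_lhs => rw [← ofCoords_coords hw, swap_ofCoords ((swap_mem_iff hw).1 hw')]
      rfl
    -- The chart at `swap p` comes from the other trivialization and is the chart at `p` composed
    -- with `swap`; between these two charts `swap` is the identity.
    · have he : fiberCoord (swap (swap p)) = fiberCoord p := by rw [swap_swap]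
      have h2 : ContMDiffAt 𝓘(ℝ, ℍ[ℝ] × E) 𝓘(ℝ, ℍ[ℝ] × E) ∞
          (chartAt (ℍ[ℝ] × E) (swap p)).symm (chartAt (ℍ[ℝ] × E) p p) :=
        contMDiffAt_chart_symm ((mem_chartAt_target_of_notMem hs).2 (by
          rw [he, chartAt_apply hp]; exact mem_chart_target E _))
      refine (h2.comp p hc).congr_of_eventuallyEq ?_
      filter_upwards [(chartAt (ℍ[ℝ] × E) p).open_source.mem_nhds (mem_chart_source _ p)]
        with w hw
      obtain ⟨h3, h4⟩ := (mem_chartAt_source hp).1 hw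
      rw [Function.comp_apply, chartAt_symm_apply_of_notMem hs, he, chartAt_apply hp,
        (chartAt E (fiberCoord p)).left_inv h4, ofCoords_coords h3]
  · have hs := swap_mem_of_notMem hp
    have h2 : ContMDiffAt 𝓘(ℝ, ℍ[ℝ] × E) 𝓘(ℝ, ℍ[ℝ] × E) ∞
        (chartAt (ℍ[ℝ] × E) (swap p)).symm (chartAt (ℍ[ℝ] × E) p p) :=
      contMDiffAt_chart_symm ((mem_chartAt_target hs).2 (by
        rw [chartAt_apply_of_notMem hp]; exact mem_chart_target E _))
    refine (h2.comp p hc).congr_of_eventuallyEq ?_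
    filter_upwards [(chartAt (ℍ[ℝ] × E) p).open_source.mem_nhds (mem_chart_source _ p)]
      with w hw
    have h3 := (chartAt (ℍ[ℝ] × E) p).left_inv hw
    rw [chartAt_symm_apply_of_notMem hp] at h3
    rw [Function.comp_apply, chartAt_symm_apply hs]
    conv_lhs => rw [← h3, swap_swap]

theorem contMDiffAt_leftMul (a b : SU2) (p : TotalSpace M) :
    ContMDiffAt 𝓘(ℝ, ℍ[ℝ] × E) 𝓘(ℝ, ℍ[ℝ] × E) ∞ (leftMul a b) p := by
  have key : ∀ (a b : SU2) {p : TotalSpace M}, p ∈ trivSource M →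
      ContMDiffAt 𝓘(ℝ, ℍ[ℝ] × E) 𝓘(ℝ, ℍ[ℝ] × E) ∞ (leftMul a b) p := by
    intro a b p hp
    have h0 : ContDiff ℝ ∞ fun q : ℍ[ℝ] => (a : ℍ[ℝ]) * q * (b : ℍ[ℝ])⁻¹ :=
      (contDiff_const.mul contDiff_id).mul contDiff_const
    have h1 := h0.contDiffAt.contMDiffAt.comp p (contMDiffAt_baseCoord (E := E) hp)
    have h2 := (contMDiffAt_const (I := 𝓘(ℝ, ℍ[ℝ] × E)) (I' := 𝓡 3) (n := ∞) (c := b)).smul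
      (contMDiffAt_fiberCoord (E := E) hp)
    refine (contMDiffAt_ofCoords h1 h2).congr_of_eventuallyEq ?_
    filter_upwards [trivSource_mem_nhds hp] with w hw
    conv_lhs => rw [← ofCoords_coords hw, leftMul_ofCoords]
    rfl
  by_cases hp : p ∈ trivSource M
  · exact key a b hp
  -- Over `v₂ = 0` the coordinates are those of `swap p`, and conjugation by `swap` exchanges `a`
  -- and `b`.
  · have h1 : leftMul a b = swap ∘ leftMul b a ∘ swap (M := M) := by
      funext w
      rw [Function.comp_apply, Function.comp_apply, ← swap_leftMul, swap_swap]
    rw [h1]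
    exact (contMDiffAt_swap _).comp p ((key b a (swap_mem_of_notMem hp)).comp p
      (contMDiffAt_swap p))

theorem contMDiffAt_mk (v : UnitPairs) (x : M) :
    ContMDiffAt 𝓘(ℝ, E) 𝓘(ℝ, ℍ[ℝ] × E) ∞ (mk v) x := by
  have key : ∀ {v : UnitPairs}, v.snd ≠ 0 →
      ContMDiffAt 𝓘(ℝ, E) 𝓘(ℝ, ℍ[ℝ] × E) ∞ (mk (M := M) v) x := by
    intro v h
    have h2 := (contMDiffAt_const (I := 𝓘(ℝ, E)) (I' := 𝓡 3) (n := ∞) (c := phase v)).smul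
      (contMDiffAt_id (I := 𝓘(ℝ, E)) (x := x))
    refine (contMDiffAt_ofCoords contMDiffAt_const h2).congr_of_eventuallyEq
      (Eventually.of_forall fun w => mk_eq_ofCoords h w)
  by_cases h : v.snd = 0
  · exact (contMDiffAt_swap _).comp x (key (v := v.swap) (UnitPairs.fst_ne_zero h))
  · exact key h

end Maps

end Smoothness

end TotalSpace

/-! ### Smooth dependence of integrals over [0, 1] on parameters -/

section ParametricIntegral

open MeasureTheory

universe u v

variable {X : Type u} {G : Type v} [NormedAddCommGroup X] [NormedSpace ℝ X]
  [NormedAddCommGroup G] [NormedSpace ℝ G] {Ω : Set X}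

theorem hasFDerivAt_slice {F : ℝ → X → G} {t : ℝ} {x : X}
    (hF : ContDiffAt ℝ ∞ (fun p : ℝ × X => F p.1 p.2) (t, x)) :
    HasFDerivAt (F t) ((fderiv ℝ (fun p : ℝ × X => F p.1 p.2) (t, x)).comp
      (ContinuousLinearMap.inr ℝ ℝ X)) x :=
  (contDiffAt_differentiableAt hF).hasFDerivAt.comp x (hasFDerivAt_prodMk_right t x)

theorem continuousOn_fderiv_slice {F : ℝ → X → G}
    (hF : ∀ t ∈ Set.Icc (0 : ℝ) 1, ∀ x ∈ Ω, ContDiffAt ℝ ∞ (fun p : ℝ × X => F p.1 p.2) (t, x)) :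
    ContinuousOn (fun p : ℝ × X => fderiv ℝ (F p.1) p.2) (Set.Icc 0 1 ×ˢ Ω) := by
  have h1 : ContinuousOn (fun p : ℝ × X =>
      (fderiv ℝ (fun p : ℝ × X => F p.1 p.2) p).comp (ContinuousLinearMap.inr ℝ ℝ X))
      (Set.Icc 0 1 ×ˢ Ω) := by
    intro p hp
    have h2 : ContinuousAt (fderiv ℝ (fun p : ℝ × X => F p.1 p.2)) p :=
      ((hF p.1 hp.1 p.2 hp.2).fderiv_right (m := ∞) (by simp)).continuousAt
    exact (h2.clm_comp continuousAt_const).continuousWithinAt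
  exact h1.congr fun p hp => (hasFDerivAt_slice (hF p.1 hp.1 p.2 hp.2)).fderiv

theorem intervalIntegrable_fderiv_slice {F : ℝ → X → G}
    (hF : ∀ t ∈ Set.Icc (0 : ℝ) 1, ∀ x ∈ Ω, ContDiffAt ℝ ∞ (fun p : ℝ × X => F p.1 p.2) (t, x))
    {x : X} (hx : x ∈ Ω) :
    IntervalIntegrable (fun t => fderiv ℝ (F t) x) volume 0 1 := by
  refine ContinuousOn.intervalIntegrable ?_
  rw [Set.uIcc_of_le zero_le_one]
  exact (continuousOn_fderiv_slice hF).comp (f := fun t : ℝ => (t, x)) (by fun_prop)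
    fun t ht => ⟨ht, hx⟩

theorem hasFDerivAt_intervalIntegral_of_contDiffAt [FiniteDimensional ℝ X] (hΩ : IsOpen Ω)
    {F : ℝ → X → G}
    (hF : ∀ t ∈ Set.Icc (0 : ℝ) 1, ∀ x ∈ Ω, ContDiffAt ℝ ∞ (fun p : ℝ × X => F p.1 p.2) (t, x))
    {x : X} (hx : x ∈ Ω) :
    HasFDerivAt (fun x => ∫ t in (0 : ℝ)..1, F t x) (∫ t in (0 : ℝ)..1, fderiv ℝ (F t) x) x := by
  have hcont := continuousOn_fderiv_slice hF
  obtain ⟨r, hr, hrΩ⟩ := Metric.nhds_basis_closedBall.mem_iff.1 (hΩ.mem_nhds hx)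
  -- A constant dominates the derivative on the compact set `[0, 1] × closedBall x r`; this permits
  -- differentiation under the integral.
  obtain ⟨C, hC⟩ := (isCompact_Icc.prod (isCompact_closedBall x r)).exists_bound_of_continuousOn
    (hcont.mono (Set.prod_mono_right hrΩ))
  have hIoc : Set.uIoc (0 : ℝ) 1 ⊆ Set.Icc 0 1 := by
    rw [Set.uIoc_of_le zero_le_one]; exact Set.Ioc_subset_Icc_self
  have hcF : ∀ y ∈ Ω, ContinuousOn (fun t => F t y) (Set.Icc 0 1) := by
    intro y hy t ht
    have h1 : ContinuousAt (fun t : ℝ => (t, y)) t := by fun_prop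
    exact (ContinuousAt.comp (f := fun t : ℝ => (t, y)) (hF t ht y hy).continuousAt
      h1).continuousWithinAt
  refine intervalIntegral.hasFDerivAt_integral_of_dominated_of_fderiv_le
    (F' := fun y t => fderiv ℝ (F t) y) (bound := fun _ => C)
    (Metric.closedBall_mem_nhds x hr) ?_ ?_ ?_ ?_ ?_ ?_
  · filter_upwards [hΩ.mem_nhds hx] with y hy
    exact ((hcF y hy).mono hIoc).aestronglyMeasurable measurableSet_uIoc
  · refine ContinuousOn.intervalIntegrable ?_
    rw [Set.uIcc_of_le zero_le_one]
    exact hcF x hx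
  · refine ContinuousOn.aestronglyMeasurable ?_ measurableSet_uIoc
    exact hcont.comp (f := fun t : ℝ => (t, x)) (by fun_prop) fun t ht => ⟨hIoc ht, hx⟩
  · exact Eventually.of_forall fun t ht y hy => hC (t, y) ⟨hIoc ht, hy⟩
  · exact intervalIntegrable_const
  · exact Eventually.of_forall fun t ht y hy =>
      (hasFDerivAt_slice (hF t (hIoc ht) y (hrΩ hy))).differentiableAt.hasFDerivAt

theorem contDiffOn_succ_intervalIntegral [FiniteDimensional ℝ X] (hΩ : IsOpen Ω) (n : ℕ)
    {F : ℝ → X → G}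
    (hF : ∀ t ∈ Set.Icc (0 : ℝ) 1, ∀ x ∈ Ω, ContDiffAt ℝ ∞ (fun p : ℝ × X => F p.1 p.2) (t, x))
    (h : ContDiffOn ℝ n (fun x => ∫ t in (0 : ℝ)..1,
      (fderiv ℝ (fun p : ℝ × X => F p.1 p.2) (t, x)).comp (ContinuousLinearMap.inr ℝ ℝ X)) Ω) :
    ContDiffOn ℝ (n + 1) (fun x => ∫ t in (0 : ℝ)..1, F t x) Ω := by
  refine (contDiffOn_succ_iff_fderiv_of_isOpen hΩ).2 ⟨fun x hx =>
    (hasFDerivAt_intervalIntegral_of_contDiffAt hΩ hF hx).differentiableAt.differentiableWithinAt,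
    by simp, ?_⟩
  refine h.congr fun x hx => ?_
  rw [(hasFDerivAt_intervalIntegral_of_contDiffAt hΩ hF hx).fderiv]
  refine intervalIntegral.integral_congr fun t ht => ?_
  rw [Set.uIcc_of_le zero_le_one] at ht
  exact (hasFDerivAt_slice (hF t ht x hx)).fderiv

/-- The target `G` varies in the induction, since the derivative takes values in `X →L[ℝ] G`; the
universe `max u v` is closed under this passage. -/
theorem contDiffOn_nat_intervalIntegral [FiniteDimensional ℝ X] (hΩ : IsOpen Ω) (n : ℕ) :
    ∀ {G : Type (max u v)} [NormedAddCommGroup G] [NormedSpace ℝ G] {F : ℝ → X → G},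
    (∀ t ∈ Set.Icc (0 : ℝ) 1, ∀ x ∈ Ω, ContDiffAt ℝ ∞ (fun p : ℝ × X => F p.1 p.2) (t, x)) →
    ContDiffOn ℝ n (fun x => ∫ t in (0 : ℝ)..1, F t x) Ω := by
  induction n with
  | zero =>
    intro G _ _ F hF
    exact contDiffOn_zero.2 fun x hx =>
      (hasFDerivAt_intervalIntegral_of_contDiffAt hΩ hF hx).continuousAt.continuousWithinAt
  | succ n ih =>
    intro G _ _ F hF
    push_cast
    exact contDiffOn_succ_intervalIntegral hΩ n hF (ih fun t ht x hx =>
      ((hF t ht x hx).fderiv_right (m := ∞) (by simp)).clm_comp contDiffAt_const)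

theorem contDiffAt_intervalIntegral [FiniteDimensional ℝ X]
    (hΩ : IsOpen Ω) {F : ℝ → X → G}
    (hF : ∀ t ∈ Set.Icc (0 : ℝ) 1, ∀ x ∈ Ω, ContDiffAt ℝ ∞ (fun p : ℝ × X => F p.1 p.2) (t, x))
    {x : X} (hx : x ∈ Ω) :
    ContDiffAt ℝ ∞ (fun x => ∫ t in (0 : ℝ)..1, F t x) x := by
  refine contDiffAt_infty.2 fun n => ContDiffAt.of_le ?_
    (show (n : WithTop ℕ∞) ≤ (n : WithTop ℕ∞) + 1 from le_self_add)
  -- One derivative is taken before the induction is invoked: it moves the target from universe `v`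
  -- to `max u v`.
  refine (contDiffOn_succ_intervalIntegral hΩ n hF ?_).contDiffAt (hΩ.mem_nhds hx)
  exact contDiffOn_nat_intervalIntegral.{u, v} hΩ n fun t ht x hx =>
    ((hF t ht x hx).fderiv_right (m := ∞) (by simp)).clm_comp contDiffAt_const

theorem intervalIntegrable_clm_apply {f : ℝ → X →L[ℝ] G} (hf : IntervalIntegrable f volume 0 1)
    (a : X) (l : G →L[ℝ] ℝ) : IntervalIntegrable (fun t => l (f t a)) volume 0 1 :=
  ⟨l.integrable_comp (hf.1.apply_continuousLinearMap a),
    l.integrable_comp (hf.2.apply_continuousLinearMap a)⟩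

theorem intervalIntegral_clm_apply [CompleteSpace G] {f : ℝ → X →L[ℝ] G}
    (hf : IntervalIntegrable f volume 0 1) (a : X) (l : G →L[ℝ] ℝ) :
    ∫ t in (0 : ℝ)..1, l (f t a) = l ((∫ t in (0 : ℝ)..1, f t) a) :=
  (l.comp (ContinuousLinearMap.apply ℝ G a)).intervalIntegral_comp_comm hf

end ParametricIntegral

/-! ### Explicit formulas for forms of degree one and two -/

section LowDegree

variable {X : Type*} [NormedAddCommGroup X] [NormedSpace ℝ X]

theorem extDeriv_apply_two {A : X → X [⋀^Fin 1]→L[ℝ] ℝ} {x : X} (a b : X) :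
    extDeriv A x ![a, b] = fderiv ℝ A x a ![b] - fderiv ℝ A x b ![a] := by
  have h0 : Fin.removeNth (0 : Fin 2) ![a, b] = ![b] := by ext i; fin_cases i; rfl
  have h1 : Fin.removeNth (1 : Fin 2) ![a, b] = ![a] := by ext i; fin_cases i; rfl
  rw [extDeriv, ContinuousAlternatingMap.alternatizeUncurryFin_apply, Fin.sum_univ_two, h0, h1]
  simp [sub_eq_add_neg]

theorem extDeriv_apply_three {A : X → X [⋀^Fin 2]→L[ℝ] ℝ} {x : X} (a b c : X) :
    extDeriv A x ![a, b, c] =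
      fderiv ℝ A x a ![b, c] - fderiv ℝ A x b ![a, c] + fderiv ℝ A x c ![a, b] := by
  have h0 : Fin.removeNth (0 : Fin 3) ![a, b, c] = ![b, c] := by ext i; fin_cases i <;> rfl
  have h1 : Fin.removeNth (1 : Fin 3) ![a, b, c] = ![a, c] := by ext i; fin_cases i <;> rfl
  have h2 : Fin.removeNth (2 : Fin 3) ![a, b, c] = ![a, b] := by ext i; fin_cases i <;> rfl
  rw [extDeriv, ContinuousAlternatingMap.alternatizeUncurryFin_apply, Fin.sum_univ_three, h0, h1,
    h2]
  simp [sub_eq_add_neg]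

theorem form_two_ext {A B : X [⋀^Fin 2]→L[ℝ] ℝ} (h : ∀ a b, A ![a, b] = B ![a, b]) : A = B := by
  ext v
  have hv : v = ![v 0, v 1] := by ext i; fin_cases i <;> rfl
  rw [hv]; exact h _ _

theorem form_one_ext {A B : X [⋀^Fin 1]→L[ℝ] ℝ} (h : ∀ a, A ![a] = B ![a]) : A = B := by
  ext v
  have hv : v = ![v 0] := funext fun i => by fin_cases i; rfl
  rw [hv]; exact h _

theorem form_two_add_left (A : X [⋀^Fin 2]→L[ℝ] ℝ) (a a' b : X) :
    A ![a + a', b] = A ![a, b] + A ![a', b] := A.toMultilinearMap.cons_add ![b] a a'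

theorem form_two_smul_left (A : X [⋀^Fin 2]→L[ℝ] ℝ) (c : ℝ) (a b : X) :
    A ![c • a, b] = c * A ![a, b] := A.toMultilinearMap.cons_smul ![b] c a

theorem form_two_swap (A : X [⋀^Fin 2]→L[ℝ] ℝ) (a b : X) : A ![a, b] = -A ![b, a] := by
  have h := A.toAlternatingMap.map_swap ![b, a] (i := 0) (j := 1) (by simp)
  have h2 : ![b, a] ∘ Equiv.swap (0 : Fin 2) 1 = ![a, b] := by ext i; fin_cases i <;> simp
  rw [h2] at h
  exact h

theorem form_two_add_right (A : X [⋀^Fin 2]→L[ℝ] ℝ) (a b b' : X) :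
    A ![a, b + b'] = A ![a, b] + A ![a, b'] := by
  rw [form_two_swap, form_two_add_left, form_two_swap A b, form_two_swap A b']; ring

theorem form_two_smul_right (A : X [⋀^Fin 2]→L[ℝ] ℝ) (c : ℝ) (a b : X) :
    A ![a, c • b] = c * A ![a, b] := by
  rw [form_two_swap, form_two_smul_left, form_two_swap A b]; ring

theorem form_two_self (A : X [⋀^Fin 2]→L[ℝ] ℝ) (a : X) : A ![a, a] = 0 :=
  A.map_eq_zero_of_eq ![a, a] (i := 0) (j := 1) rfl (by simp)

theorem hasDerivAt_form_one {c : ℝ → X [⋀^Fin 1]→L[ℝ] ℝ} {c' : X [⋀^Fin 1]→L[ℝ] ℝ}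
    {x : ℝ → X} {x' : X} {t : ℝ} (hc : HasDerivAt c c' t) (hx : HasDerivAt x x' t) :
    HasDerivAt (fun s => c s ![x s]) (c' ![x t] + c t ![x']) t := by
  have hg : ∀ (i : Fin 1) (s : ℝ), ![x] i s = ![x s] i := fun i s => by fin_cases i; rfl
  have h := (hc.hasFDerivAt.continuousAlternatingMap_apply (g := ![x])
    (g' := ![ContinuousLinearMap.toSpanSingleton ℝ x']) fun i => by
      fin_cases i; exact hx.hasFDerivAt).hasDerivAt
  simp only [hg] at h
  refine h.congr_deriv ?_
  have h1 : Function.update ![x t] 0 x' = ![x'] := by ext i; fin_cases i; rfl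
  simp [ContinuousAlternatingMap.toContinuousLinearMap, -Matrix.cons_val_fin_one, h1]

theorem hasDerivAt_form_two {c : ℝ → X [⋀^Fin 2]→L[ℝ] ℝ} {c' : X [⋀^Fin 2]→L[ℝ] ℝ}
    {x y : ℝ → X} {x' y' : X} {t : ℝ} (hc : HasDerivAt c c' t) (hx : HasDerivAt x x' t)
    (hy : HasDerivAt y y' t) :
    HasDerivAt (fun s => c s ![x s, y s]) (c' ![x t, y t] + c t ![x', y t] + c t ![x t, y']) t := by
  have hg : ∀ (i : Fin 2) (s : ℝ), ![x, y] i s = ![x s, y s] i := fun i s => by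
    fin_cases i <;> rfl
  have h := (hc.hasFDerivAt.continuousAlternatingMap_apply (g := ![x, y])
    (g' := ![ContinuousLinearMap.toSpanSingleton ℝ x', ContinuousLinearMap.toSpanSingleton ℝ y'])
    fun i => by fin_cases i; exacts [hx.hasFDerivAt, hy.hasFDerivAt]).hasDerivAt
  simp only [hg] at h
  refine h.congr_deriv ?_
  have h1 : Function.update (fun i => ![x t, y t] i) 0 x' = ![x', y t] := by
    ext i; fin_cases i <;> rfl
  have h2 : Function.update (fun i => ![x t, y t] i) 1 y' = ![x t, y'] := by
    ext i; fin_cases i <;> rfl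
  simp [ContinuousAlternatingMap.toContinuousLinearMap, add_assoc, h1, h2]

/-- Directional derivatives along curves. -/
theorem fderiv_apply_eq_of_hasDerivAt {W : Type*} [NormedAddCommGroup W] [NormedSpace ℝ W]
    {f : X → W} {x v : X} {w : W} (hf : DifferentiableAt ℝ f x)
    (h : HasDerivAt (fun s : ℝ => f (x + s • v)) w 0) : fderiv ℝ f x v = w := by
  have hl : HasDerivAt (fun s : ℝ => x + s • v) v 0 := by
    simpa using ((hasDerivAt_id (0 : ℝ)).smul_const v).const_add x
  have h0 : HasFDerivAt f (fderiv ℝ f x) (x + (0 : ℝ) • v) := by simpa using hf.hasFDerivAt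
  exact (h0.comp_hasDerivAt (0 : ℝ) hl).unique h

theorem hasDerivAt_line {W : Type*} [NormedAddCommGroup W] [NormedSpace ℝ W]
    {f : X → W} {x v : X} (hf : DifferentiableAt ℝ f x) :
    HasDerivAt (fun s : ℝ => f (x + s • v)) (fderiv ℝ f x v) 0 := by
  have hl : HasDerivAt (fun s : ℝ => x + s • v) v 0 := by
    simpa using ((hasDerivAt_id (0 : ℝ)).smul_const v).const_add x
  have h0 : HasFDerivAt f (fderiv ℝ f x) (x + (0 : ℝ) • v) := by simpa using hf.hasFDerivAt
  exact h0.comp_hasDerivAt (0 : ℝ) hl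

theorem fderiv_form_apply {A : X → X [⋀^Fin 1]→L[ℝ] ℝ} {x : X} (hA : DifferentiableAt ℝ A x)
    (a b : X) : fderiv ℝ A x a ![b] = fderiv ℝ (fun y => A y ![b]) x a := by
  have h : HasFDerivAt (fun y => A y ![b]) _ x :=
    (ContinuousAlternatingMap.apply ℝ X ℝ ![b]).hasFDerivAt.comp x hA.hasFDerivAt
  rw [h.fderiv]
  rfl

end LowDegree

/-! ### The relative Poincaré lemma on V × U -/

section Cone

variable {V E : Type*} [NormedAddCommGroup V] [NormedSpace ℝ V]
  [NormedAddCommGroup E] [NormedSpace ℝ E]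

/-- `(w, v) ↦ (t w, v)`. -/
def scaleFst (V E : Type*) [NormedAddCommGroup V] [NormedSpace ℝ V]
    [NormedAddCommGroup E] [NormedSpace ℝ E] (t : ℝ) : V × E →L[ℝ] V × E :=
  (t • ContinuousLinearMap.id ℝ V).prodMap (ContinuousLinearMap.id ℝ E)

theorem scaleFst_apply (t : ℝ) (x : V × E) : scaleFst V E t x = (t • x.1, x.2) := rfl

/-- The integrand of the cone operator. -/
def coneIntegrand (c : V → (V × E) [⋀^Fin 2]→L[ℝ] ℝ) (q : V) (t : ℝ) :
    (V × E) [⋀^Fin 1]→L[ℝ] ℝ :=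
  ((c (t • q)).curryLeft (q, 0)).compContinuousLinearMap (scaleFst V E t)

theorem coneIntegrand_apply (c : V → (V × E) [⋀^Fin 2]→L[ℝ] ℝ) (q : V) (t : ℝ) (a : V × E) :
    coneIntegrand c q t ![a] = c (t • q) ![(q, 0), (t • a.1, a.2)] := by
  simp only [coneIntegrand, ContinuousAlternatingMap.compContinuousLinearMap_apply,
    ContinuousAlternatingMap.curryLeft_apply_apply]
  congr 2
  ext i <;> fin_cases i <;> rfl

/-- The cone (Poincaré homotopy) operator in the direction of the first factor. -/
def coneOp (c : V → (V × E) [⋀^Fin 2]→L[ℝ] ℝ) (q : V) : (V × E) [⋀^Fin 1]→L[ℝ] ℝ :=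
  ∫ t in (0 : ℝ)..1, coneIntegrand c q t

variable [FiniteDimensional ℝ V] [FiniteDimensional ℝ E]

theorem contDiffAt_coneIntegrand {Y : Type*} [NormedAddCommGroup Y] [NormedSpace ℝ Y]
    {n : WithTop ℕ∞} {b : Y → V → (V × E) [⋀^Fin 2]→L[ℝ] ℝ} {f : Y → V} {g : Y → ℝ} {y : Y}
    (hb : ContDiffAt ℝ n (fun y => b y (g y • f y)) y) (hf : ContDiffAt ℝ n f y)
    (hg : ContDiffAt ℝ n g y) :
    ContDiffAt ℝ n (fun y => coneIntegrand (b y) (f y) (g y)) y := by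
  refine contDiffAt_form_iff.2 fun v => ?_
  have hv : v = ![v 0] := funext fun i => by fin_cases i; rfl
  rw [hv]
  simp only [coneIntegrand_apply]
  refine contDiffAt_form_apply hb fun i => ?_
  fin_cases i
  · exact hf.prodMk contDiffAt_const
  · exact (hg.smul contDiffAt_const).prodMk contDiffAt_const

theorem continuous_coneIntegrand {c : V → (V × E) [⋀^Fin 2]→L[ℝ] ℝ} (hc : Continuous c) (q : V) :
    Continuous (coneIntegrand c q) := by
  refine (contDiff_zero (𝕜 := ℝ)).1 (contDiff_iff_contDiffAt.2 fun t => ?_)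
  refine contDiffAt_coneIntegrand (b := fun _ => c) (f := fun _ => q) (g := fun t => t) ?_
    contDiffAt_const contDiffAt_id
  exact (contDiff_zero.2 (hc.comp (continuous_id.smul continuous_const))).contDiffAt

/-- The cone contracts and scales in the direction of `V` only, so it commutes with a linear change
of the `E`-coordinate. This makes the cone compatible with charts of the fiber. -/
theorem coneOp_compContinuousLinearMap
    {c : V → (V × E) [⋀^Fin 2]→L[ℝ] ℝ} (hc : Continuous c) (q : V) (D : E →L[ℝ] E) :
    (coneOp c q).compContinuousLinearMap ((ContinuousLinearMap.id ℝ V).prodMap D) =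
      coneOp (fun q' => (c q').compContinuousLinearMap
        ((ContinuousLinearMap.id ℝ V).prodMap D)) q := by
  have h := (ContinuousAlternatingMap.compContinuousLinearMapCLM (F := ℝ) (ι := Fin 1)
    ((ContinuousLinearMap.id ℝ V).prodMap D)).intervalIntegral_comp_comm
    ((continuous_coneIntegrand hc q).intervalIntegrable (μ := MeasureTheory.volume) 0 1)
  refine h.symm.trans (intervalIntegral.integral_congr fun t _ => form_one_ext fun a => ?_)
  have h1 : (⇑((ContinuousLinearMap.id ℝ V).prodMap D) ∘ ![a]) = ![(a.1, D a.2)] := by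
    ext i <;> fin_cases i <;> rfl
  have h2 : (⇑((ContinuousLinearMap.id ℝ V).prodMap D) ∘ ![(q, 0), (t • a.1, a.2)]) =
      ![(q, 0), (t • a.1, D a.2)] := by
    ext i <;> fin_cases i <;> simp
  rw [coneIntegrand_apply, ContinuousAlternatingMap.compContinuousLinearMap_apply, h2]
  change coneIntegrand c q t (⇑((ContinuousLinearMap.id ℝ V).prodMap D) ∘ ![a]) = _
  rw [h1, coneIntegrand_apply]

variable {b : V × E → (V × E) [⋀^Fin 2]→L[ℝ] ℝ} {U : Set E}

theorem contDiffAt_coneIntegrand_family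
    (hb : ∀ q, ∀ z ∈ U, ContDiffAt ℝ ∞ b (q, z)) (t : ℝ) {x : V × E} (hx : x.2 ∈ U) :
    ContDiffAt ℝ ∞ (fun p : ℝ × (V × E) => coneIntegrand (fun q' => b (q', p.2.2)) p.2.1 p.1)
      (t, x) := by
  have h1 : ContDiffAt ℝ ∞ (fun p : ℝ × (V × E) => (p.1 • p.2.1, p.2.2)) (t, x) :=
    (contDiffAt_fst.smul (contDiffAt_fst.comp _ contDiffAt_snd)).prodMk
      (contDiffAt_snd.comp _ contDiffAt_snd)
  exact contDiffAt_coneIntegrand (b := fun p : ℝ × (V × E) => fun q' => b (q', p.2.2))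
    (f := fun p => p.2.1) (g := fun p => p.1)
    (ContDiffAt.comp (f := fun p : ℝ × (V × E) => (p.1 • p.2.1, p.2.2)) (t, x)
      (hb (t • x.1) x.2 hx) h1) (contDiffAt_fst.comp _ contDiffAt_snd) contDiffAt_fst

theorem contDiffAt_coneOp (hU : IsOpen U) (hb : ∀ q, ∀ z ∈ U, ContDiffAt ℝ ∞ b (q, z))
    {x : V × E} (hx : x.2 ∈ U) :
    ContDiffAt ℝ ∞ (fun x : V × E => coneOp (fun q' => b (q', x.2)) x.1) x :=
  contDiffAt_intervalIntegral (Ω := {x : V × E | x.2 ∈ U}) (hU.preimage continuous_snd)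
    (fun t _ _ hy => contDiffAt_coneIntegrand_family hb t hy) hx

/-- The product rule: `x` enters through the base point of `b` and through the contracted vector
`(x.1, 0)`. -/
theorem fderiv_coneIntegrand (hb : ∀ q, ∀ z ∈ U, ContDiffAt ℝ ∞ b (q, z))
    {x : V × E} (hx : x.2 ∈ U) (t : ℝ) (a a' : V × E) :
    fderiv ℝ (fun x : V × E => coneIntegrand (fun q' => b (q', x.2)) x.1 t) x a ![a'] =
      fderiv ℝ b (scaleFst V E t x) (scaleFst V E t a) ![(x.1, 0), scaleFst V E t a'] +
        b (scaleFst V E t x) ![(a.1, 0), scaleFst V E t a'] := by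
  have hd := (hasFDerivAt_slice (F := fun t (x : V × E) =>
    coneIntegrand (fun q' => b (q', x.2)) x.1 t)
    (contDiffAt_coneIntegrand_family hb t hx)).differentiableAt
  rw [fderiv_form_apply hd]
  simp only [coneIntegrand_apply]
  have hd' : DifferentiableAt ℝ (fun y : V × E =>
      b (t • y.1, y.2) ![(y.1, 0), (t • a'.1, a'.2)]) x := by
    have h0 : DifferentiableAt ℝ (fun y : V × E =>
        coneIntegrand (fun q' => b (q', y.2)) y.1 t ![a']) x :=
      (ContinuousAlternatingMap.apply ℝ (V × E) ℝ ![a']).differentiableAt.comp x hd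
    refine h0.congr_of_eventuallyEq (Eventually.of_forall fun y => ?_)
    exact (coneIntegrand_apply (fun q' => b (q', y.2)) y.1 t a').symm
  refine fderiv_apply_eq_of_hasDerivAt hd' ?_
  have hbd : DifferentiableAt ℝ b (scaleFst V E t x) :=
    contDiffAt_differentiableAt (hb (t • x.1) x.2 hx)
  have h1 : HasDerivAt (fun s : ℝ => b (scaleFst V E t (x + s • a)))
      (fderiv ℝ b (scaleFst V E t x) (scaleFst V E t a)) 0 := by
    have := hasDerivAt_line (W := (V × E) [⋀^Fin 2]→L[ℝ] ℝ) (v := scaleFst V E t a) hbd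
    refine this.congr_of_eventuallyEq (Eventually.of_forall fun s => ?_)
    simp
  have h2 : HasDerivAt (fun s : ℝ => ((x + s • a).1, (0 : E))) (a.1, 0) 0 := by
    have : HasDerivAt (fun s : ℝ => x.1 + s • a.1) a.1 0 := by
      simpa using ((hasDerivAt_id (0 : ℝ)).smul_const a.1).const_add x.1
    exact this.prodMk (hasDerivAt_const _ _)
  have h3 := hasDerivAt_form_two h1 h2 (hasDerivAt_const (0 : ℝ) (scaleFst V E t a'))
  have h4 := form_two_smul_right (b (scaleFst V E t (x + (0 : ℝ) • a))) 0
    ((x + (0 : ℝ) • a).1, 0) 0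
  rw [zero_smul, zero_mul] at h4
  rw [zero_smul] at h3 h4
  rw [h4, add_zero] at h3
  rw [add_zero] at h3
  exact h3

/-- The relative Poincaré lemma: a closed `2`-form on `V × U` vanishing on `{0} × U` is the
exterior derivative of its cone. -/
theorem extDeriv_coneOp (hU : IsOpen U) (hb : ∀ q, ∀ z ∈ U, ContDiffAt ℝ ∞ b (q, z))
    (hclosed : ∀ q, ∀ z ∈ U, extDeriv b (q, z) = 0)
    (hzero : ∀ z ∈ U, ∀ v v' : E, b (0, z) ![(0, v), (0, v')] = 0)
    {x : V × E} (hx : x.2 ∈ U) :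
    extDeriv (fun x : V × E => coneOp (fun q' => b (q', x.2)) x.1) x = b x := by
  refine form_two_ext fun a a' => ?_
  set I : ℝ → V × E → (V × E) [⋀^Fin 1]→L[ℝ] ℝ :=
    fun t x => coneIntegrand (fun q' => b (q', x.2)) x.1 t with hI
  have hΩ : IsOpen {x : V × E | x.2 ∈ U} := hU.preimage continuous_snd
  have hsm : ∀ t ∈ Set.Icc (0 : ℝ) 1, ∀ y ∈ {x : V × E | x.2 ∈ U},
    ContDiffAt ℝ ∞ (fun p : ℝ × (V × E) => I p.1 p.2) (t, y) :=
    fun t _ y hy => contDiffAt_coneIntegrand_family hb t hy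
  have hder := hasFDerivAt_intervalIntegral_of_contDiffAt hΩ hsm hx
  have hint := intervalIntegrable_fderiv_slice hsm hx
  have hev : ∀ a a', fderiv ℝ (fun x : V × E => coneOp (fun q' => b (q', x.2)) x.1) x a ![a'] =
      ∫ t in (0 : ℝ)..1, fderiv ℝ (I t) x a ![a'] := fun a a' => by
    have h1 : fderiv ℝ (fun x : V × E => coneOp (fun q' => b (q', x.2)) x.1) x = _ := hder.fderiv
    rw [h1]
    exact (intervalIntegral_clm_apply hint a
      (ContinuousAlternatingMap.apply ℝ (V × E) ℝ ![a'])).symm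
  have hevi : ∀ a a', IntervalIntegrable (fun t => fderiv ℝ (I t) x a ![a'])
      MeasureTheory.volume 0 1 := fun a a' =>
    intervalIntegrable_clm_apply hint a (ContinuousAlternatingMap.apply ℝ (V × E) ℝ ![a'])
  rw [extDeriv_apply_two, hev, hev, ← intervalIntegral.integral_sub (hevi a a') (hevi a' a)]
  have hS : ∀ c : V × E, ∀ t : ℝ, HasDerivAt (fun t => scaleFst V E t c) (c.1, 0) t := by
    intro c t
    have : HasDerivAt (fun t : ℝ => t • c.1) c.1 t := by
      simpa using (hasDerivAt_id t).smul_const c.1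
    exact this.prodMk (hasDerivAt_const _ _)
  -- Cartan's formula: for closed `b`, the exterior derivative of the cone integrand at time `t` is
  -- the `t`-derivative of the pullback of `b` by `scaleFst V E t`.
  have hFTC : ∀ t ∈ Set.uIcc (0 : ℝ) 1, HasDerivAt
      (fun t => b (scaleFst V E t x) ![scaleFst V E t a, scaleFst V E t a'])
      (fderiv ℝ (I t) x a ![a'] - fderiv ℝ (I t) x a' ![a]) t := by
    intro t _
    have hbd : DifferentiableAt ℝ b (scaleFst V E t x) :=
      contDiffAt_differentiableAt (hb (t • x.1) x.2 hx)
    have h1 := hasDerivAt_form_two (hbd.hasFDerivAt.comp_hasDerivAt t (hS x t)) (hS a t) (hS a' t)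
    refine h1.congr_deriv ?_
    rw [fderiv_coneIntegrand hb hx, fderiv_coneIntegrand hb hx]
    -- Closedness on the radial vector and the two scaled vectors cancels all terms with derivatives
    -- of `b`.
    have hc := congrArg (fun A => A ![(x.1, (0 : E)), scaleFst V E t a, scaleFst V E t a'])
      (hclosed (t • x.1) x.2 hx)
    simp only [extDeriv_apply_three] at hc
    rw [← scaleFst_apply] at hc
    change _ = (0 : ℝ) at hc
    rw [form_two_swap (b (scaleFst V E t x)) (a'.1, 0)]
    simp only [Function.comp_apply]
    linarith
  rw [intervalIntegral.integral_eq_sub_of_hasDerivAt hFTC ((hevi a a').sub (hevi a' a))]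
  -- The endpoint `t = 1` gives `b x`; at `t = 0` only vertical vectors over `0` remain, where `b`
  -- vanishes.
  simp [scaleFst_apply, hzero x.2 hx]

end Cone

/-! ### Tangent vectors of the bundle in the trivialization -/

section InCharts

variable {E E' : Type*} [NormedAddCommGroup E] [NormedSpace ℝ E]
  [NormedAddCommGroup E'] [NormedSpace ℝ E']
  {N N' : Type*} [TopologicalSpace N] [ChartedSpace E N]
  [TopologicalSpace N'] [ChartedSpace E' N']

theorem hasMFDerivAt_iff_inCharts {f : N → N'} {x : N} {f' : E →L[ℝ] E'} :
    HasMFDerivAt 𝓘(ℝ, E) 𝓘(ℝ, E') f x f' ↔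
      ContinuousAt f x ∧ HasFDerivAt (inCharts (E := E) (E' := E') f x (f x)) f'
        (chartAt E x x) := by
  have h1 : Set.range 𝓘(ℝ, E) = Set.univ := by simp
  have h2 : HasFDerivWithinAt (inCharts (E := E) (E' := E') f x (f x)) f' (Set.range 𝓘(ℝ, E))
      (chartAt E x x) ↔ HasFDerivAt (inCharts (E := E) (E' := E') f x (f x)) f'
        (chartAt E x x) := by
    rw [h1, hasFDerivWithinAt_univ]
  exact and_congr Iff.rfl h2

end InCharts

namespace TotalSpace

section Tangent

variable {E : Type*} [NormedAddCommGroup E] [NormedSpace ℝ E] {M : Type*} [TopologicalSpace M]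
  [ChartedSpace E M] [MulAction SU2 M] [ContinuousSMul SU2 M]

/-- The preferred chart at `ofCoords q y` is the identity of `ℍ` times the preferred chart of `M` at
`y`. So the tangent spaces along `q ↦ ofCoords q y` are all identified with `ℍ × E` in the same way,
and derivatives are plain pairs. -/
theorem hasMFDerivAt_ofCoords {F : Type*} [NormedAddCommGroup F] [NormedSpace ℝ F] {N : Type*}
    [TopologicalSpace N] [ChartedSpace F N] {f : N → ℍ[ℝ]} {g : N → M} {x : N}
    {f' : F →L[ℝ] ℍ[ℝ]} {g' : F →L[ℝ] E}
    (hf : HasMFDerivAt 𝓘(ℝ, F) 𝓘(ℝ, ℍ[ℝ]) f x f') (hg : HasMFDerivAt 𝓘(ℝ, F) 𝓘(ℝ, E) g x g') :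
    HasMFDerivAt 𝓘(ℝ, F) 𝓘(ℝ, ℍ[ℝ] × E) (fun y => ofCoords (f y) (g y)) x
      (f'.prod g' : F →L[ℝ] ℍ[ℝ] × E) := by
  obtain ⟨hf1, hf2⟩ := hasMFDerivAt_iff_inCharts.1 hf
  obtain ⟨hg1, hg2⟩ := hasMFDerivAt_iff_inCharts.1 hg
  refine hasMFDerivAt_iff_inCharts.2 ⟨?_, ?_⟩
  · have hc : Continuous fun p : ℍ[ℝ] × M => ofCoords p.1 p.2 :=
      continuous_mk.comp (continuous_affine.prodMap continuous_id)
    exact ContinuousAt.comp (f := fun y => (f y, g y)) hc.continuousAt (hf1.prodMk hg1)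
  · have h : HasFDerivAt (fun z => (inCharts (E := F) (E' := ℍ[ℝ]) f x (f x) z,
        inCharts (E := F) (E' := E) g x (g x) z)) (f'.prod g') (chartAt F x x) := hf2.prodMk hg2
    refine h.congr_of_eventuallyEq (Eventually.of_forall fun z => ?_)
    simp only [inCharts, Function.comp_apply]
    rw [chartAt_apply (ofCoords_mem _ _), baseCoord_ofCoords, fiberCoord_ofCoords,
      fiberCoord_ofCoords]
    rfl

theorem hasMFDerivAt_baseCoord {p : TotalSpace M} (hp : p ∈ trivSource M) :
    HasMFDerivAt 𝓘(ℝ, ℍ[ℝ] × E) 𝓘(ℝ, ℍ[ℝ]) baseCoord p (ContinuousLinearMap.fst ℝ ℍ[ℝ] E) := by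
  refine hasMFDerivAt_iff_inCharts.2 ⟨((triv M).continuousAt hp).fst, ?_⟩
  refine hasFDerivAt_fst.congr_of_eventuallyEq (Eventually.of_forall fun z => ?_)
  simp only [inCharts, Function.comp_apply]
  rw [chartAt_symm_apply hp, baseCoord_ofCoords]
  rfl

theorem hasMFDerivAt_fiberCoord {p : TotalSpace M} (hp : p ∈ trivSource M) :
    HasMFDerivAt 𝓘(ℝ, ℍ[ℝ] × E) 𝓘(ℝ, E) fiberCoord p (ContinuousLinearMap.snd ℝ ℍ[ℝ] E) := by
  refine hasMFDerivAt_iff_inCharts.2 ⟨((triv M).continuousAt hp).snd, ?_⟩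
  refine hasFDerivAt_snd.congr_of_eventuallyEq ?_
  filter_upwards [(chartAt (ℍ[ℝ] × E) p).open_target.mem_nhds (mem_chart_target _ p)] with z hz
  simp only [inCharts, Function.comp_apply]
  rw [chartAt_symm_apply hp, fiberCoord_ofCoords,
    (chartAt E (fiberCoord p)).right_inv ((mem_chartAt_target hp).1 hz)]

/-- The derivative of the inverse of the preferred chart of `M` at `y`. -/
def chartSymmDeriv (y : M) (z : E) : E →L[ℝ] E :=
  mfderiv 𝓘(ℝ, E) 𝓘(ℝ, E) (chartAt E y).symm z

variable [IsManifold 𝓘(ℝ, E) ∞ M]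

/-- The chart at `p` and the preferred chart at a nearby point differ only in the fiber;
`chartSymmDeriv` is the correction, and it does not depend on the base coordinate. -/
theorem localRep_eq {k : ℕ} (η : DForm (ℍ[ℝ] × E) (TotalSpace M) k) {p : TotalSpace M}
    (hp : p ∈ trivSource M) {z : ℍ[ℝ] × E} (hz : z.2 ∈ (chartAt E (fiberCoord p)).target) :
    localRep η p z =
      (η (ofCoords z.1 ((chartAt E (fiberCoord p)).symm z.2)) :
        (ℍ[ℝ] × E) [⋀^Fin k]→L[ℝ] ℝ).compContinuousLinearMap
      ((ContinuousLinearMap.id ℝ ℍ[ℝ]).prodMap (chartSymmDeriv (fiberCoord p) z.2)) := by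
  have h1 : localRep η p z = pullback (E := ℍ[ℝ] × E)
      (fun z : ℍ[ℝ] × E => ofCoords z.1 ((chartAt E (fiberCoord p)).symm z.2)) η z :=
    pullback_congr (Eventually.of_forall fun z => chartAt_symm_apply hp z) η
  have h2 : HasMFDerivAt 𝓘(ℝ, ℍ[ℝ] × E) 𝓘(ℝ, ℍ[ℝ]) (fun z : ℍ[ℝ] × E => z.1) z
      (ContinuousLinearMap.fst ℝ ℍ[ℝ] E) := hasFDerivAt_fst.hasMFDerivAt
  have h3 : HasMFDerivAt 𝓘(ℝ, ℍ[ℝ] × E) 𝓘(ℝ, E) (fun z : ℍ[ℝ] × E => z.2) z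
      (ContinuousLinearMap.snd ℝ ℍ[ℝ] E) := hasFDerivAt_snd.hasMFDerivAt
  have h4 := (mdifferentiableAt_of_contMDiffAt (contMDiffAt_chart_symm hz)).hasMFDerivAt
  have h5 := hasMFDerivAt_ofCoords h2 (h4.comp z h3)
  rw [h1]
  simp only [pullback]
  rw [show (mfderiv 𝓘(ℝ, ℍ[ℝ] × E) 𝓘(ℝ, ℍ[ℝ] × E)
    (fun z : ℍ[ℝ] × E => ofCoords z.1 ((chartAt E (fiberCoord p)).symm z.2)) z) = _ from h5.mfderiv]
  rfl

theorem chartSymmDeriv_self (y : M) :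
    chartSymmDeriv (E := E) y (chartAt E y y) = ContinuousLinearMap.id ℝ E := by
  have h := (hasMFDerivAt_iff_inCharts.1 (mdifferentiableAt_of_contMDiffAt
    (contMDiffAt_chart_symm (mem_chart_target E y))).hasMFDerivAt).2
  refine h.unique ((hasFDerivAt_id (chartAt E y y)).congr_of_eventuallyEq ?_)
  filter_upwards [(chartAt E y).open_target.mem_nhds (mem_chart_target E y)] with z hz
  simp only [inCharts, Function.comp_apply, chartAt_self_eq, OpenPartialHomeomorph.refl_symm,
    OpenPartialHomeomorph.refl_apply, id]
  rw [(chartAt E y).left_inv (mem_chart_source E y), (chartAt E y).right_inv hz]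

theorem localRep_self {k : ℕ} (η : DForm (ℍ[ℝ] × E) (TotalSpace M) k) {p : TotalSpace M}
    (hp : p ∈ trivSource M) (q : ℍ[ℝ]) :
    localRep η p (q, chartAt E (fiberCoord p) (fiberCoord p)) = η (ofCoords q (fiberCoord p)) := by
  rw [localRep_eq η hp (mem_chart_target E (fiberCoord p)), chartSymmDeriv_self]
  ext v
  refine form_apply_congr η ?_ v
  simp only
  rw [(chartAt E (fiberCoord p)).left_inv (mem_chart_source E _)]

end Tangent

end TotalSpace

namespace TotalSpace

/-! ### The cone of a 2-form on the half v₂ ≠ 0 -/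

section ConeForm

variable {E : Type*} [NormedAddCommGroup E] [NormedSpace ℝ E] {M : Type*} [TopologicalSpace M]
  [ChartedSpace E M] [MulAction SU2 M] [ContinuousSMul SU2 M]

/-- The value of a form in the trivialization over `v₂ ≠ 0`. -/
def valueAt {k : ℕ} (η : DForm (ℍ[ℝ] × E) (TotalSpace M) k) (q : ℍ[ℝ]) (y : M) :
    (ℍ[ℝ] × E) [⋀^Fin k]→L[ℝ] ℝ := η (ofCoords q y)

theorem valueAt_coords {k : ℕ} (η : DForm (ℍ[ℝ] × E) (TotalSpace M) k) {p : TotalSpace M}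
    (hp : p ∈ trivSource M) : valueAt η (baseCoord p) (fiberCoord p) = η p := by
  ext v
  exact form_apply_congr η (ofCoords_coords hp) v

/-- The cone of a `2`-form on the part of the bundle over `v₂ ≠ 0`, along the rays of the base. -/
def coneForm (β : DForm (ℍ[ℝ] × E) (TotalSpace M) 2) : DForm (ℍ[ℝ] × E) (TotalSpace M) 1 :=
  fun p => coneOp (fun q => valueAt β q (fiberCoord p)) (baseCoord p)

theorem valueAt_coneForm (β : DForm (ℍ[ℝ] × E) (TotalSpace M) 2) (q : ℍ[ℝ]) (y : M) :
    valueAt (coneForm β) q y = coneOp (fun q => valueAt β q y) q := by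
  change coneOp (fun q' => valueAt β q' (fiberCoord (ofCoords q y))) (baseCoord (ofCoords q y)) = _
  rw [fiberCoord_ofCoords, baseCoord_ofCoords]

variable [IsManifold 𝓘(ℝ, E) ∞ M]

theorem localRep_eq_valueAt {k : ℕ} (η : DForm (ℍ[ℝ] × E) (TotalSpace M) k) {p : TotalSpace M}
    (hp : p ∈ trivSource M) {z : ℍ[ℝ] × E} (hz : z.2 ∈ (chartAt E (fiberCoord p)).target) :
    localRep η p z =
      (valueAt η z.1 ((chartAt E (fiberCoord p)).symm z.2)).compContinuousLinearMap
      ((ContinuousLinearMap.id ℝ ℍ[ℝ]).prodMap (chartSymmDeriv (fiberCoord p) z.2)) :=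
  localRep_eq η hp hz

/-- Restriction to a fiber, in the trivialization. -/
theorem pullback_mk_affine {k : ℕ} (η : DForm (ℍ[ℝ] × E) (TotalSpace M) k) (q : ℍ[ℝ]) (y : M) :
    (pullback (E := E) (mk (affine q)) η y : E [⋀^Fin k]→L[ℝ] ℝ) =
      (valueAt η q y).compContinuousLinearMap (ContinuousLinearMap.inr ℝ ℍ[ℝ] E) := by
  have h1 : HasMFDerivAt 𝓘(ℝ, E) 𝓘(ℝ, ℍ[ℝ]) (fun _ : M => q) y (0 : E →L[ℝ] ℍ[ℝ]) :=
    hasMFDerivAt_const q y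
  have h2 : HasMFDerivAt 𝓘(ℝ, E) 𝓘(ℝ, E) (fun y : M => y) y (ContinuousLinearMap.id ℝ E) :=
    hasMFDerivAt_id y
  have h3 := (hasMFDerivAt_ofCoords h1 h2).mfderiv
  simp only [pullback]
  rw [show mfderiv 𝓘(ℝ, E) 𝓘(ℝ, ℍ[ℝ] × E) (mk (affine q)) y = _ from h3]
  rfl

variable [FiniteDimensional ℝ E] [ContMDiffSMul (𝓡 3) 𝓘(ℝ, E) ∞ SU2 M]

theorem contDiffAt_localRep_of_mem {k : ℕ} {η : DForm (ℍ[ℝ] × E) (TotalSpace M) k}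
    {p : TotalSpace M} (hp : p ∈ trivSource M) {z : ℍ[ℝ] × E}
    (hz : z.2 ∈ (chartAt E (fiberCoord p)).target)
    (h : SmoothFormAt η (ofCoords z.1 ((chartAt E (fiberCoord p)).symm z.2))) :
    ContDiffAt ℝ ∞ (localRep η p) z := by
  refine SmoothFormAt.contDiffAt_localRep ((mem_chartAt_target hp).2 hz) ?_
  rwa [chartAt_symm_apply hp]

theorem extDeriv_localRep {k : ℕ} {η : DForm (ℍ[ℝ] × E) (TotalSpace M) k}
    {p : TotalSpace M} (hp : p ∈ trivSource M) {z : ℍ[ℝ] × E}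
    (hz : z.2 ∈ (chartAt E (fiberCoord p)).target)
    (h : SmoothFormAt η (ofCoords z.1 ((chartAt E (fiberCoord p)).symm z.2))) :
    extDeriv (localRep η p) z = localRep (extD η) p z := by
  refine (localRep_extD ((mem_chartAt_target hp).2 hz) ?_).symm
  rwa [chartAt_symm_apply hp]

theorem localRep_eq_zero {k : ℕ} {η : DForm (ℍ[ℝ] × E) (TotalSpace M) k}
    {p : TotalSpace M} (hp : p ∈ trivSource M) {z : ℍ[ℝ] × E}
    (h : η (ofCoords z.1 ((chartAt E (fiberCoord p)).symm z.2)) = 0) :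
    localRep η p z = 0 := by
  have h1 : η ((chartAt (ℍ[ℝ] × E) p).symm z) =
      (0 : DForm (ℍ[ℝ] × E) (TotalSpace M) k) ((chartAt (ℍ[ℝ] × E) p).symm z) := by
    rw [chartAt_symm_apply hp]; exact h
  exact localRep_congr h1

theorem continuous_valueAt {k : ℕ} {η : DForm (ℍ[ℝ] × E) (TotalSpace M) k} {y : M} {S : Set ℍ[ℝ]}
    (h : ∀ q ∈ S, SmoothFormAt η (ofCoords q y)) :
    ContinuousOn (fun q => valueAt η q y) S := by
  have hp := ofCoords_mem 0 y
  intro q hq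
  have hy : fiberCoord (ofCoords 0 y) = y := fiberCoord_ofCoords 0 y
  have h1 : ContDiffAt ℝ ∞ (localRep η (ofCoords 0 y)) (q, chartAt E y y) := by
    refine contDiffAt_localRep_of_mem hp (by rw [hy]; exact mem_chart_target E y) ?_
    simp only [hy, (chartAt E y).left_inv (mem_chart_source E y)]
    exact h q hq
  have h2 : ContinuousAt (fun q => localRep η (ofCoords 0 y) (q, chartAt E y y)) q :=
    ContinuousAt.comp (f := fun q : ℍ[ℝ] => (q, chartAt E y y)) h1.continuousAt (by fun_prop)
  refine ContinuousAt.continuousWithinAt (h2.congr (Eventually.of_forall fun q' => ?_))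
  have h3 := localRep_self η hp q'
  rw [hy] at h3
  exact h3

/-- In any chart `coneForm` is the cone of the coordinate expression, because the fiber correction
passes through `coneOp`. The linear statements about `coneOp` thus carry over to the bundle. -/
theorem localRep_coneForm {β : DForm (ℍ[ℝ] × E) (TotalSpace M) 2}
    (hβ : ∀ p ∈ trivSource M, SmoothFormAt β p) {p : TotalSpace M} (hp : p ∈ trivSource M)
    {z : ℍ[ℝ] × E} (hz : z.2 ∈ (chartAt E (fiberCoord p)).target) :
    localRep (coneForm β) p z = coneOp (fun q => localRep β p (q, z.2)) z.1 := by
  have hc : Continuous (fun q => valueAt β q ((chartAt E (fiberCoord p)).symm z.2)) :=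
    continuousOn_univ.1 (continuous_valueAt fun q _ => hβ _ (ofCoords_mem q _))
  rw [localRep_eq_valueAt _ hp hz, valueAt_coneForm, coneOp_compContinuousLinearMap hc]
  congr 1
  funext q
  exact (localRep_eq_valueAt β hp (z := (q, z.2)) hz).symm

theorem smoothFormAt_coneForm {β : DForm (ℍ[ℝ] × E) (TotalSpace M) 2}
    (hβ : ∀ p ∈ trivSource M, SmoothFormAt β p) {p : TotalSpace M} (hp : p ∈ trivSource M) :
    SmoothFormAt (coneForm β) p := by
  have hz := (mem_chartAt_target hp).1 (mem_chart_target (ℍ[ℝ] × E) p)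
  have h1 := contDiffAt_coneOp (b := localRep β p) (chartAt E (fiberCoord p)).open_target
    (fun q z hz => contDiffAt_localRep_of_mem hp hz (hβ _ (ofCoords_mem _ _))) hz
  refine h1.congr_of_eventuallyEq ?_
  filter_upwards [(chartAt (ℍ[ℝ] × E) p).open_target.mem_nhds (mem_chart_target _ p)] with w hw
  exact localRep_coneForm hβ hp ((mem_chartAt_target hp).1 hw)

theorem extD_coneForm {β : DForm (ℍ[ℝ] × E) (TotalSpace M) 2}
    (hβ : ∀ p ∈ trivSource M, SmoothFormAt β p) (hβ' : ∀ p ∈ trivSource M, extD β p = 0)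
    (hfib : pullback (E := E) (mk (affine 0)) β = 0) {p : TotalSpace M} (hp : p ∈ trivSource M) :
    extD (coneForm β) p = β p := by
  have hz := (mem_chartAt_target hp).1 (mem_chart_target (ℍ[ℝ] × E) p)
  have hp' : (chartAt (ℍ[ℝ] × E) p).symm (chartAt (ℍ[ℝ] × E) p p) = p :=
    (chartAt (ℍ[ℝ] × E) p).left_inv (mem_chart_source _ p)
  have h1 := extDeriv_coneOp (b := localRep β p) (chartAt E (fiberCoord p)).open_target
    (fun q z hz => contDiffAt_localRep_of_mem hp hz (hβ _ (ofCoords_mem _ _)))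
    (fun q z hz => by
      rw [extDeriv_localRep hp hz (hβ _ (ofCoords_mem _ _))]
      exact localRep_eq_zero hp (hβ' _ (ofCoords_mem _ _)))
    (fun z hz v v' => by
      set y := (chartAt E (fiberCoord p)).symm z
      have h := pullback_mk_affine β 0 y
      rw [hfib] at h
      set D := chartSymmDeriv (E := E) (fiberCoord p) z
      have h' := congrArg (fun A : E [⋀^Fin 2]→L[ℝ] ℝ => A ![D v, D v']) h
      rw [localRep_eq_valueAt β hp hz]
      simp only [ContinuousAlternatingMap.compContinuousLinearMap_apply] at h' ⊢
      refine Eq.trans ?_ h'.symm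
      congr 1
      ext i <;> fin_cases i <;> simp [D]) hz
  refine eq_of_localRep_eq ?_
  rw [← h1, localRep_extD (mem_chart_target _ p)
    (by rw [hp']; exact smoothFormAt_coneForm hβ hp)]
  refine Filter.EventuallyEq.extDeriv_eq ?_
  filter_upwards [(chartAt (ℍ[ℝ] × E) p).open_target.mem_nhds (mem_chart_target _ p)] with w hw
  exact localRep_coneForm hβ hp ((mem_chartAt_target hp).1 hw)

end ConeForm

end TotalSpace

/-! ### Integrating closed 1-forms along segments of the base -/

section Segment

variable {V E : Type*} [NormedAddCommGroup V] [NormedSpace ℝ V]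
  [NormedAddCommGroup E] [NormedSpace ℝ E]

/-- The integral of a family `g` of `1`-forms along the segment from `c` to `q`. -/
def segmentIntegral (c : V) (g : V → (V × E) [⋀^Fin 1]→L[ℝ] ℝ) (q : V) : ℝ :=
  ∫ t in (0 : ℝ)..1, g (c + t • (q - c)) ![(q - c, 0)]

variable {g : V × E → (V × E) [⋀^Fin 1]→L[ℝ] ℝ} {C : Set V} {U : Set E} {c : V}

theorem contDiffAt_segmentIntegrand (hC : StarConvex ℝ c C)
    (hg : ∀ q ∈ C, ∀ z ∈ U, ContDiffAt ℝ ∞ g (q, z)) {t : ℝ} (ht : t ∈ Set.Icc (0 : ℝ) 1)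
    {x : V × E} (hx : x ∈ C ×ˢ U) :
    ContDiffAt ℝ ∞ (fun p : ℝ × (V × E) => g (c + p.1 • (p.2.1 - c), p.2.2) ![(p.2.1 - c, 0)])
      (t, x) := by
  have h0 : ContDiffAt ℝ ∞ (fun p : ℝ × (V × E) => p.2.1 - c) (t, x) :=
    (contDiffAt_fst.comp _ contDiffAt_snd).sub contDiffAt_const
  have h1 : ContDiffAt ℝ ∞ (fun p : ℝ × (V × E) => (c + p.1 • (p.2.1 - c), p.2.2)) (t, x) :=
    (contDiffAt_const.add (contDiffAt_fst.smul h0)).prodMk (contDiffAt_snd.comp _ contDiffAt_snd)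
  refine contDiffAt_form_apply (A := fun p : ℝ × (V × E) => g (c + p.1 • (p.2.1 - c), p.2.2))
    (ContDiffAt.comp (f := fun p : ℝ × (V × E) => (c + p.1 • (p.2.1 - c), p.2.2)) (t, x)
      (hg _ (hC.add_smul_sub_mem hx.1 ht.1 ht.2) _ hx.2) h1) fun i => ?_
  fin_cases i
  exact h0.prodMk contDiffAt_const

theorem fderiv_segmentIntegrand {x a : V × E} {t : ℝ}
    (hgd : DifferentiableAt ℝ g (c + t • (x.1 - c), x.2))
    (hd : DifferentiableAt ℝ
      (fun x : V × E => g (c + t • (x.1 - c), x.2) ![(x.1 - c, 0)]) x) :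
    fderiv ℝ (fun x : V × E => g (c + t • (x.1 - c), x.2) ![(x.1 - c, 0)]) x a =
      fderiv ℝ g (c + t • (x.1 - c), x.2) (t • a.1, a.2) ![(x.1 - c, 0)] +
        g (c + t • (x.1 - c), x.2) ![(a.1, 0)] := by
  refine fderiv_apply_eq_of_hasDerivAt hd ?_
  have h1 : HasDerivAt (fun s : ℝ => g (c + t • (x.1 - c) + s • t • a.1, x.2 + s • a.2))
      (fderiv ℝ g (c + t • (x.1 - c), x.2) (t • a.1, a.2)) 0 :=
    hasDerivAt_line (v := (t • a.1, a.2)) hgd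
  have h2 : HasDerivAt (fun s : ℝ => g (c + t • ((x + s • a).1 - c), (x + s • a).2))
      (fderiv ℝ g (c + t • (x.1 - c), x.2) (t • a.1, a.2)) 0 := by
    refine h1.congr_of_eventuallyEq (Eventually.of_forall fun s => ?_)
    have h3 : c + t • ((x + s • a).1 - c) = c + t • (x.1 - c) + s • t • a.1 := by
      rw [Prod.fst_add, Prod.smul_fst]; module
    simp only [h3, Prod.snd_add, Prod.smul_snd]
  have hr : HasDerivAt (fun s : ℝ => ((x + s • a).1 - c, (0 : E))) (a.1, 0) 0 := by
    have h1 : HasDerivAt (fun s : ℝ => x.1 + s • a.1 - c) a.1 0 := by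
      simpa using (((hasDerivAt_id (0 : ℝ)).smul_const a.1).const_add x.1).sub_const c
    exact h1.prodMk (hasDerivAt_const _ _)
  refine (hasDerivAt_form_one h2 hr).congr_deriv ?_
  rw [zero_smul, add_zero]

variable [FiniteDimensional ℝ V] [FiniteDimensional ℝ E]

theorem contDiffAt_segmentIntegral (hCo : IsOpen C) (hU : IsOpen U) (hC : StarConvex ℝ c C)
    (hg : ∀ q ∈ C, ∀ z ∈ U, ContDiffAt ℝ ∞ g (q, z)) {x : V × E} (hx : x ∈ C ×ˢ U) :
    ContDiffAt ℝ ∞ (fun x : V × E => segmentIntegral c (fun q => g (q, x.2)) x.1) x :=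
  contDiffAt_intervalIntegral (Ω := C ×ˢ U) (hCo.prod hU)
    (fun _ ht _ hy => contDiffAt_segmentIntegrand hC hg ht hy) hx

/-- The derivative of the segment integral of a closed `1`-form. -/
theorem fderiv_segmentIntegral (hCo : IsOpen C) (hU : IsOpen U) (hC : StarConvex ℝ c C)
    (hg : ∀ q ∈ C, ∀ z ∈ U, ContDiffAt ℝ ∞ g (q, z))
    (hclosed : ∀ q ∈ C, ∀ z ∈ U, extDeriv g (q, z) = 0) {x : V × E} (hx : x ∈ C ×ˢ U)
    (a : V × E) :
    fderiv ℝ (fun x : V × E => segmentIntegral c (fun q => g (q, x.2)) x.1) x a =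
      g x ![a] - g (c, x.2) ![(0, a.2)] := by
  set F : ℝ → V × E → ℝ := fun t x => g (c + t • (x.1 - c), x.2) ![(x.1 - c, 0)] with hF
  have hsm : ∀ t ∈ Set.Icc (0 : ℝ) 1, ∀ y ∈ C ×ˢ U,
      ContDiffAt ℝ ∞ (fun p : ℝ × (V × E) => F p.1 p.2) (t, y) :=
    fun t ht y hy => contDiffAt_segmentIntegrand hC hg ht hy
  have hder := hasFDerivAt_intervalIntegral_of_contDiffAt (hCo.prod hU) hsm hx
  have hint := intervalIntegrable_fderiv_slice hsm hx
  have hev : fderiv ℝ (fun x : V × E => segmentIntegral c (fun q => g (q, x.2)) x.1) x a =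
      ∫ t in (0 : ℝ)..1, fderiv ℝ (F t) x a := by
    have h1 : fderiv ℝ (fun x : V × E => segmentIntegral c (fun q => g (q, x.2)) x.1) x = _ :=
      hder.fderiv
    rw [h1]
    exact (intervalIntegral_clm_apply hint a (ContinuousLinearMap.id ℝ ℝ)).symm
  have hevi : IntervalIntegrable (fun t => fderiv ℝ (F t) x a) MeasureTheory.volume 0 1 :=
    intervalIntegrable_clm_apply hint a (ContinuousLinearMap.id ℝ ℝ)
  rw [hev]
  -- By closedness the derivative of the integrand in the direction `a` is the `t`-derivative of `g`
  -- on the transported vector `(t • a.1, a.2)`; the endpoint `t = 0` leaves the vertical term over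
  -- `c`.
  have hFTC : ∀ t ∈ Set.uIcc (0 : ℝ) 1, HasDerivAt
      (fun t => g (c + t • (x.1 - c), x.2) ![(t • a.1, a.2)]) (fderiv ℝ (F t) x a) t := by
    intro t ht
    rw [Set.uIcc_of_le zero_le_one] at ht
    have hmem := hC.add_smul_sub_mem hx.1 ht.1 ht.2
    have hgd : DifferentiableAt ℝ g (c + t • (x.1 - c), x.2) :=
      contDiffAt_differentiableAt (hg _ hmem _ hx.2)
    have hS : HasDerivAt (fun t : ℝ => (c + t • (x.1 - c), x.2)) (x.1 - c, 0) t := by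
      have h1 : HasDerivAt (fun t : ℝ => c + t • (x.1 - c)) (x.1 - c) t := by
        simpa using ((hasDerivAt_id t).smul_const (x.1 - c)).const_add c
      exact h1.prodMk (hasDerivAt_const _ _)
    have hA : HasDerivAt (fun t : ℝ => (t • a.1, a.2)) (a.1, 0) t := by
      have h1 : HasDerivAt (fun t : ℝ => t • a.1) a.1 t := by
        simpa using (hasDerivAt_id t).smul_const a.1
      exact h1.prodMk (hasDerivAt_const _ _)
    refine (hasDerivAt_form_one (hgd.hasFDerivAt.comp_hasDerivAt t hS) hA).congr_deriv ?_
    have hd : DifferentiableAt ℝ (F t) x :=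
      (hasFDerivAt_slice (hsm t ht x hx)).differentiableAt
    rw [fderiv_segmentIntegrand hgd hd]
    have hc := congrArg (fun A => A ![(x.1 - c, (0 : E)), (t • a.1, a.2)])
      (hclosed _ hmem x.2 hx.2)
    simp only [extDeriv_apply_two] at hc
    change _ = (0 : ℝ) at hc
    linarith
  rw [intervalIntegral.integral_eq_sub_of_hasDerivAt hFTC hevi]
  simp

end Segment

/-! ### A cover of ℍ ∖ {0} by two star-shaped sets with connected intersection -/

section Slit

/-- The complement of a closed half-line in the real axis of `ℍ`. -/
def slitSpace (s : ℝ) : Set ℍ[ℝ] := {q | 0 < s * q.re ∨ q.im ≠ 0}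

theorem isOpen_slitSpace (s : ℝ) : IsOpen (slitSpace s) :=
  (isOpen_lt continuous_const (continuous_const.mul Quaternion.continuous_re)).union
    (isOpen_ne_fun Quaternion.continuous_im continuous_const)

/-- A segment towards the real point `s` scales the imaginary part by `b`. So `b ≠ 0` keeps a
nonzero imaginary part nonzero, and otherwise the sign of the real part is kept. -/
theorem starConvex_slitSpace {s : ℝ} (hs : s ≠ 0) : StarConvex ℝ (s : ℍ[ℝ]) (slitSpace s) := by
  intro q hq a b ha hb hab
  have hss : 0 < s * s := mul_self_pos.2 hs
  have him : (a • (s : ℍ[ℝ]) + b • q).im = b • q.im := by simp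
  have hre : s * (a • (s : ℍ[ℝ]) + b • q).re = a * (s * s) + b * (s * q.re) := by
    simp; ring
  simp only [slitSpace, Set.mem_ofPred_eq, him, hre]
  rcases hb.eq_or_lt with rfl | hb
  · left
    have : a = 1 := by linarith
    simpa [this] using hss
  · rcases hq with hq | hq
    · left
      have := mul_nonneg ha hss.le
      have := mul_pos hb hq
      linarith
    · exact Or.inr (smul_ne_zero hb.ne' hq)

theorem slitSpace_ne_zero {s : ℝ} {q : ℍ[ℝ]} (hq : q ∈ slitSpace s) : q ≠ 0 := by
  rintro rfl
  rcases hq with hq | hq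
  · simp at hq
  · exact hq (by simp)

theorem mem_slitSpace_neg {s : ℝ} (hs : s ≠ 0) {q : ℍ[ℝ]} (hq : q ≠ 0) (h : q ∉ slitSpace s) :
    q ∈ slitSpace (-s) := by
  simp only [slitSpace, Set.mem_ofPred_eq, not_or, not_not, not_lt] at h
  left
  have h1 : q.re ≠ 0 := fun h1 => hq (by
    have := Quaternion.re_add_im q
    rw [h.2, h1] at this
    simpa using this.symm)
  have := lt_of_le_of_ne h.1 (mul_ne_zero hs h1)
  linarith

/-- `ℍ ∖ ℝ`. -/
def nonReal : Set ℍ[ℝ] := {q | q.im ≠ 0}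

theorem isOpen_nonReal : IsOpen nonReal := isOpen_ne_fun Quaternion.continuous_im continuous_const

theorem nonReal_subset_slitSpace (s : ℝ) : nonReal ⊆ slitSpace s := fun _ h => Or.inr h

theorem slitSpace_inter_subset {s : ℝ} {q : ℍ[ℝ]} (h : q ∈ slitSpace s) (h' : q ∈ slitSpace (-s)) :
    q ∈ nonReal := by
  rcases h with h | h
  · rcases h' with h' | h'
    · linarith
    · exact h'
  · exact h

/-- The real axis has codimension 3, and the complement of a subspace of codimension greater than 1
is connected. This is where the simple connectivity of `ℍ ∖ {0}` enters. -/
theorem isPreconnected_nonReal : IsPreconnected nonReal := by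
  have h1 : nonReal = ((Submodule.span ℝ {(1 : ℍ[ℝ])} : Set ℍ[ℝ]))ᶜ := by
    ext q
    simp only [nonReal, Set.mem_ofPred_eq, Set.mem_compl_iff, SetLike.mem_coe,
      Submodule.mem_span_singleton]
    refine not_congr ⟨fun h => ⟨q.re, ?_⟩, ?_⟩
    · have := Quaternion.re_add_im q
      rw [h, add_zero] at this
      rw [← this]
      ext <;> simp
    · rintro ⟨a, rfl⟩
      simp
  rw [h1]
  refine (isConnected_compl_of_one_lt_codim ?_).isPreconnected
  have h2 := (Submodule.span ℝ {(1 : ℍ[ℝ])}).finrank_quotient_add_finrank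
  rw [finrank_span_singleton one_ne_zero, Quaternion.finrank_eq_four] at h2
  have := Module.lt_rank_of_lt_finrank (R := ℝ) (M := ℍ[ℝ] ⧸ Submodule.span ℝ {(1 : ℍ[ℝ])}) (n := 1)
    (by omega)
  simpa using this

end Slit

namespace TotalSpace

/-! ### Closed 1-forms over the punctured base -/

section Primitive

variable {E : Type*} [NormedAddCommGroup E] [NormedSpace ℝ E] {M : Type*} [TopologicalSpace M]
  [ChartedSpace E M] [MulAction SU2 M] [ContinuousSMul SU2 M]

/-- The part of the bundle over `v₁ ≠ 0`, `v₂ ≠ 0`. -/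
def overlap (M : Type*) [MulAction SU2 M] : Set (TotalSpace M) :=
  {p | p ∈ trivSource M ∧ baseCoord p ≠ 0}

theorem ofCoords_mem_overlap {q : ℍ[ℝ]} (hq : q ≠ 0) (y : M) : ofCoords q y ∈ overlap M :=
  ⟨ofCoords_mem q y, by simpa using hq⟩

/-- The integral of a `1`-form along the segment from `c` in the base, at a fixed fiber
coordinate. -/
def segmentFun (c : ℍ[ℝ]) (γ : DForm (ℍ[ℝ] × E) (TotalSpace M) 1) (p : TotalSpace M) : ℝ :=
  segmentIntegral c (fun q => valueAt γ q (fiberCoord p)) (baseCoord p)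

/-- The retraction onto the fiber over `c`. -/
def retract (c : ℍ[ℝ]) (p : TotalSpace M) : TotalSpace M := ofCoords c (fiberCoord p)

theorem retract_comp_retract (c d : ℍ[ℝ]) :
    (retract c ∘ retract d : TotalSpace M → TotalSpace M) = retract c := by
  funext p; simp [retract]

theorem localRep_chartAt [IsManifold 𝓘(ℝ, E) ∞ M] {k : ℕ}
    (η : DForm (ℍ[ℝ] × E) (TotalSpace M) k) {p : TotalSpace M} (hp : p ∈ trivSource M) :
    localRep η p (chartAt (ℍ[ℝ] × E) p p) = η p := by
  rw [chartAt_apply hp, localRep_self η hp]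
  exact valueAt_coords η hp

theorem pullback_retract {k : ℕ} (c : ℍ[ℝ]) (η : DForm (ℍ[ℝ] × E) (TotalSpace M) k)
    {p : TotalSpace M} (hp : p ∈ trivSource M) :
    (pullback (retract c) η p : (ℍ[ℝ] × E) [⋀^Fin k]→L[ℝ] ℝ) =
      (valueAt η c (fiberCoord p)).compContinuousLinearMap
        ((0 : ℍ[ℝ] × E →L[ℝ] ℍ[ℝ]).prod (ContinuousLinearMap.snd ℝ ℍ[ℝ] E)) := by
  have h1 : HasMFDerivAt 𝓘(ℝ, ℍ[ℝ] × E) 𝓘(ℝ, ℍ[ℝ]) (fun _ : TotalSpace M => c) p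
    (0 : ℍ[ℝ] × E →L[ℝ] ℍ[ℝ]) := hasMFDerivAt_const c p
  have h3 := (hasMFDerivAt_ofCoords h1 (hasMFDerivAt_fiberCoord hp)).mfderiv
  simp only [pullback]
  rw [show mfderiv 𝓘(ℝ, ℍ[ℝ] × E) 𝓘(ℝ, ℍ[ℝ] × E) (retract c) p = _ from h3]
  rfl

variable [IsManifold 𝓘(ℝ, E) ∞ M] [FiniteDimensional ℝ E] [ContMDiffSMul (𝓡 3) 𝓘(ℝ, E) ∞ SU2 M]

theorem contMDiffAt_retract (c : ℍ[ℝ]) {p : TotalSpace M} (hp : p ∈ trivSource M) :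
    ContMDiffAt 𝓘(ℝ, ℍ[ℝ] × E) 𝓘(ℝ, ℍ[ℝ] × E) ∞ (retract c) p :=
  contMDiffAt_ofCoords contMDiffAt_const (contMDiffAt_fiberCoord hp)

theorem segmentFun_chartAt_symm (c : ℍ[ℝ]) (γ : DForm (ℍ[ℝ] × E) (TotalSpace M) 1)
    {p : TotalSpace M} (hp : p ∈ trivSource M) {z : ℍ[ℝ] × E}
    (hz : z.2 ∈ (chartAt E (fiberCoord p)).target) :
    segmentFun c γ ((chartAt (ℍ[ℝ] × E) p).symm z) =
      segmentIntegral c (fun q => localRep γ p (q, z.2)) z.1 := by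
  rw [chartAt_symm_apply hp, segmentFun, fiberCoord_ofCoords, baseCoord_ofCoords]
  refine intervalIntegral.integral_congr fun t _ => ?_
  simp only
  rw [localRep_eq_valueAt γ hp (z := (c + t • (z.1 - c), z.2)) hz,
    ContinuousAlternatingMap.compContinuousLinearMap_apply]
  congr 1
  ext i <;> fin_cases i <;> simp

section

variable {γ : DForm (ℍ[ℝ] × E) (TotalSpace M) 1} {c : ℍ[ℝ]} {C : Set ℍ[ℝ]}

theorem contDiffAt_localRep_of_forall (hγ : ∀ q ∈ C, ∀ y, SmoothFormAt γ (ofCoords q y))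
    {p : TotalSpace M} (hp : p ∈ trivSource M) :
    ∀ q ∈ C, ∀ z ∈ (chartAt E (fiberCoord p)).target, ContDiffAt ℝ ∞ (localRep γ p) (q, z) :=
  fun q hq z hz => contDiffAt_localRep_of_mem hp (z := (q, z)) hz (hγ q hq _)

theorem extDeriv_localRep_of_forall (hγ : ∀ q ∈ C, ∀ y, SmoothFormAt γ (ofCoords q y))
    (hγ' : ∀ q ∈ C, ∀ y, extD γ (ofCoords q y) = 0) {p : TotalSpace M} (hp : p ∈ trivSource M) :
    ∀ q ∈ C, ∀ z ∈ (chartAt E (fiberCoord p)).target, extDeriv (localRep γ p) (q, z) = 0 := by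
  intro q hq z hz
  rw [extDeriv_localRep hp (z := (q, z)) hz (hγ q hq _)]
  exact localRep_eq_zero hp (hγ' q hq _)

theorem contDiffAt_segmentFun (hCo : IsOpen C) (hC : StarConvex ℝ c C)
    (hγ : ∀ q ∈ C, ∀ y, SmoothFormAt γ (ofCoords q y)) {p : TotalSpace M} (hp : p ∈ trivSource M)
    (hpC : baseCoord p ∈ C) :
    ContDiffAt ℝ ∞ (segmentFun c γ ∘ (chartAt (ℍ[ℝ] × E) p).symm) (chartAt (ℍ[ℝ] × E) p p) := by
  have hz := (mem_chartAt_target hp).1 (mem_chart_target (ℍ[ℝ] × E) p)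
  have h1 : (chartAt (ℍ[ℝ] × E) p p).1 ∈ C := by rwa [chartAt_apply hp]
  refine (contDiffAt_segmentIntegral (g := localRep γ p) hCo
    (chartAt E (fiberCoord p)).open_target hC (contDiffAt_localRep_of_forall hγ hp)
    ⟨h1, hz⟩).congr_of_eventuallyEq ?_
  filter_upwards [(chartAt (ℍ[ℝ] × E) p).open_target.mem_nhds (mem_chart_target _ p)] with w hw
  exact segmentFun_chartAt_symm c γ hp ((mem_chartAt_target hp).1 hw)

theorem extD_segmentFun (hCo : IsOpen C) (hC : StarConvex ℝ c C)
    (hγ : ∀ q ∈ C, ∀ y, SmoothFormAt γ (ofCoords q y))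
    (hγ' : ∀ q ∈ C, ∀ y, extD γ (ofCoords q y) = 0) {p : TotalSpace M} (hp : p ∈ trivSource M)
    (hpC : baseCoord p ∈ C) :
    extD (funForm (ℍ[ℝ] × E) (segmentFun c γ)) p = γ p - pullback (retract c) γ p := by
  have hz := (mem_chartAt_target hp).1 (mem_chart_target (ℍ[ℝ] × E) p)
  have hs := (contDiffAt_segmentFun hCo hC hγ hp hpC)
  have hp' : (chartAt (ℍ[ℝ] × E) p).symm (chartAt (ℍ[ℝ] × E) p p) = p :=
    (chartAt (ℍ[ℝ] × E) p).left_inv (mem_chart_source _ p)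
  have h1 : (chartAt (ℍ[ℝ] × E) p p).1 ∈ C := by rwa [chartAt_apply hp]
  refine eq_of_localRep_eq (η' := γ - pullback (retract c) γ) ?_
  rw [localRep_extD (mem_chart_target _ p) (by rw [hp']; exact smoothFormAt_funForm hs),
    localRep_chartAt _ hp, localRep_funForm]
  refine form_one_ext fun a => ?_
  have h2 := fderiv_segmentIntegral (g := localRep γ p) hCo
    (chartAt E (fiberCoord p)).open_target hC (contDiffAt_localRep_of_forall hγ hp)
    (extDeriv_localRep_of_forall hγ hγ' hp) (x := chartAt (ℍ[ℝ] × E) p p) ⟨h1, hz⟩ a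
  have h3 : (segmentFun c γ ∘ (chartAt (ℍ[ℝ] × E) p).symm) =ᶠ[𝓝 (chartAt (ℍ[ℝ] × E) p p)]
      fun x : ℍ[ℝ] × E => segmentIntegral c (fun q => localRep γ p (q, x.2)) x.1 := by
    filter_upwards [(chartAt (ℍ[ℝ] × E) p).open_target.mem_nhds (mem_chart_target _ p)] with w hw
    exact segmentFun_chartAt_symm c γ hp ((mem_chartAt_target hp).1 hw)
  rw [extDeriv_constOfIsEmpty]
  rw [← h3.fderiv_eq, localRep_chartAt _ hp, chartAt_apply hp, localRep_self γ hp] at h2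
  rw [← chartAt_apply hp] at h2
  refine Eq.trans ?_ (h2.trans ?_)
  · rfl
  · have h4 := congrArg (fun A : (ℍ[ℝ] × E) [⋀^Fin 1]→L[ℝ] ℝ => A ![a]) (pullback_retract c γ hp)
    simp only [ContinuousAlternatingMap.compContinuousLinearMap_apply] at h4
    refine congrArg₂ (· - ·) rfl (Eq.trans ?_ h4.symm)
    change valueAt γ c (fiberCoord p) _ = _
    congr 1
    ext i <;> fin_cases i <;> simp

/-- At a fixed fiber coordinate the base derivative of the segment integral does not depend on the
centre `c`, so integrals from different centres can be compared. -/
theorem differentiableAt_segmentFun (hCo : IsOpen C) (hC : StarConvex ℝ c C)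
    (hγ : ∀ q ∈ C, ∀ y, SmoothFormAt γ (ofCoords q y))
    (hγ' : ∀ q ∈ C, ∀ y, extD γ (ofCoords q y) = 0) {q : ℍ[ℝ]} (hq : q ∈ C) (y : M) :
    DifferentiableAt ℝ (fun q => segmentFun c γ (ofCoords q y)) q ∧
      ∀ w, fderiv ℝ (fun q => segmentFun c γ (ofCoords q y)) q w = valueAt γ q y ![(w, 0)] := by
  have hp := ofCoords_mem 0 y
  have hy : fiberCoord (ofCoords 0 y) = y := fiberCoord_ofCoords 0 y
  have hU := (chartAt E (fiberCoord (ofCoords 0 y))).open_target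
  have hz : chartAt E y y ∈ (chartAt E (fiberCoord (ofCoords 0 y))).target := by
    rw [hy]; exact mem_chart_target E y
  have hsm := contDiffAt_localRep_of_forall hγ hp
  have h2 := fderiv_segmentIntegral (g := localRep γ (ofCoords 0 y)) hCo hU hC hsm
    (extDeriv_localRep_of_forall hγ hγ' hp) (x := (q, chartAt E y y)) ⟨hq, hz⟩
  have h1 := contDiffAt_differentiableAt (contDiffAt_segmentIntegral
    (g := localRep γ (ofCoords 0 y)) hCo hU hC hsm (x := (q, chartAt E y y)) ⟨hq, hz⟩)
  have h3 : (fun q => segmentFun c γ (ofCoords q y)) = fun q =>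
      segmentIntegral c (fun q => localRep γ (ofCoords 0 y) (q, chartAt E y y)) q := by
    funext q'
    rw [← segmentFun_chartAt_symm c γ hp (z := (q', chartAt E y y)) hz, chartAt_symm_apply hp]
    simp only [hy, (chartAt E y).left_inv (mem_chart_source E y)]
  have h4 := HasFDerivAt.comp (f := fun q' : ℍ[ℝ] => (q', chartAt E y y)) q h1.hasFDerivAt
    (hasFDerivAt_prodMk_left q (chartAt E y y))
  rw [h3]
  refine ⟨h4.differentiableAt, fun w => ?_⟩
  have h5 : fderiv ℝ (fun q => segmentIntegral c
    (fun q => localRep γ (ofCoords 0 y) (q, chartAt E y y)) q) q = _ := h4.fderiv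
  rw [h5]
  refine (h2 (w, 0)).trans ?_
  have h6 := localRep_self γ hp q
  rw [hy] at h6
  rw [h6]
  have h7 : localRep γ (ofCoords 0 y) (c, chartAt E y y) ![(0, (0 : E))] = 0 :=
    (localRep γ (ofCoords 0 y) (c, chartAt E y y)).map_coord_zero 0 rfl
  simp only [h7, sub_zero]
  rfl

end

/-- Both functions have the same base derivative on the connected set `nonReal`, so their difference
depends on the fiber coordinate alone. -/
theorem segmentFun_sub_const {γ : DForm (ℍ[ℝ] × E) (TotalSpace M) 1} {s t : ℝ} (hs : s ≠ 0)
    (ht : t ≠ 0) (hγ : ∀ p ∈ overlap M, SmoothFormAt γ p) (hγ' : ∀ p ∈ overlap M, extD γ p = 0)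
    {q q' : ℍ[ℝ]} (hq : q ∈ nonReal) (hq' : q' ∈ nonReal) (y : M) :
    segmentFun s γ (ofCoords q y) - segmentFun t γ (ofCoords q y) =
      segmentFun s γ (ofCoords q' y) - segmentFun t γ (ofCoords q' y) := by
  have key : ∀ {s : ℝ}, s ≠ 0 → ∀ q ∈ nonReal,
      DifferentiableAt ℝ (fun q => segmentFun s γ (ofCoords q y)) q ∧
      ∀ w, fderiv ℝ (fun q => segmentFun s γ (ofCoords q y)) q w = valueAt γ q y ![(w, 0)] :=
    fun {s} hs q hq => differentiableAt_segmentFun (isOpen_slitSpace s) (starConvex_slitSpace hs)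
      (fun q hq y => hγ _ (ofCoords_mem_overlap (slitSpace_ne_zero hq) y))
      (fun q hq y => hγ' _ (ofCoords_mem_overlap (slitSpace_ne_zero hq) y))
      (nonReal_subset_slitSpace s hq) y
  obtain ⟨a, ha⟩ := isOpen_nonReal.exists_eq_add_of_fderiv_eq isPreconnected_nonReal
    (fun q hq => (key hs q hq).1.differentiableWithinAt)
    (fun q hq => (key ht q hq).1.differentiableWithinAt)
    (fun q hq => by ext w; rw [(key hs q hq).2, (key ht q hq).2])
  have h1 := ha hq
  have h2 := ha hq'
  simp only at h1 h2
  rw [h1, h2]; ring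

open Classical in
/-- A closed `1`-form over the punctured quaternions is cohomologous to its pullback by the
retraction onto a fiber. -/
theorem exists_primitive_of_overlap {γ : DForm (ℍ[ℝ] × E) (TotalSpace M) 1}
    (hγ : ∀ p ∈ overlap M, SmoothFormAt γ p) (hγ' : ∀ p ∈ overlap M, extD γ p = 0) :
    ∃ f : TotalSpace M → ℝ, ∀ p ∈ overlap M, SmoothFormAt (funForm (ℍ[ℝ] × E) f) p ∧
      extD (funForm (ℍ[ℝ] × E) f) p = γ p - pullback (retract 1) γ p := by
  set f₁ := segmentFun ((1 : ℝ) : ℍ[ℝ]) γ with hf₁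
  set f₂ := segmentFun ((-1 : ℝ) : ℍ[ℝ]) γ with hf₂
  have hsm : ∀ s : ℝ, s ≠ 0 → ∀ p ∈ trivSource M, baseCoord p ∈ slitSpace s →
      SmoothFormAt (funForm (ℍ[ℝ] × E) (segmentFun (s : ℍ[ℝ]) γ)) p := fun s hs p hp hps =>
    smoothFormAt_funForm (contDiffAt_segmentFun (isOpen_slitSpace s) (starConvex_slitSpace hs)
      (fun q hq y => hγ _ (ofCoords_mem_overlap (slitSpace_ne_zero hq) y)) hp hps)
  have hd : ∀ s : ℝ, s ≠ 0 → ∀ p ∈ trivSource M, baseCoord p ∈ slitSpace s →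
      extD (funForm (ℍ[ℝ] × E) (segmentFun (s : ℍ[ℝ]) γ)) p =
        γ p - pullback (retract (s : ℍ[ℝ])) γ p := fun s hs p hp hps =>
    extD_segmentFun (isOpen_slitSpace s) (starConvex_slitSpace hs)
      (fun q hq y => hγ _ (ofCoords_mem_overlap (slitSpace_ne_zero hq) y))
      (fun q hq y => hγ' _ (ofCoords_mem_overlap (slitSpace_ne_zero hq) y)) hp hps
  set i : ℍ[ℝ] := ⟨0, 1, 0, 0⟩ with hi
  have hi' : i ∈ nonReal := fun h => by
    have h1 : (1 : ℝ) = 0 := congrArg (fun q => q.imI) h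
    exact one_ne_zero h1
  have hcont : ∀ p ∈ overlap M, ContinuousAt baseCoord p := fun p hp =>
    ((triv M).continuousAt hp.1).fst
  -- On the intersection of the two slit domains `f₁ - f₂` is a function of the fiber coordinate,
  -- hence equal to its value over the non-real point `i`. Adding it to `f₂` continues `f₁` across
  -- the removed half-line.
  refine ⟨fun p => if baseCoord p ∈ slitSpace 1 then f₁ p else
    f₂ p + (f₁ (retract i p) - f₂ (retract i p)), fun p hp => ?_⟩
  by_cases h : baseCoord p ∈ slitSpace 1
  · have hev : ∀ᶠ p' in 𝓝 p, funForm (ℍ[ℝ] × E) f₁ p' = funForm (ℍ[ℝ] × E) (fun p =>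
        if baseCoord p ∈ slitSpace 1 then f₁ p else
          f₂ p + (f₁ (retract i p) - f₂ (retract i p))) p' := by
      filter_upwards [(hcont p hp).preimage_mem_nhds ((isOpen_slitSpace 1).mem_nhds h)] with p' hp'
      simp only [funForm, if_pos (show baseCoord p' ∈ slitSpace 1 from hp')]
    refine ⟨(hsm 1 one_ne_zero p hp.1 h).congr hev, ?_⟩
    rw [← extD_congr hev, hd 1 one_ne_zero p hp.1 h]
    simp
  · have h2 : baseCoord p ∈ slitSpace (-1) := mem_slitSpace_neg one_ne_zero hp.2 h
    have hev : ∀ᶠ p' in 𝓝 p, (funForm (ℍ[ℝ] × E) f₂ + pullback (retract i)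
        (funForm (ℍ[ℝ] × E) f₁ - funForm (ℍ[ℝ] × E) f₂) : DForm (ℍ[ℝ] × E) (TotalSpace M) 0) p' = funForm (ℍ[ℝ] × E) (fun p =>
        if baseCoord p ∈ slitSpace 1 then f₁ p else
          f₂ p + (f₁ (retract i p) - f₂ (retract i p))) p' := by
      filter_upwards [(hcont p hp).preimage_mem_nhds ((isOpen_slitSpace (-1)).mem_nhds h2),
        trivSource_mem_nhds hp.1] with p' hp' hp''
      have h3 : (if baseCoord p' ∈ slitSpace 1 then f₁ p' else
          f₂ p' + (f₁ (retract i p') - f₂ (retract i p'))) =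
          f₂ p' + (f₁ (retract i p') - f₂ (retract i p')) := by
        split_ifs with h3
        · have h4 := segmentFun_sub_const one_ne_zero (neg_ne_zero.2 one_ne_zero) hγ hγ'
            (slitSpace_inter_subset h3 hp') hi' (fiberCoord p')
          rw [ofCoords_coords hp''] at h4
          change f₁ p' - f₂ p' = f₁ (retract i p') - f₂ (retract i p') at h4
          linarith
        · rfl
      simp only [funForm]
      rw [h3]
      rfl
    have hri : retract i p ∈ trivSource M := ofCoords_mem _ _
    have hbi : baseCoord (retract i p) = i := baseCoord_ofCoords _ _
    have hi1 : baseCoord (retract i p) ∈ slitSpace 1 := by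
      rw [hbi]; exact nonReal_subset_slitSpace 1 hi'
    have hi2 : baseCoord (retract i p) ∈ slitSpace (-1) := by
      rw [hbi]; exact nonReal_subset_slitSpace (-1) hi'
    have hs1 := (hsm 1 one_ne_zero _ hri hi1)
    have hs2 := (hsm (-1) (neg_ne_zero.2 one_ne_zero) _ hri hi2)
    have hr := contMDiffAt_retract (E := E) i hp.1
    have hs3 := (hs1.sub hs2).pullback hr
    have hs4 := hsm (-1) (neg_ne_zero.2 one_ne_zero) p hp.1 h2
    refine ⟨(hs4.add hs3).congr hev, ?_⟩
    rw [← extD_congr hev, extD_add hs4 hs3, extD_pullback (hs1.sub hs2) hr,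
      hd (-1) (neg_ne_zero.2 one_ne_zero) p hp.1 h2]
    have hrr : ∀ c : ℍ[ℝ], pullback (retract i) (pullback (retract c) γ) p =
        pullback (retract c) γ p := fun c => by
      have h5 := pullback_comp_apply (g := retract c) (f := retract i)
        (mdifferentiableAt_of_contMDiffAt (contMDiffAt_retract (E := E) c hri))
        (mdifferentiableAt_of_contMDiffAt hr) γ
      rw [← h5, retract_comp_retract]
    -- The forms `γ` cancel in `d(f₁ - f₂)`. Since `retract c ∘ retract i = retract c`, the
    -- correction replaces the pullback from the fiber over `-1` by that from the fiber over `1`.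
    have h6 : pullback (E := ℍ[ℝ] × E) (retract i) (extD (funForm (ℍ[ℝ] × E) f₁ - funForm (ℍ[ℝ] × E) f₂)) p =
        pullback (E := ℍ[ℝ] × E) (retract i) (pullback (E := ℍ[ℝ] × E) (retract ((-1 : ℝ) : ℍ[ℝ])) γ -
          pullback (E := ℍ[ℝ] × E) (retract ((1 : ℝ) : ℍ[ℝ])) γ) p := by
      refine pullback_congr_form ?_
      rw [extD_sub hs1 hs2, hd 1 one_ne_zero _ hri hi1,
        hd (-1) (neg_ne_zero.2 one_ne_zero) _ hri hi2]
      simp only [Pi.sub_apply]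
      abel
    have h7 : pullback (E := ℍ[ℝ] × E) (retract i) (pullback (E := ℍ[ℝ] × E) (retract ((-1 : ℝ) : ℍ[ℝ])) γ -
        pullback (E := ℍ[ℝ] × E) (retract ((1 : ℝ) : ℍ[ℝ])) γ) p = pullback (E := ℍ[ℝ] × E) (retract i)
          (pullback (E := ℍ[ℝ] × E) (retract ((-1 : ℝ) : ℍ[ℝ])) γ) p -
        pullback (E := ℍ[ℝ] × E) (retract i) (pullback (E := ℍ[ℝ] × E) (retract ((1 : ℝ) : ℍ[ℝ])) γ) p := rfl
    rw [h6, h7, hrr, hrr]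
    simp

end Primitive

end TotalSpace

theorem smoothFormAt_zero {E : Type*} [NormedAddCommGroup E] [NormedSpace ℝ E] {N : Type*}
    [TopologicalSpace N] [ChartedSpace E N] {k : ℕ} (x : N) :
    SmoothFormAt (0 : DForm E N k) x :=
  show ContDiffAt ℝ ∞ (fun _ => (0 : E [⋀^Fin k]→L[ℝ] ℝ)) _ from contDiffAt_const

namespace TotalSpace

/-! ### Gluing the two halves, and exactness of closed 2-forms vanishing on fibers -/

section Glue

variable {E : Type*} [NormedAddCommGroup E] [NormedSpace ℝ E] {M : Type*} [TopologicalSpace M]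
  [ChartedSpace E M] [MulAction SU2 M] [ContinuousSMul SU2 M]

theorem baseCoord_swap_of_notMem {p : TotalSpace M} (hp : p ∉ trivSource M) :
    baseCoord (swap p) = 0 := by
  by_contra h
  have := (swap_mem_iff (swap_mem_of_notMem hp)).2 h
  rw [swap_swap] at this
  exact hp this

theorem continuousAt_baseCoord {p : TotalSpace M} (hp : p ∈ trivSource M) :
    ContinuousAt baseCoord p := ((triv M).continuousAt hp).fst

theorem overlap_mem_nhds {p : TotalSpace M} (hp : p ∈ overlap M) : overlap M ∈ 𝓝 p := by
  filter_upwards [trivSource_mem_nhds hp.1, (continuousAt_baseCoord hp.1).eventually_ne hp.2]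
    with p' h h' using ⟨h, h'⟩

theorem swap_mem_of_overlap {p : TotalSpace M} (hp : p ∈ overlap M) : swap p ∈ trivSource M :=
  (swap_mem_iff hp.1).2 hp.2

theorem mem_overlap {p : TotalSpace M} (hp : p ∈ trivSource M) (h : swap p ∈ trivSource M) :
    p ∈ overlap M := ⟨hp, (swap_mem_iff hp).1 h⟩

/-- A smooth function of the norm of the base coordinate `q`, which is `0` near `q = 0` and `1` for
`1 ≤ ‖q‖`. -/
def cutoff (p : TotalSpace M) : ℝ := Real.smoothTransition (2 * ‖baseCoord p‖ ^ 2 - 1)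

theorem cutoff_eq_one {p : TotalSpace M} (h : 1 ≤ ‖baseCoord p‖) : cutoff p = 1 :=
  Real.smoothTransition.one_of_one_le (by nlinarith)

theorem eventually_cutoff_eq_zero {p : TotalSpace M} (hp : p ∈ trivSource M)
    (h : baseCoord p = 0) : ∀ᶠ p' in 𝓝 p, cutoff p' = 0 := by
  have h1 : ContinuousAt (fun p => 2 * ‖baseCoord p‖ ^ 2 - 1) p :=
    (((continuousAt_baseCoord hp).norm.pow 2).const_mul 2).sub continuousAt_const
  filter_upwards [h1.eventually_lt_const (u := 0) (by simp [h])] with p' hp'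
  exact Real.smoothTransition.zero_of_nonpos hp'.le

theorem eventually_cutoff_eq_one {p : TotalSpace M} (hp : p ∈ trivSource M)
    (h : 1 < ‖baseCoord p‖) : ∀ᶠ p' in 𝓝 p, cutoff p' = 1 := by
  filter_upwards [(continuousAt_baseCoord hp).norm.eventually_const_lt h] with p' hp'
  exact cutoff_eq_one hp'.le

/-- A form on the overlap, multiplied by the cutoff function. -/
def cutForm {k : ℕ} (lam : DForm (ℍ[ℝ] × E) (TotalSpace M) k) :
    DForm (ℍ[ℝ] × E) (TotalSpace M) k := fun p => cutoff p • lam p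

open Classical in
/-- Two forms, one on each part of the bundle, which differ on the overlap by an exact form,
glued with the cutoff function. -/
def glue {k : ℕ} (ζ₀ ζ₁ : DForm (ℍ[ℝ] × E) (TotalSpace M) (k + 1))
    (lam : DForm (ℍ[ℝ] × E) (TotalSpace M) k) : DForm (ℍ[ℝ] × E) (TotalSpace M) (k + 1) :=
  fun p => if p ∈ trivSource M then ζ₀ p + extD (cutForm lam) p else ζ₁ p

theorem glue_of_mem {k : ℕ} (ζ₀ ζ₁ : DForm (ℍ[ℝ] × E) (TotalSpace M) (k + 1))
    (lam : DForm (ℍ[ℝ] × E) (TotalSpace M) k) {p : TotalSpace M} (hp : p ∈ trivSource M) :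
    glue ζ₀ ζ₁ lam p = ζ₀ p + extD (cutForm lam) p := if_pos hp

theorem glue_of_notMem {k : ℕ} (ζ₀ ζ₁ : DForm (ℍ[ℝ] × E) (TotalSpace M) (k + 1))
    (lam : DForm (ℍ[ℝ] × E) (TotalSpace M) k) {p : TotalSpace M} (hp : p ∉ trivSource M) :
    glue ζ₀ ζ₁ lam p = ζ₁ p := if_neg hp

variable [IsManifold 𝓘(ℝ, E) ∞ M] [ContMDiffSMul (𝓡 3) 𝓘(ℝ, E) ∞ SU2 M]

theorem extD_cutForm_of_one_lt {k : ℕ} (lam : DForm (ℍ[ℝ] × E) (TotalSpace M) k)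
    {p : TotalSpace M} (hp : p ∈ trivSource M) (h : 1 < ‖baseCoord p‖) :
    extD (cutForm lam) p = extD lam p := by
  refine extD_congr ?_
  filter_upwards [eventually_cutoff_eq_one hp h] with p' hp'
  rw [cutForm, hp', one_smul]

theorem eventually_eq_glue_of_mem {k : ℕ} (ζ₀ ζ₁ : DForm (ℍ[ℝ] × E) (TotalSpace M) (k + 1))
    (lam : DForm (ℍ[ℝ] × E) (TotalSpace M) k) {p : TotalSpace M} (hp : p ∈ trivSource M) :
    ∀ᶠ p' in 𝓝 p, (ζ₀ + extD (cutForm lam) : DForm (ℍ[ℝ] × E) (TotalSpace M) (k + 1)) p' =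
      glue ζ₀ ζ₁ lam p' := by
  filter_upwards [trivSource_mem_nhds hp] with p' hp'
  rw [glue_of_mem _ _ _ hp', Pi.add_apply]

/-- Near the fiber `v₂ = 0` the coordinate `q` of the points of the overlap has norm greater than 1.
There the cutoff is locally 1, and `ζ₀ + d lam` is `ζ₁`. -/
theorem eventually_eq_glue_of_notMem {k : ℕ} {ζ₀ ζ₁ : DForm (ℍ[ℝ] × E) (TotalSpace M) (k + 1)}
    {lam : DForm (ℍ[ℝ] × E) (TotalSpace M) k} (hd : ∀ p ∈ overlap M, extD lam p = ζ₁ p - ζ₀ p)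
    {p : TotalSpace M} (hp : p ∉ trivSource M) :
    ∀ᶠ p' in 𝓝 p, ζ₁ p' = glue ζ₀ ζ₁ lam p' := by
  have hs := swap_mem_of_notMem hp
  have h1 : ContinuousAt (fun p' : TotalSpace M => ‖baseCoord (swap p')‖) p :=
    (ContinuousAt.comp (g := baseCoord) (continuousAt_baseCoord hs)
      continuous_swap'.continuousAt).norm
  filter_upwards [h1.eventually_lt_const (u := 1) (by simp [baseCoord_swap_of_notMem hp]),
    continuous_swap'.continuousAt.preimage_mem_nhds (trivSource_mem_nhds hs)] with p' h2 h3
  by_cases h4 : p' ∈ trivSource M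
  · have h5 := mem_overlap h4 h3
    have h6 : 1 < ‖baseCoord p'‖ := by
      rw [baseCoord_swap h4 h5.2, norm_inv] at h2
      exact (inv_lt_one₀ (norm_pos_iff.2 h5.2)).1 h2
    rw [glue_of_mem _ _ _ h4, extD_cutForm_of_one_lt _ h4 h6, hd p' h5, add_sub_cancel]
  · rw [glue_of_notMem _ _ _ h4]

theorem contMDiffAt_cutoff {p : TotalSpace M} (hp : p ∈ trivSource M) :
    ContMDiffAt 𝓘(ℝ, ℍ[ℝ] × E) 𝓘(ℝ, ℝ) ∞ cutoff p := by
  have h : ContDiff ℝ ∞ fun q : ℍ[ℝ] => Real.smoothTransition (2 * ‖q‖ ^ 2 - 1) :=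
    Real.smoothTransition.contDiff.comp
      ((contDiff_const.mul (contDiff_norm_sq ℝ)).sub contDiff_const)
  exact (h.contDiffAt.contMDiffAt).comp p (contMDiffAt_baseCoord hp)

theorem smoothFormAt_cutForm {k : ℕ} {lam : DForm (ℍ[ℝ] × E) (TotalSpace M) k}
    (hl : ∀ p ∈ overlap M, SmoothFormAt lam p) {p : TotalSpace M} (hp : p ∈ trivSource M) :
    SmoothFormAt (cutForm lam) p := by
  by_cases h : baseCoord p = 0
  · refine (smoothFormAt_zero p).congr ?_
    filter_upwards [eventually_cutoff_eq_zero hp h] with p' hp'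
    rw [cutForm, hp', zero_smul, Pi.zero_apply]
  · exact (hl p ⟨hp, h⟩).smul (contDiffAt_comp_chart_symm (contMDiffAt_cutoff hp))

theorem eventually_smoothFormAt_cutForm {k : ℕ} {lam : DForm (ℍ[ℝ] × E) (TotalSpace M) k}
    (hl : ∀ p ∈ overlap M, SmoothFormAt lam p) {p : TotalSpace M} (hp : p ∈ trivSource M) :
    ∀ᶠ p' in 𝓝 p, SmoothFormAt (cutForm lam) p' := by
  filter_upwards [trivSource_mem_nhds hp] with p' hp' using smoothFormAt_cutForm hl hp'

section

variable {k : ℕ} {ζ₀ ζ₁ : DForm (ℍ[ℝ] × E) (TotalSpace M) (k + 1)}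
  {lam : DForm (ℍ[ℝ] × E) (TotalSpace M) k}

theorem smoothFormAt_glue (h0 : ∀ p ∈ trivSource M, SmoothFormAt ζ₀ p)
    (h1 : ∀ p, swap p ∈ trivSource M → SmoothFormAt ζ₁ p)
    (hl : ∀ p ∈ overlap M, SmoothFormAt lam p)
    (hd : ∀ p ∈ overlap M, extD lam p = ζ₁ p - ζ₀ p) (p : TotalSpace M) :
    SmoothFormAt (glue ζ₀ ζ₁ lam) p := by
  by_cases hp : p ∈ trivSource M
  · exact ((h0 p hp).add (SmoothFormAt.extD (eventually_smoothFormAt_cutForm hl hp))).congr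
      (eventually_eq_glue_of_mem ζ₀ ζ₁ lam hp)
  · exact (h1 p (swap_mem_of_notMem hp)).congr (eventually_eq_glue_of_notMem hd hp)

/-- The glued form differs from `ζ₀` by `d` of the cut form, which is smooth also at `q = 0` because
the cutoff vanishes near there. -/
theorem extD_glue_of_mem (h0 : ∀ p ∈ trivSource M, SmoothFormAt ζ₀ p)
    (hl : ∀ p ∈ overlap M, SmoothFormAt lam p) {p : TotalSpace M} (hp : p ∈ trivSource M) :
    extD (glue ζ₀ ζ₁ lam) p = extD ζ₀ p := by
  have h := eventually_smoothFormAt_cutForm hl hp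
  rw [← extD_congr (eventually_eq_glue_of_mem ζ₀ ζ₁ lam hp),
    extD_add (h0 p hp) (SmoothFormAt.extD h), extD_extD h, add_zero]

theorem extD_glue_of_notMem (hd : ∀ p ∈ overlap M, extD lam p = ζ₁ p - ζ₀ p)
    {p : TotalSpace M} (hp : p ∉ trivSource M) :
    extD (glue ζ₀ ζ₁ lam) p = extD ζ₁ p :=
  (extD_congr (eventually_eq_glue_of_notMem hd hp)).symm

end

theorem pullback_swap_pullback_swap {k : ℕ} (η : DForm (ℍ[ℝ] × E) (TotalSpace M) k) :
    pullback (E := ℍ[ℝ] × E) swap (pullback (E := ℍ[ℝ] × E) swap η) = η := by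
  funext p
  have h := pullback_comp_apply (g := swap) (f := swap)
    (mdifferentiableAt_of_contMDiffAt (contMDiffAt_swap (E := E) (swap p)))
    (mdifferentiableAt_of_contMDiffAt (contMDiffAt_swap (E := E) p)) η
  rw [← h, show (swap ∘ swap : TotalSpace M → TotalSpace M) = fun p => p from funext swap_swap,
    pullback_id]

variable [FiniteDimensional ℝ E]

/-- A closed `2`-form on the bundle which vanishes on every fiber is exact. -/
theorem exists_primitive_of_fiberwise_zero {β : DForm (ℍ[ℝ] × E) (TotalSpace M) 2}
    (hβ : IsClosedForm β) (hfib : ∀ v : UnitPairs, pullback (E := E) (mk v) β = 0) :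
    ∃ α : DForm (ℍ[ℝ] × E) (TotalSpace M) 1, IsSmoothForm α ∧ extD α = β := by
  have hβs := isSmoothForm_iff.1 hβ.smooth
  have hβc : ∀ p, extD β p = 0 := fun p => congrFun hβ.closed p
  set β' := pullback (E := ℍ[ℝ] × E) swap β with hβ'
  have hβs' : ∀ p, SmoothFormAt β' p := fun p => (hβs (swap p)).pullback (contMDiffAt_swap p)
  have hpz : ∀ {k : ℕ} {f : TotalSpace M → TotalSpace M} {η : DForm (ℍ[ℝ] × E) (TotalSpace M) k}
      {p : TotalSpace M}, η (f p) = 0 → pullback (E := ℍ[ℝ] × E) f η p = 0 := fun h =>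
    (pullback_congr_form (η' := 0) h).trans rfl
  have hβc' : ∀ p, extD β' p = 0 := fun p => by
    rw [hβ', extD_pullback (hβs _) (contMDiffAt_swap p)]
    exact hpz (hβc _)
  have hfib' : pullback (E := E) (mk (affine 0)) β' = 0 := by
    funext x
    have h := pullback_comp_apply (g := swap) (f := mk (affine 0))
      (mdifferentiableAt_of_contMDiffAt (contMDiffAt_swap (E := E) (mk (affine 0) x)))
      (mdifferentiableAt_of_contMDiffAt (contMDiffAt_mk (E := E) (affine 0) x)) β
    rw [hβ', ← h]
    exact congrFun (hfib (affine 0).swap) x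
  set a₀ := coneForm β with ha₀
  -- The primitive on the half `v₁ ≠ 0` is the same cone construction, conjugated by the exchange of
  -- `v₁` and `v₂`.
  set a₁ := pullback (E := ℍ[ℝ] × E) swap (coneForm β') with ha₁
  have h0 : ∀ p ∈ trivSource M, SmoothFormAt a₀ p := fun p hp =>
    smoothFormAt_coneForm (fun p _ => hβs p) hp
  have h0d : ∀ p ∈ trivSource M, extD a₀ p = β p := fun p hp =>
    extD_coneForm (fun p _ => hβs p) (fun p _ => hβc p) (hfib _) hp
  have h1 : ∀ p, swap p ∈ trivSource M → SmoothFormAt a₁ p := fun p hp =>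
    (smoothFormAt_coneForm (fun p _ => hβs' p) hp).pullback (contMDiffAt_swap p)
  have h1d : ∀ p, swap p ∈ trivSource M → extD a₁ p = β p := fun p hp => by
    rw [ha₁, extD_pullback (smoothFormAt_coneForm (fun p _ => hβs' p) hp) (contMDiffAt_swap p),
      pullback_congr_form (η' := β') (extD_coneForm (fun p _ => hβs' p) (fun p _ => hβc' p) hfib'
        hp), hβ', pullback_swap_pullback_swap]
  have hγ : ∀ p ∈ overlap M, SmoothFormAt (a₁ - a₀) p := fun p hp =>
    (h1 p (swap_mem_of_overlap hp)).sub (h0 p hp.1)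
  have hγ' : ∀ p ∈ overlap M, extD (a₁ - a₀) p = 0 := fun p hp => by
    rw [extD_sub (h1 p (swap_mem_of_overlap hp)) (h0 p hp.1), h0d p hp.1,
      h1d p (swap_mem_of_overlap hp), sub_self]
  obtain ⟨f, hf⟩ := exists_primitive_of_overlap hγ hγ'
  have hr : ∀ p : TotalSpace M, retract 1 p ∈ overlap M := fun p =>
    ofCoords_mem_overlap one_ne_zero _
  -- The retraction is smooth on the whole half `v₂ ≠ 0`, including `q = 0`. So `ρ` is closed there,
  -- and adding it to `a₀` keeps a primitive of `β`.
  set ρ := pullback (E := ℍ[ℝ] × E) (retract 1) (a₁ - a₀) with hρ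
  have hρs : ∀ p ∈ trivSource M, SmoothFormAt ρ p := fun p hp =>
    (hγ _ (hr p)).pullback (contMDiffAt_retract 1 hp)
  have hρd : ∀ p ∈ trivSource M, extD ρ p = 0 := fun p hp => by
    rw [hρ, extD_pullback (hγ _ (hr p)) (contMDiffAt_retract 1 hp)]
    exact hpz (hγ' _ (hr p))
  have hd : ∀ p ∈ overlap M, extD (funForm (ℍ[ℝ] × E) f) p =
      a₁ p - (a₀ + ρ : DForm (ℍ[ℝ] × E) (TotalSpace M) 1) p := fun p hp => by
    rw [(hf p hp).2]
    simp only [Pi.sub_apply, Pi.add_apply]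
    abel
  have h0' : ∀ p ∈ trivSource M, SmoothFormAt (a₀ + ρ) p := fun p hp => (h0 p hp).add (hρs p hp)
  refine ⟨glue (a₀ + ρ) a₁ (funForm (ℍ[ℝ] × E) f), isSmoothForm_iff.2
    (smoothFormAt_glue h0' h1 (fun p hp => (hf p hp).1) hd), ?_⟩
  funext p
  by_cases hp : p ∈ trivSource M
  · rw [extD_glue_of_mem h0' (fun p hp => (hf p hp).1) hp, extD_add (h0 p hp) (hρs p hp),
      h0d p hp, hρd p hp, add_zero]
  · rw [extD_glue_of_notMem hd hp, h1d p (swap_mem_of_notMem hp)]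

end Glue

end TotalSpace

/-! ### Functionals on ℍ determined by commutators -/

section Commutator

/-- A quaternion unit. -/
@[simps]
def unitI : ℍ[ℝ] := ⟨0, 1, 0, 0⟩

/-- A quaternion unit. -/
@[simps]
def unitJ : ℍ[ℝ] := ⟨0, 0, 1, 0⟩

/-- A quaternion unit. -/
@[simps]
def unitK : ℍ[ℝ] := ⟨0, 0, 0, 1⟩

/-- An imaginary coordinate of a quaternion. -/
def coordI : ℍ[ℝ] →L[ℝ] ℝ where
  toFun q := q.imI
  map_add' _ _ := rfl
  map_smul' _ _ := rfl
  cont := Quaternion.continuous_imI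

/-- An imaginary coordinate of a quaternion. -/
def coordJ : ℍ[ℝ] →L[ℝ] ℝ where
  toFun q := q.imJ
  map_add' _ _ := rfl
  map_smul' _ _ := rfl
  cont := Quaternion.continuous_imJ

/-- An imaginary coordinate of a quaternion. -/
def coordK : ℍ[ℝ] →L[ℝ] ℝ where
  toFun q := q.imK
  map_add' _ _ := rfl
  map_smul' _ _ := rfl
  cont := Quaternion.continuous_imK

theorem quaternion_eq_sum (x : ℍ[ℝ]) :
    x = x.re • (1 : ℍ[ℝ]) + x.imI • unitI + x.imJ • unitJ + x.imK • unitK := by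
  ext <;> simp

/-- `ℍ` is spanned by `1` and commutators, as `[j, k] = 2i` and cyclically. This is the perfectness
of `su(2)`, and it makes the moment map unique. -/
theorem linear_eq_zero_of_commutator {f : ℍ[ℝ] →ₗ[ℝ] ℝ} (h1 : f 1 = 0)
    (h : ∀ x y, f (x * y - y * x) = 0) (u : ℍ[ℝ]) : f u = 0 := by
  have hu : u = u.re • (1 : ℍ[ℝ]) + (u.imI / 2) • (unitJ * unitK - unitK * unitJ) +
      (u.imJ / 2) • (unitK * unitI - unitI * unitK) +
      (u.imK / 2) • (unitI * unitJ - unitJ * unitI) := by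
    ext <;> simp <;> ring
  rw [hu]
  simp only [map_add, map_smul, h1, h, smul_zero, add_zero]

variable {E : Type*} [NormedAddCommGroup E] [NormedSpace ℝ E]

/-- The linear functional `F` on `ℍ` with `F (x y - y x) = A ((x, 0), (y, 0))`, for a `2`-form `A`
on `ℍ × E` with `A ((1, 0), ·) = 0`. -/
def commDual : ((ℍ[ℝ] × E) [⋀^Fin 2]→L[ℝ] ℝ) →L[ℝ] ℍ[ℝ] →L[ℝ] ℝ :=
  (1 / 2 : ℝ) • (
    (ContinuousAlternatingMap.apply ℝ (ℍ[ℝ] × E) ℝ ![(unitJ, 0), (unitK, 0)]).smulRight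
      coordI +
    (ContinuousAlternatingMap.apply ℝ (ℍ[ℝ] × E) ℝ ![(unitK, 0), (unitI, 0)]).smulRight
      coordJ +
    (ContinuousAlternatingMap.apply ℝ (ℍ[ℝ] × E) ℝ ![(unitI, 0), (unitJ, 0)]).smulRight
      coordK)

theorem commDual_apply (A : (ℍ[ℝ] × E) [⋀^Fin 2]→L[ℝ] ℝ) (x : ℍ[ℝ]) :
    commDual A x = 1 / 2 * (A ![(unitJ, 0), (unitK, 0)] * x.imI +
      A ![(unitK, 0), (unitI, 0)] * x.imJ + A ![(unitI, 0), (unitJ, 0)] * x.imK) := rfl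

theorem commDual_one (A : (ℍ[ℝ] × E) [⋀^Fin 2]→L[ℝ] ℝ) : commDual A 1 = 0 := by
  simp [commDual_apply]

/-- On imaginary quaternions the bracket is twice the cross product, and an alternating form on a
3-dimensional space factors through the cross product; hence the factor `1/2` in `commDual`. The
condition on `1` removes the real direction. -/
theorem commDual_commutator {A : (ℍ[ℝ] × E) [⋀^Fin 2]→L[ℝ] ℝ}
    (hA : ∀ u : ℍ[ℝ], A ![(1, 0), (u, 0)] = 0) (x y : ℍ[ℝ]) :
    commDual A (x * y - y * x) = A ![(x, 0), (y, 0)] := by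
  have hA' : ∀ u : ℍ[ℝ], A ![(u, 0), (1, 0)] = 0 := fun u => by
    rw [form_two_swap, hA, neg_zero]
  have hx : ∀ x : ℍ[ℝ], ((x, 0) : ℍ[ℝ] × E) = x.re • ((1 : ℍ[ℝ]), (0 : E)) +
      x.imI • (unitI, (0 : E)) + x.imJ • (unitJ, (0 : E)) + x.imK • (unitK, (0 : E)) := fun x => by
    refine Prod.ext ?_ (by simp)
    simpa using quaternion_eq_sum x
  rw [hx x, hx y]
  simp only [form_two_add_left, form_two_add_right, form_two_smul_left, form_two_smul_right,
    form_two_self, hA, hA']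
  rw [form_two_swap A (unitJ, 0) (unitI, 0), form_two_swap A (unitI, 0) (unitK, 0),
    form_two_swap A (unitK, 0) (unitJ, 0), commDual_apply]
  simp
  ring

/-- The `1`-form `(w, v) ↦ -F (q⁻¹ w)`. -/
def commForm (A : (ℍ[ℝ] × E) [⋀^Fin 2]→L[ℝ] ℝ) (q : ℍ[ℝ]) : (ℍ[ℝ] × E) [⋀^Fin 1]→L[ℝ] ℝ :=
  ContinuousAlternatingMap.ofSubsingleton ℝ (ℍ[ℝ] × E) ℝ (0 : Fin 1)
    (-((commDual A).comp ((ContinuousLinearMap.mul ℝ ℍ[ℝ] q⁻¹).comp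
      (ContinuousLinearMap.fst ℝ ℍ[ℝ] E))))

theorem commForm_apply (A : (ℍ[ℝ] × E) [⋀^Fin 2]→L[ℝ] ℝ) (q : ℍ[ℝ]) (a : Fin 1 → ℍ[ℝ] × E) :
    commForm A q a = -commDual A (q⁻¹ * (a 0).1) := rfl

end Commutator

/-! ### The moment map identity and the derivative of the transgression in a chart -/

section Local

variable {E : Type*} [NormedAddCommGroup E] [NormedSpace ℝ E] [FiniteDimensional ℝ E]
  {B : ℍ[ℝ] × E → (ℍ[ℝ] × E) [⋀^Fin 2]→L[ℝ] ℝ} {U : Set E}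

theorem contDiffAt_commForm {x : ℍ[ℝ] × E} (hB : ContDiffAt ℝ ∞ B (1, x.2)) (hx : x.1 ≠ 0) :
    ContDiffAt ℝ ∞ (fun x : ℍ[ℝ] × E => commForm (B (1, x.2)) x.1) x := by
  refine contDiffAt_form_iff.2 fun v => ?_
  simp only [commForm_apply]
  have h1 : ContDiffAt ℝ ∞ (fun x : ℍ[ℝ] × E => B (1, x.2)) x :=
    ContDiffAt.comp (f := fun x : ℍ[ℝ] × E => ((1 : ℍ[ℝ]), x.2)) x hB
      (contDiffAt_const.prodMk contDiffAt_snd)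
  have h2 : ContDiffAt ℝ ∞ (fun x : ℍ[ℝ] × E => x.1⁻¹ * (v 0).1) x :=
    (ContDiffAt.comp (g := fun q : ℍ[ℝ] => q⁻¹) x (TotalSpace.contDiffAt_quaternion_inv hx)
      contDiffAt_fst).mul contDiffAt_const
  exact ((commDual.contDiff.contDiffAt.comp x h1).clm_apply h2).neg

/-- The identity `hrad` holds along the whole fiber over `1`, so it can be differentiated in a fiber
direction. Thus `commDual_commutator` applies to the derivative of `B` too. -/
theorem fderiv_vertical_apply (hU : IsOpen U)
    (hB : ∀ z ∈ U, ContDiffAt ℝ ∞ B (1, z))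
    (hrad : ∀ z ∈ U, ∀ u : ℍ[ℝ], B (1, z) ![(1, 0), (u, 0)] = 0) {z : E} (hz : z ∈ U) (v : E)
    (u : ℍ[ℝ]) : fderiv ℝ B (1, z) (0, v) ![(1, 0), (u, 0)] = 0 := by
  have h1 := hasDerivAt_form_two (hasDerivAt_line (v := ((0 : ℍ[ℝ]), v))
    (contDiffAt_differentiableAt (hB z hz))) (hasDerivAt_const (0 : ℝ) ((1 : ℍ[ℝ]), (0 : E)))
    (hasDerivAt_const (0 : ℝ) (u, (0 : E)))
  have h0 : ∀ a : ℍ[ℝ] × E, B ((1, z) + (0 : ℝ) • ((0 : ℍ[ℝ]), v)) ![0, a] = 0 := fun a =>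
    (B ((1, z) + (0 : ℝ) • ((0 : ℍ[ℝ]), v))).map_coord_zero 0 rfl
  rw [form_two_swap _ _ 0, h0, h0, neg_zero, add_zero, add_zero] at h1
  refine h1.unique ((hasDerivAt_const (0 : ℝ) (0 : ℝ)).congr_of_eventuallyEq ?_)
  have hc : ContinuousAt (fun s : ℝ => z + s • v) 0 := by fun_prop
  filter_upwards [hc.preimage_mem_nhds (hU.mem_nhds (by simpa using hz))] with s hs
  have := hrad _ hs u
  simpa using this

/-- By invariance `B (q, z)` on `(q y, 0)` and `(0, v)` is constant in `q`; the product rule at `q =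
1` along `1 + s x` gives the formula. -/
theorem fderiv_horizontal_apply
    (hB : ∀ z ∈ U, ContDiffAt ℝ ∞ B (1, z))
    (hinv : ∀ q : ℍ[ℝ], q ≠ 0 → ∀ z ∈ U, ∀ a b : ℍ[ℝ] × E,
      B (q, z) ![(q * a.1, a.2), (q * b.1, b.2)] = B (1, z) ![a, b]) {z : E} (hz : z ∈ U)
    (x y : ℍ[ℝ]) (v : E) : fderiv ℝ B (1, z) (x, 0) ![(y, 0), (0, v)] =
      -B (1, z) ![(x * y, 0), (0, v)] := by
  have hl : HasDerivAt (fun s : ℝ => (((1 : ℍ[ℝ]) + s • x) * y, (0 : E))) (x * y, 0) 0 := by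
    have h1 : HasDerivAt (fun s : ℝ => ((1 : ℍ[ℝ]) + s • x) * y) (x * y) 0 := by
      simpa using (((hasDerivAt_id (0 : ℝ)).smul_const x).const_add 1).mul_const y
    exact h1.prodMk (hasDerivAt_const _ _)
  have h1 := hasDerivAt_form_two (hasDerivAt_line (v := (x, (0 : E)))
    (contDiffAt_differentiableAt (hB z hz))) hl (hasDerivAt_const (0 : ℝ) ((0 : ℍ[ℝ]), v))
  have h0 : ∀ a : ℍ[ℝ] × E, B ((1, z) + (0 : ℝ) • (x, (0 : E))) ![a, 0] = 0 := fun a =>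
    (B ((1, z) + (0 : ℝ) • (x, (0 : E)))).map_coord_zero 1 rfl
  rw [h0, add_zero] at h1
  have h2 := h1.unique ((hasDerivAt_const (0 : ℝ) (B (1, z) ![(y, 0), (0, v)])).congr_of_eventuallyEq
    (by
      have hc : ContinuousAt (fun s : ℝ => (1 : ℍ[ℝ]) + s • x) 0 := by fun_prop
      filter_upwards [hc.eventually_ne (y := 0) (by simp)] with s hs
      have := hinv _ hs z hz (y, 0) (0, v)
      simpa using this))
  simp only [zero_smul, add_zero, one_mul] at h2
  linarith

/-- The moment map equation `dF_u = σ(X_u, ·)`. Both sides vanish at `u = 1`. On a commutator `u = x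
y - y x` they agree by closedness of `B` on `(x, 0)`, `(y, 0)`, `(0, v)`, whose horizontal
derivatives are known from invariance. -/
theorem commDual_fderiv (hU : IsOpen U)
    (hB : ∀ z ∈ U, ContDiffAt ℝ ∞ B (1, z)) (hclosed : ∀ z ∈ U, extDeriv B (1, z) = 0)
    (hinv : ∀ q : ℍ[ℝ], q ≠ 0 → ∀ z ∈ U, ∀ a b : ℍ[ℝ] × E,
      B (q, z) ![(q * a.1, a.2), (q * b.1, b.2)] = B (1, z) ![a, b])
    (hrad : ∀ z ∈ U, ∀ a : ℍ[ℝ] × E, B (1, z) ![(1, 0), a] = 0) {z : E} (hz : z ∈ U) (v : E)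
    (u : ℍ[ℝ]) : commDual (fderiv ℝ B (1, z) (0, v)) u = B (1, z) ![(u, 0), (0, v)] := by
  set f : ℍ[ℝ] →ₗ[ℝ] ℝ := (commDual (fderiv ℝ B (1, z) (0, v))).toLinearMap -
    { toFun := fun u => B (1, z) ![(u, 0), (0, v)]
      map_add' := fun x y => by
        rw [← form_two_add_left, Prod.mk_add_mk, add_zero]
      map_smul' := fun c x => by
        rw [RingHom.id_apply, smul_eq_mul, ← form_two_smul_left, Prod.smul_mk, smul_zero] } with hf
  have hf' : ∀ u, f u = commDual (fderiv ℝ B (1, z) (0, v)) u - B (1, z) ![(u, 0), (0, v)] :=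
    fun u => rfl
  refine sub_eq_zero.1 ((hf' u).symm.trans (linear_eq_zero_of_commutator ?_ (fun x y => ?_) u))
  · rw [hf', commDual_one, hrad z hz, sub_zero]
  · rw [hf', commDual_commutator fun u =>
      fderiv_vertical_apply hU hB (fun z hz u => hrad z hz _) hz v u]
    have h1 := congrArg (fun A => A ![(x, (0 : E)), (y, 0), (0, v)]) (hclosed z hz)
    simp only [extDeriv_apply_three] at h1
    change _ = (0 : ℝ) at h1
    rw [fderiv_horizontal_apply hB hinv hz, fderiv_horizontal_apply hB hinv hz] at h1
    have h2 : B (1, z) ![(x * y, 0), (0, v)] = B (1, z) ![(x * y - y * x, 0), (0, v)] +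
        B (1, z) ![(y * x, 0), (0, v)] := by
      rw [← form_two_add_left, Prod.mk_add_mk, add_zero, sub_add_cancel]
    linarith

theorem differentiableAt_form_apply {X Y : Type*} [NormedAddCommGroup X] [NormedSpace ℝ X]
    [NormedAddCommGroup Y] [NormedSpace ℝ Y] {k : ℕ} {A : Y → X [⋀^Fin k]→L[ℝ] ℝ} {y : Y}
    (hA : DifferentiableAt ℝ A y) (v : Fin k → X) : DifferentiableAt ℝ (fun y => A y v) y :=
  (ContinuousAlternatingMap.apply ℝ X ℝ v).differentiableAt.comp y hA

theorem hasDerivAt_snd_line {V X W : Type*} [NormedAddCommGroup V] [NormedSpace ℝ V]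
    [NormedAddCommGroup X] [NormedSpace ℝ X] [NormedAddCommGroup W] [NormedSpace ℝ W]
    {g : V × X → W} {c : V} {x : V × X} (a : V × X) (hg : DifferentiableAt ℝ g (c, x.2)) :
    HasDerivAt (fun s : ℝ => g (c, (x + s • a).2)) (fderiv ℝ g (c, x.2) (0, a.2)) 0 := by
  have h1 := hasDerivAt_line (v := ((0 : V), a.2)) hg
  refine h1.congr_of_eventuallyEq (Eventually.of_forall fun s => ?_)
  simp

theorem hasDerivAt_bilinear {V W G : Type*} [NormedAddCommGroup V] [NormedSpace ℝ V]
    [NormedAddCommGroup G] [NormedSpace ℝ G] [NormedAddCommGroup W] [NormedSpace ℝ W]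
    (L : G →L[ℝ] V →L[ℝ] W) {c : ℝ → G} {c' : G} {u : ℝ → V} {u' : V} {t : ℝ}
    (hc : HasDerivAt c c' t) (hu : HasDerivAt u u' t) :
    HasDerivAt (fun s => L (c s) (u s)) (L c' (u t) + L (c t) u') t :=
  (L.hasFDerivAt.comp_hasDerivAt t hc).clm_apply hu

/-- The first term varies the functional along the fiber; the second varies `q⁻¹` and
antisymmetrizes to the Maurer–Cartan equation for `q⁻¹ dq`. -/
theorem fderiv_commForm (hB : ∀ z ∈ U, ContDiffAt ℝ ∞ B (1, z)) {x : ℍ[ℝ] × E} (hx : x.1 ≠ 0) (hz : x.2 ∈ U)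
    (a b : ℍ[ℝ] × E) :
    fderiv ℝ (fun x : ℍ[ℝ] × E => commForm (B (1, x.2)) x.1) x a ![b] =
      -commDual (fderiv ℝ B (1, x.2) (0, a.2)) (x.1⁻¹ * b.1) +
        commDual (B (1, x.2)) (x.1⁻¹ * a.1 * (x.1⁻¹ * b.1)) := by
  have hs := contDiffAt_differentiableAt (contDiffAt_commForm (x := x) (hB _ hz) hx)
  rw [fderiv_form_apply hs]
  have hs' : DifferentiableAt ℝ (fun x : ℍ[ℝ] × E => commForm (B (1, x.2)) x.1 ![b]) x :=
    differentiableAt_form_apply hs _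
  refine fderiv_apply_eq_of_hasDerivAt hs' ?_
  simp only [commForm_apply]
  have h1 := hasDerivAt_snd_line a (contDiffAt_differentiableAt (hB _ hz))
  have h2 : HasDerivAt (fun s : ℝ => (x.1 + s • a.1)⁻¹) (-(x.1⁻¹ * a.1 * x.1⁻¹)) 0 := by
    have h3 : HasDerivAt (fun s : ℝ => x.1 + s • a.1) a.1 0 := by
      simpa using ((hasDerivAt_id (0 : ℝ)).smul_const a.1).const_add x.1
    have h4 : HasFDerivAt (fun q : ℍ[ℝ] => q⁻¹) _ (x.1 + (0 : ℝ) • a.1) :=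
      hasFDerivAt_inv' (𝕜 := ℝ) (by simpa using hx)
    refine (h4.comp_hasDerivAt (0 : ℝ) h3).congr_deriv ?_
    simp
  have h3 := hasDerivAt_bilinear (commDual (E := E)) h1 (h2.mul_const b.1)
  refine h3.neg.congr_deriv ?_
  rw [zero_smul, add_zero, zero_smul, add_zero, neg_mul, map_neg, mul_assoc (x.1⁻¹ * a.1)]
  ring

/-- The exterior derivative of `commForm`. -/
theorem extDeriv_commForm (hU : IsOpen U)
    (hB : ∀ z ∈ U, ContDiffAt ℝ ∞ B (1, z)) (hclosed : ∀ z ∈ U, extDeriv B (1, z) = 0)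
    (hinv : ∀ q : ℍ[ℝ], q ≠ 0 → ∀ z ∈ U, ∀ a b : ℍ[ℝ] × E,
      B (q, z) ![(q * a.1, a.2), (q * b.1, b.2)] = B (1, z) ![a, b])
    (hrad : ∀ z ∈ U, ∀ a : ℍ[ℝ] × E, B (1, z) ![(1, 0), a] = 0)
    {x : ℍ[ℝ] × E} (hx : x.1 ≠ 0) (hz : x.2 ∈ U) (a b : ℍ[ℝ] × E) :
    extDeriv (fun x : ℍ[ℝ] × E => commForm (B (1, x.2)) x.1) x ![a, b] =
      B x ![a, b] - B (1, x.2) ![(0, a.2), (0, b.2)] := by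
  rw [extDeriv_apply_two, fderiv_commForm hB hx hz, fderiv_commForm hB hx hz,
    commDual_fderiv hU hB hclosed hinv hrad hz, commDual_fderiv hU hB hclosed hinv hrad hz]
  -- The bracket term supplies the horizontal-horizontal part of `B`; the moment map terms supply
  -- the mixed part. Only the vertical-vertical part is missing, and it is the subtracted one.
  have h1 := commDual_commutator (fun u => hrad _ hz (u, 0)) (x.1⁻¹ * a.1) (x.1⁻¹ * b.1)
  rw [map_sub] at h1
  have h2 := hinv x.1 hx x.2 hz (x.1⁻¹ * a.1, a.2) (x.1⁻¹ * b.1, b.2)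
  simp only [mul_inv_cancel_left₀ hx] at h2
  have h3 : ∀ c : ℍ[ℝ] × E, ((x.1⁻¹ * c.1, c.2) : ℍ[ℝ] × E) =
      (x.1⁻¹ * c.1, 0) + (0, c.2) := fun c => by simp
  rw [h3 a, h3 b] at h2
  simp only [form_two_add_left, form_two_add_right] at h2
  rw [form_two_swap _ (0, a.2) (x.1⁻¹ * b.1, 0)] at h2
  change B x ![a, b] = _ at h2
  linarith

end Local

/-- `commDual` sees horizontal vectors only, so it is unaffected by a change of fiber chart. -/
theorem commDual_comp {E : Type*} [NormedAddCommGroup E] [NormedSpace ℝ E]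
    (A : (ℍ[ℝ] × E) [⋀^Fin 2]→L[ℝ] ℝ) (D : E →L[ℝ] E) :
    commDual (A.compContinuousLinearMap ((ContinuousLinearMap.id ℝ ℍ[ℝ]).prodMap D)) =
      commDual A := by
  have h : ∀ x y : ℍ[ℝ], ⇑((ContinuousLinearMap.id ℝ ℍ[ℝ]).prodMap D) ∘ ![(x, 0), (y, 0)] =
      ![(x, 0), (y, 0)] := fun x y => by
    ext i <;> fin_cases i <;> simp
  ext x
  rw [commDual_apply, commDual_apply]
  simp only [ContinuousAlternatingMap.compContinuousLinearMap_apply, h]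

theorem unitPart_mul_of_ne_zero {a b : ℍ[ℝ]} (ha : a ≠ 0) (hb : b ≠ 0) :
    unitPart (a * b) = unitPart a * unitPart b := by
  apply Subtype.ext
  rw [coe_unitPart (mul_ne_zero ha hb)]
  change _ = (unitPart a : ℍ[ℝ]) * (unitPart b : ℍ[ℝ])
  rw [coe_unitPart ha, coe_unitPart hb, smul_mul_smul_comm, norm_mul, mul_inv]

theorem unitPart_smul_one {r : ℝ} (hr : 0 < r) : unitPart (r • (1 : ℍ[ℝ])) = 1 := by
  apply Subtype.ext
  rw [coe_unitPart (smul_ne_zero hr.ne' one_ne_zero)]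
  change _ = (1 : ℍ[ℝ])
  rw [norm_smul, norm_one, mul_one, Real.norm_of_nonneg hr.le, smul_smul,
    inv_mul_cancel₀ hr.ne', one_smul]

namespace TotalSpace

/-! ### The two local extensions and the transgression between them -/

section FarForm

variable {E : Type*} [NormedAddCommGroup E] [NormedSpace ℝ E] {M : Type*} [TopologicalSpace M]
  [ChartedSpace E M] [MulAction SU2 M] [ContinuousSMul SU2 M]

/-- The pullback of a form on `M` by the fiber coordinate over `v₂ ≠ 0`. -/
def nearForm {k : ℕ} (σ : DForm E M k) : DForm (ℍ[ℝ] × E) (TotalSpace M) k :=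
  pullback (E := ℍ[ℝ] × E) fiberCoord σ

/-- The pullback of a form on `M` by the fiber coordinate over `v₁ ≠ 0`. -/
def farForm {k : ℕ} (σ : DForm E M k) : DForm (ℍ[ℝ] × E) (TotalSpace M) k :=
  pullback (E := ℍ[ℝ] × E) (fun p => fiberCoord (swap p)) σ

/-- `(q, y) ↦ (a q, y)` in the trivialization over `v₂ ≠ 0`. -/
def mulBase (a : ℍ[ℝ]) (p : TotalSpace M) : TotalSpace M := ofCoords (a * baseCoord p) (fiberCoord p)

theorem hasMFDerivAt_mulBase (a : ℍ[ℝ]) {p : TotalSpace M} (hp : p ∈ trivSource M) :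
    HasMFDerivAt 𝓘(ℝ, ℍ[ℝ] × E) 𝓘(ℝ, ℍ[ℝ] × E) (mulBase a) p
      (((ContinuousLinearMap.mul ℝ ℍ[ℝ] a).comp (ContinuousLinearMap.fst ℝ ℍ[ℝ] E)).prod
        (ContinuousLinearMap.snd ℝ ℍ[ℝ] E) : ℍ[ℝ] × E →L[ℝ] ℍ[ℝ] × E) := by
  have h1 : HasMFDerivAt 𝓘(ℝ, ℍ[ℝ]) 𝓘(ℝ, ℍ[ℝ]) (fun q : ℍ[ℝ] => a * q) (baseCoord p)
      (ContinuousLinearMap.mul ℝ ℍ[ℝ] a) :=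
    (ContinuousLinearMap.mul ℝ ℍ[ℝ] a).hasMFDerivAt
  exact hasMFDerivAt_ofCoords (h1.comp p (hasMFDerivAt_baseCoord hp)) (hasMFDerivAt_fiberCoord hp)

variable [IsManifold 𝓘(ℝ, E) ∞ M] [ContMDiffSMul (𝓡 3) 𝓘(ℝ, E) ∞ SU2 M]

theorem contMDiffAt_smul_const {F : Type*} [NormedAddCommGroup F] [NormedSpace ℝ F] {N : Type*}
    [TopologicalSpace N] [ChartedSpace F N] (g : SU2) {f : N → M} {x : N}
    (hf : ContMDiffAt 𝓘(ℝ, F) 𝓘(ℝ, E) ∞ f x) :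
    ContMDiffAt 𝓘(ℝ, F) 𝓘(ℝ, E) ∞ (fun x => g • f x) x :=
  (contMDiffAt_const (I := 𝓘(ℝ, F)) (I' := 𝓡 3) (n := ∞) (c := g)).smul hf

theorem pullback_smul_of_invariant {F : Type*} [NormedAddCommGroup F] [NormedSpace ℝ F]
    {N : Type*} [TopologicalSpace N] [ChartedSpace F N] [IsManifold 𝓘(ℝ, F) ∞ N] {k : ℕ} {σ : DForm E M k}
    (hφ : ∀ g : SU2, pullback (fun x : M => g • x) σ = σ) (g : SU2) {f : N → M} {x : N}
    (hf : ContMDiffAt 𝓘(ℝ, F) 𝓘(ℝ, E) ∞ f x) :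
    pullback (E := F) (fun x => g • f x) σ x = pullback (E := F) f σ x := by
  have h := pullback_comp_apply (g := fun y : M => g • y) (f := f)
    (mdifferentiableAt_of_contMDiffAt (contMDiffAt_smul_const g contMDiffAt_id))
    (mdifferentiableAt_of_contMDiffAt hf) σ
  rw [hφ] at h
  exact h

theorem contMDiffAt_fiberCoord_swap {p : TotalSpace M} (hp : swap p ∈ trivSource M) :
    ContMDiffAt 𝓘(ℝ, ℍ[ℝ] × E) 𝓘(ℝ, E) ∞ (fun p => fiberCoord (swap p)) p :=
  (contMDiffAt_fiberCoord hp).comp p (contMDiffAt_swap p)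

theorem contMDiffAt_mulBase (a : ℍ[ℝ]) {p : TotalSpace M} (hp : p ∈ trivSource M) :
    ContMDiffAt 𝓘(ℝ, ℍ[ℝ] × E) 𝓘(ℝ, ℍ[ℝ] × E) ∞ (mulBase a) p := by
  have h1 : ContMDiffAt 𝓘(ℝ, ℍ[ℝ]) 𝓘(ℝ, ℍ[ℝ]) ∞ (fun q : ℍ[ℝ] => a * q) (baseCoord p) :=
    (contDiff_const.mul contDiff_id).contDiffAt.contMDiffAt
  exact contMDiffAt_ofCoords (h1.comp p (contMDiffAt_baseCoord hp)) (contMDiffAt_fiberCoord hp)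

section

variable {k : ℕ} {σ : DForm E M k}

/-- The far fiber coordinate `ψ` satisfies `ψ(a q, y) = φ(a/|a|, ψ(q, y))`, and `φ` preserves `σ`.
-/
theorem pullback_mulBase_farForm (hφ : ∀ g : SU2, pullback (fun x : M => g • x) σ = σ)
    {a : ℍ[ℝ]} (ha : a ≠ 0) {p : TotalSpace M} (hp : p ∈ overlap M) :
    pullback (E := ℍ[ℝ] × E) (mulBase a) (farForm σ) p = farForm σ p := by
  have hq : mulBase a p ∈ overlap M := ofCoords_mem_overlap (mul_ne_zero ha hp.2) _
  have h := pullback_comp_apply (g := fun p : TotalSpace M => fiberCoord (swap p)) (f := mulBase a)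
    (mdifferentiableAt_of_contMDiffAt (contMDiffAt_fiberCoord_swap (E := E)
      (swap_mem_of_overlap hq)))
    (mdifferentiableAt_of_contMDiffAt (contMDiffAt_mulBase (E := E) a hp.1)) σ
  refine h.symm.trans ((pullback_congr ?_ σ).trans (pullback_smul_of_invariant hφ (unitPart a)
    (contMDiffAt_fiberCoord_swap (swap_mem_of_overlap hp))))
  filter_upwards [overlap_mem_nhds hp] with p' hp'
  have h1 : swap p' = ofCoords (baseCoord p')⁻¹ (unitPart (baseCoord p') • fiberCoord p') := by
    rw [← swap_ofCoords hp'.2, ofCoords_coords hp'.1]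
  simp only [Function.comp_apply]
  rw [mulBase, swap_ofCoords (mul_ne_zero ha hp'.2), h1, fiberCoord_ofCoords, fiberCoord_ofCoords,
    unitPart_mul_of_ne_zero ha hp'.2, mul_smul]

theorem valueAt_farForm_mul {σ : DForm E M 2}
    (hφ : ∀ g : SU2, pullback (fun x : M => g • x) σ = σ)
    {q : ℍ[ℝ]} (hq : q ≠ 0) (y : M) (a b : ℍ[ℝ] × E) :
    valueAt (farForm σ) q y ![(q * a.1, a.2), (q * b.1, b.2)] =
      valueAt (farForm σ) 1 y ![a, b] := by
  have hp : (ofCoords 1 y : TotalSpace M) ∈ overlap M := ofCoords_mem_overlap one_ne_zero y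
  have h1 := pullback_mulBase_farForm (E := E) hφ hq hp
  have h2 : pullback (E := ℍ[ℝ] × E) (mulBase q) (farForm σ) (ofCoords 1 y) =
      (valueAt (farForm σ) (q * baseCoord (ofCoords 1 y))
        (fiberCoord (ofCoords 1 y))).compContinuousLinearMap
      (((ContinuousLinearMap.mul ℝ ℍ[ℝ] q).comp (ContinuousLinearMap.fst ℝ ℍ[ℝ] E)).prod
        (ContinuousLinearMap.snd ℝ ℍ[ℝ] E)) := by
    simp only [pullback]
    rw [show mfderiv 𝓘(ℝ, ℍ[ℝ] × E) 𝓘(ℝ, ℍ[ℝ] × E) (mulBase q) (ofCoords 1 y) = _ from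
      (hasMFDerivAt_mulBase q hp.1).mfderiv]
    rfl
  rw [baseCoord_ofCoords, fiberCoord_ofCoords, mul_one, h1] at h2
  have h3 := congrArg (fun A : (ℍ[ℝ] × E) [⋀^Fin 2]→L[ℝ] ℝ => A ![a, b]) h2
  simp only [ContinuousAlternatingMap.compContinuousLinearMap_apply] at h3
  refine Eq.trans ?_ h3.symm
  congr 1
  ext i <;> fin_cases i <;> rfl

/-- `ψ` depends on `q` only through `q/|q|`, so it is constant along the ray `r ↦ r · 1` and its
derivative kills the radial vector. -/
theorem valueAt_farForm_radial (σ : DForm E M 2) (y : M) (a : ℍ[ℝ] × E) :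
    valueAt (farForm σ) 1 y ![(1, 0), a] = 0 := by
  set ρ : ℝ → TotalSpace M := fun r => ofCoords (r • (1 : ℍ[ℝ])) y with hρ
  have hp : ρ 1 ∈ overlap M := ofCoords_mem_overlap (smul_ne_zero one_ne_zero one_ne_zero) y
  have h1 : HasMFDerivAt 𝓘(ℝ, ℝ) 𝓘(ℝ, ℍ[ℝ]) (fun r : ℝ => r • (1 : ℍ[ℝ])) 1
      (ContinuousLinearMap.toSpanSingleton ℝ (1 : ℍ[ℝ])) :=
    (ContinuousLinearMap.toSpanSingleton ℝ (1 : ℍ[ℝ])).hasMFDerivAt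
  have h2 : HasMFDerivAt 𝓘(ℝ, ℝ) 𝓘(ℝ, ℍ[ℝ] × E) ρ 1
      ((ContinuousLinearMap.toSpanSingleton ℝ (1 : ℍ[ℝ])).prod 0 : ℝ →L[ℝ] ℍ[ℝ] × E) :=
    hasMFDerivAt_ofCoords h1 (hasMFDerivAt_const y 1)
  have h3 := (mdifferentiableAt_of_contMDiffAt (contMDiffAt_fiberCoord_swap (E := E)
    (swap_mem_of_overlap hp))).hasMFDerivAt
  have h4 := h3.comp 1 h2
  have h5 : HasMFDerivAt 𝓘(ℝ, ℝ) 𝓘(ℝ, E) ((fun p : TotalSpace M => fiberCoord (swap p)) ∘ ρ) 1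
      (0 : ℝ →L[ℝ] E) := by
    refine (hasMFDerivAt_const y (1 : ℝ)).congr_of_eventuallyEq ?_
    filter_upwards [lt_mem_nhds (show (0 : ℝ) < 1 from one_pos)] with r hr
    simp only [hρ, Function.comp_apply]
    rw [swap_ofCoords (smul_ne_zero hr.ne' one_ne_zero), fiberCoord_ofCoords,
      unitPart_smul_one hr, one_smul]
  have h6 := congrArg (fun L : ℝ →L[ℝ] E => L 1) (hasMFDerivAt_unique h4 h5)
  have h7 : mfderiv 𝓘(ℝ, ℍ[ℝ] × E) 𝓘(ℝ, E) (fun p : TotalSpace M => fiberCoord (swap p)) (ρ 1)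
      ((1 : ℝ) • (1 : ℍ[ℝ]), (0 : E)) = (0 : E) := h6
  have h8 : valueAt (farForm σ) ((1 : ℝ) • (1 : ℍ[ℝ])) y ![((1 : ℝ) • (1 : ℍ[ℝ]), 0), a] = 0 := by
    change (σ (fiberCoord (swap (ρ 1))) : E [⋀^Fin 2]→L[ℝ] ℝ)
      (⇑(mfderiv 𝓘(ℝ, ℍ[ℝ] × E) 𝓘(ℝ, E) (fun p : TotalSpace M => fiberCoord (swap p)) (ρ 1)) ∘
        ![((1 : ℝ) • (1 : ℍ[ℝ]), 0), a]) = 0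
    exact ContinuousAlternatingMap.map_coord_zero _ 0 h7
  rwa [one_smul] at h8

/-- Over `q = 1` the two fiber coordinates coincide. -/
theorem pullback_retract_farForm (σ : DForm E M k) {p : TotalSpace M} (hp : p ∈ trivSource M) :
    pullback (E := ℍ[ℝ] × E) (retract 1) (farForm σ) p = nearForm σ p := by
  have hq : retract 1 p ∈ overlap M := ofCoords_mem_overlap one_ne_zero _
  have hr : ContMDiffAt 𝓘(ℝ, ℍ[ℝ] × E) 𝓘(ℝ, ℍ[ℝ] × E) ∞ (retract 1) p :=
    contMDiffAt_ofCoords contMDiffAt_const (contMDiffAt_fiberCoord hp)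
  have h := pullback_comp_apply (g := fun p : TotalSpace M => fiberCoord (swap p)) (f := retract 1)
    (mdifferentiableAt_of_contMDiffAt (contMDiffAt_fiberCoord_swap (E := E)
      (swap_mem_of_overlap hq))) (mdifferentiableAt_of_contMDiffAt hr) σ
  refine h.symm.trans ?_
  have h1 : (fun p : TotalSpace M => fiberCoord (swap p)) ∘ retract 1 = fiberCoord := by
    funext p'
    have h2 : unitPart (1 : ℍ[ℝ]) = 1 := unitPart_coe 1
    simp only [Function.comp_apply]
    rw [retract, swap_ofCoords one_ne_zero, fiberCoord_ofCoords, h2, one_smul]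
  rw [h1]
  rfl

variable [FiniteDimensional ℝ E]

theorem smoothFormAt_nearForm (hσ : IsSmoothForm σ) {p : TotalSpace M} (hp : p ∈ trivSource M) :
    SmoothFormAt (nearForm σ) p := (isSmoothForm_iff.1 hσ _).pullback (contMDiffAt_fiberCoord hp)

theorem smoothFormAt_farForm (hσ : IsSmoothForm σ) {p : TotalSpace M}
    (hp : swap p ∈ trivSource M) : SmoothFormAt (farForm σ) p :=
  (isSmoothForm_iff.1 hσ _).pullback (contMDiffAt_fiberCoord_swap hp)

theorem extD_nearForm (hσ : IsClosedForm σ) {p : TotalSpace M} (hp : p ∈ trivSource M) :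
    extD (nearForm σ) p = 0 := by
  rw [nearForm, extD_pullback (isSmoothForm_iff.1 hσ.smooth _) (contMDiffAt_fiberCoord hp),
    hσ.closed]
  rfl

theorem extD_farForm (hσ : IsClosedForm σ) {p : TotalSpace M} (hp : swap p ∈ trivSource M) :
    extD (farForm σ) p = 0 := by
  rw [farForm, extD_pullback (isSmoothForm_iff.1 hσ.smooth _) (contMDiffAt_fiberCoord_swap hp),
    hσ.closed]
  rfl

end

section

/-- The invariant primitive on the overlap of the difference of `farForm σ` and `nearForm σ`. -/
def transgression (σ : DForm E M 2) : DForm (ℍ[ℝ] × E) (TotalSpace M) 1 :=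
  fun p => commForm (valueAt (farForm σ) 1 (fiberCoord p)) (baseCoord p)

theorem valueAt_transgression (σ : DForm E M 2) (q : ℍ[ℝ]) (y : M) :
    valueAt (transgression σ) q y = commForm (valueAt (farForm σ) 1 y) q := by
  change commForm (valueAt (farForm σ) 1 (fiberCoord (ofCoords q y))) (baseCoord (ofCoords q y)) = _
  rw [fiberCoord_ofCoords, baseCoord_ofCoords]

theorem localRep_transgression (σ : DForm E M 2) {p : TotalSpace M} (hp : p ∈ trivSource M)
    {z : ℍ[ℝ] × E} (hz : z.2 ∈ (chartAt E (fiberCoord p)).target) :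
    localRep (transgression σ) p z = commForm (localRep (farForm σ) p (1, z.2)) z.1 := by
  rw [localRep_eq_valueAt _ hp hz, valueAt_transgression,
    localRep_eq_valueAt (farForm σ) hp (z := (1, z.2)) hz]
  refine form_one_ext fun a => ?_
  rw [ContinuousAlternatingMap.compContinuousLinearMap_apply, commForm_apply, commForm_apply,
    commDual_comp]
  rfl

variable [FiniteDimensional ℝ E] {σ : DForm E M 2}

theorem contDiffAt_localRep_farForm (hσ : IsSmoothForm σ) {p : TotalSpace M}
    (hp : p ∈ trivSource M) : ∀ z ∈ (chartAt E (fiberCoord p)).target,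
      ContDiffAt ℝ ∞ (localRep (farForm σ) p) (1, z) := fun z hz =>
  contDiffAt_localRep_of_mem hp (z := (1, z)) hz
    (smoothFormAt_farForm hσ (swap_mem_of_overlap (ofCoords_mem_overlap one_ne_zero _)))

theorem smoothFormAt_transgression (hσ : IsSmoothForm σ) {p : TotalSpace M}
    (hp : p ∈ overlap M) : SmoothFormAt (transgression σ) p := by
  have hz := (mem_chartAt_target hp.1).1 (mem_chart_target (ℍ[ℝ] × E) p)
  have h1 : (chartAt (ℍ[ℝ] × E) p p).1 ≠ 0 := by rw [chartAt_apply hp.1]; exact hp.2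
  refine (contDiffAt_commForm (contDiffAt_localRep_farForm hσ hp.1 _ hz)
    h1).congr_of_eventuallyEq ?_
  filter_upwards [(chartAt (ℍ[ℝ] × E) p).open_target.mem_nhds (mem_chart_target _ p)] with w hw
  exact localRep_transgression σ hp.1 ((mem_chartAt_target hp.1).1 hw)

/-- `extDeriv_commForm` in a chart, with `B` the expression of `farForm σ`: invariance and radial
vanishing are those of `ψ^*σ`, and the subtracted vertical part over `q = 1` is `nearForm σ`. -/
theorem extD_transgression (hσ : IsClosedForm σ)
    (hφ : ∀ g : SU2, pullback (fun x : M => g • x) σ = σ) {p : TotalSpace M}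
    (hp : p ∈ overlap M) : extD (transgression σ) p = farForm σ p - nearForm σ p := by
  have hz := (mem_chartAt_target hp.1).1 (mem_chart_target (ℍ[ℝ] × E) p)
  have hp' : (chartAt (ℍ[ℝ] × E) p).symm (chartAt (ℍ[ℝ] × E) p p) = p :=
    (chartAt (ℍ[ℝ] × E) p).left_inv (mem_chart_source _ p)
  have h1 : (chartAt (ℍ[ℝ] × E) p p).1 ≠ 0 := by rw [chartAt_apply hp.1]; exact hp.2
  have hsm := contDiffAt_localRep_farForm hσ.smooth hp.1
  have hclosed : ∀ z ∈ (chartAt E (fiberCoord p)).target,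
      extDeriv (localRep (farForm σ) p) (1, z) = 0 := fun z hz => by
    have hm : swap (ofCoords 1 ((chartAt E (fiberCoord p)).symm z)) ∈ trivSource M :=
      swap_mem_of_overlap (ofCoords_mem_overlap one_ne_zero _)
    rw [extDeriv_localRep hp.1 (z := (1, z)) hz (smoothFormAt_farForm hσ.smooth hm)]
    exact localRep_eq_zero hp.1 (extD_farForm hσ hm)
  have hinv : ∀ q : ℍ[ℝ], q ≠ 0 → ∀ z ∈ (chartAt E (fiberCoord p)).target, ∀ a b : ℍ[ℝ] × E,
      localRep (farForm σ) p (q, z) ![(q * a.1, a.2), (q * b.1, b.2)] =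
        localRep (farForm σ) p (1, z) ![a, b] := fun q hq z hz a b => by
    rw [localRep_eq_valueAt _ hp.1 (z := (q, z)) hz, localRep_eq_valueAt _ hp.1 (z := (1, z)) hz]
    simp only [ContinuousAlternatingMap.compContinuousLinearMap_apply]
    set D := chartSymmDeriv (E := E) (fiberCoord p) z
    refine Eq.trans ?_ ((valueAt_farForm_mul hφ hq ((chartAt E (fiberCoord p)).symm z)
      (a.1, D a.2) (b.1, D b.2)).trans ?_)
    · congr 1; ext i <;> fin_cases i <;> rfl
    · congr 1; ext i <;> fin_cases i <;> rfl
  have hrad : ∀ z ∈ (chartAt E (fiberCoord p)).target, ∀ a : ℍ[ℝ] × E,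
      localRep (farForm σ) p (1, z) ![(1, 0), a] = 0 := fun z hz a => by
    rw [localRep_eq_valueAt _ hp.1 (z := (1, z)) hz]
    simp only [ContinuousAlternatingMap.compContinuousLinearMap_apply]
    set D := chartSymmDeriv (E := E) (fiberCoord p) z
    refine Eq.trans ?_ (valueAt_farForm_radial σ ((chartAt E (fiberCoord p)).symm z)
      (a.1, D a.2))
    congr 1; ext i <;> fin_cases i <;> simp [D]
  refine eq_of_localRep_eq (η' := farForm σ - nearForm σ) ?_
  rw [localRep_extD (mem_chart_target _ p)
    (by rw [hp']; exact smoothFormAt_transgression hσ.smooth hp), localRep_chartAt _ hp.1]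
  refine form_two_ext fun a b => ?_
  have h2 := extDeriv_commForm (chartAt E (fiberCoord p)).open_target hsm hclosed hinv hrad
    (x := chartAt (ℍ[ℝ] × E) p p) h1 hz a b
  have h3 : extDeriv (localRep (transgression σ) p) (chartAt (ℍ[ℝ] × E) p p) =
      extDeriv (fun x : ℍ[ℝ] × E => commForm (localRep (farForm σ) p (1, x.2)) x.1)
        (chartAt (ℍ[ℝ] × E) p p) := by
    refine Filter.EventuallyEq.extDeriv_eq ?_
    filter_upwards [(chartAt (ℍ[ℝ] × E) p).open_target.mem_nhds (mem_chart_target _ p)] with w hw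
    exact localRep_transgression σ hp.1 ((mem_chartAt_target hp.1).1 hw)
  rw [h3, h2, localRep_chartAt _ hp.1]
  have h4 : localRep (farForm σ) p (1, (chartAt (ℍ[ℝ] × E) p p).2) =
      valueAt (farForm σ) 1 (fiberCoord p) := by
    rw [chartAt_apply hp.1]; exact localRep_self _ hp.1 1
  rw [h4]
  have h5 := (pullback_retract_farForm σ hp.1).symm.trans (pullback_retract 1 (farForm σ) hp.1)
  have h6 := congrArg (fun A : (ℍ[ℝ] × E) [⋀^Fin 2]→L[ℝ] ℝ => A ![a, b]) h5
  simp only [ContinuousAlternatingMap.compContinuousLinearMap_apply] at h6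
  refine congrArg₂ (· - ·) rfl (Eq.trans ?_ h6.symm)
  congr 1
  ext i <;> fin_cases i <;> simp

end

end FarForm

end TotalSpace

namespace TotalSpace

/-! ### Invariance, restriction to fibers, and uniqueness of the class -/

section Invariance

variable {E : Type*} [NormedAddCommGroup E] [NormedSpace ℝ E] {M : Type*} [TopologicalSpace M]
  [ChartedSpace E M] [MulAction SU2 M] [ContinuousSMul SU2 M]
  [IsManifold 𝓘(ℝ, E) ∞ M] [ContMDiffSMul (𝓡 3) 𝓘(ℝ, E) ∞ SU2 M]

theorem pullback_leftMul_apply {k : ℕ} (η : DForm (ℍ[ℝ] × E) (TotalSpace M) k) (a b : SU2)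
    {p : TotalSpace M} (hp : p ∈ trivSource M) (v : Fin k → ℍ[ℝ] × E) :
    (pullback (leftMul a b) η p : (ℍ[ℝ] × E) [⋀^Fin k]→L[ℝ] ℝ) v =
      valueAt η (a * baseCoord p * (b : ℍ[ℝ])⁻¹) (b • fiberCoord p) (fun i =>
        ((a * (v i).1 * (b : ℍ[ℝ])⁻¹,
          mfderiv 𝓘(ℝ, E) 𝓘(ℝ, E) (fun y : M => b • y) (fiberCoord p) (v i).2) :
            ℍ[ℝ] × E)) := by
  have h1 : HasMFDerivAt 𝓘(ℝ, ℍ[ℝ]) 𝓘(ℝ, ℍ[ℝ])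
      (fun q : ℍ[ℝ] => (a : ℍ[ℝ]) * q * (b : ℍ[ℝ])⁻¹) (baseCoord p)
      (ContinuousLinearMap.mulLeftRight ℝ ℍ[ℝ] a (b : ℍ[ℝ])⁻¹) :=
    (ContinuousLinearMap.mulLeftRight ℝ ℍ[ℝ] (a : ℍ[ℝ]) (b : ℍ[ℝ])⁻¹).hasMFDerivAt
  have h2 : HasMFDerivAt 𝓘(ℝ, E) 𝓘(ℝ, E) (fun y : M => b • y) (fiberCoord p) _ :=
    (mdifferentiableAt_of_contMDiffAt (contMDiffAt_smul_const b contMDiffAt_id)).hasMFDerivAt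
  have h3 := hasMFDerivAt_ofCoords (h1.comp p (hasMFDerivAt_baseCoord (E := E) hp))
    (h2.comp p (hasMFDerivAt_fiberCoord hp))
  have h4 : leftMul a b =ᶠ[𝓝 p] fun p => ofCoords
      (((fun q : ℍ[ℝ] => (a : ℍ[ℝ]) * q * (b : ℍ[ℝ])⁻¹) ∘ baseCoord) p)
      (((fun y : M => b • y) ∘ fiberCoord) p) := by
    filter_upwards [trivSource_mem_nhds hp] with p' hp'
    conv_lhs => rw [← ofCoords_coords hp', leftMul_ofCoords]
    rfl
  rw [pullback_congr h4]
  simp only [pullback]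
  rw [h3.mfderiv]
  rfl

theorem pullback_leftMul_nearForm {k : ℕ} {σ : DForm E M k}
    (hφ : ∀ g : SU2, pullback (fun x : M => g • x) σ = σ) (a b : SU2) {p : TotalSpace M}
    (hp : p ∈ trivSource M) :
    pullback (E := ℍ[ℝ] × E) (leftMul a b) (nearForm σ) p = nearForm σ p := by
  have h := pullback_comp_apply (g := fiberCoord) (f := leftMul a b)
    (mdifferentiableAt_of_contMDiffAt (contMDiffAt_fiberCoord (E := E) ((leftMul_mem a b).2 hp)))
    (mdifferentiableAt_of_contMDiffAt (contMDiffAt_leftMul (E := E) a b p)) σ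
  refine h.symm.trans ((pullback_congr ?_ σ).trans (pullback_smul_of_invariant hφ b
    (contMDiffAt_fiberCoord hp)))
  filter_upwards [trivSource_mem_nhds hp] with p' hp'
  exact fiberCoord_leftMul a b hp'

theorem pullback_leftMul_farForm {k : ℕ} {σ : DForm E M k}
    (hφ : ∀ g : SU2, pullback (fun x : M => g • x) σ = σ) (a b : SU2) {p : TotalSpace M}
    (hp : swap p ∈ trivSource M) :
    pullback (E := ℍ[ℝ] × E) (leftMul a b) (farForm σ) p = farForm σ p := by
  have hq : swap (leftMul a b p) ∈ trivSource M := by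
    rw [swap_leftMul]; exact (leftMul_mem b a).2 hp
  have h := pullback_comp_apply (g := fun p : TotalSpace M => fiberCoord (swap p))
    (f := leftMul a b)
    (mdifferentiableAt_of_contMDiffAt (contMDiffAt_fiberCoord_swap (E := E) hq))
    (mdifferentiableAt_of_contMDiffAt (contMDiffAt_leftMul (E := E) a b p)) σ
  refine h.symm.trans ((pullback_congr ?_ σ).trans (pullback_smul_of_invariant hφ a
    (contMDiffAt_fiberCoord_swap hp)))
  filter_upwards [continuous_swap'.continuousAt.preimage_mem_nhds (trivSource_mem_nhds hp)]
    with p' hp'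
  simp only [Function.comp_apply]
  rw [swap_leftMul, fiberCoord_leftMul b a hp']

variable {σ : DForm E M 2}

/-- Equivariance of the moment map. It is enough to compare both sides on commutators, where they
are values of `farForm σ`; `leftMul b b` maps the fiber over `q = 1` to itself, acts on base vectors
by conjugation, and preserves `farForm σ`. -/
theorem commDual_farForm_conj (hφ : ∀ g : SU2, pullback (fun x : M => g • x) σ = σ) (b : SU2)
    (y : M) (u : ℍ[ℝ]) :
    commDual (valueAt (farForm σ) 1 (b • y)) (b * u * (b : ℍ[ℝ])⁻¹) =
      commDual (valueAt (farForm σ) 1 y) u := by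
  have hb : (b : ℍ[ℝ]) ≠ 0 := ne_zero_of_mem_unit_sphere b
  set L := ContinuousLinearMap.mulLeftRight ℝ ℍ[ℝ] (b : ℍ[ℝ]) (b : ℍ[ℝ])⁻¹ with hL
  set f : ℍ[ℝ] →ₗ[ℝ] ℝ := (((commDual (valueAt (farForm σ) 1 (b • y))).comp L) -
    commDual (valueAt (farForm σ) 1 y)).toLinearMap with hf
  have hf' : ∀ u, f u = commDual (valueAt (farForm σ) 1 (b • y)) (b * u * (b : ℍ[ℝ])⁻¹) -
    commDual (valueAt (farForm σ) 1 y) u := fun u => rfl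
  refine sub_eq_zero.1 ((hf' u).symm.trans (linear_eq_zero_of_commutator ?_ (fun x x' => ?_) u))
  · rw [hf', mul_one, mul_inv_cancel₀ hb, commDual_one, commDual_one, sub_zero]
  · have h1 : (b : ℍ[ℝ]) * (x * x' - x' * x) * (b : ℍ[ℝ])⁻¹ =
        (b * x * (b : ℍ[ℝ])⁻¹) * (b * x' * (b : ℍ[ℝ])⁻¹) -
          (b * x' * (b : ℍ[ℝ])⁻¹) * (b * x * (b : ℍ[ℝ])⁻¹) := by
      simp only [mul_sub, sub_mul, mul_assoc, inv_mul_cancel_left₀ hb]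
    have hrad : ∀ y : M, ∀ u : ℍ[ℝ], valueAt (farForm σ) 1 y ![(1, 0), (u, 0)] = 0 :=
      fun y u => valueAt_farForm_radial σ y (u, 0)
    rw [hf', h1, commDual_commutator (hrad _), commDual_commutator (hrad _), sub_eq_zero]
    have hp : (ofCoords 1 y : TotalSpace M) ∈ overlap M := ofCoords_mem_overlap one_ne_zero y
    have h2 := pullback_leftMul_apply (farForm σ) b b hp.1 ![(x, 0), (x', 0)]
    rw [pullback_leftMul_farForm hφ b b (swap_mem_of_overlap hp), baseCoord_ofCoords,
      fiberCoord_ofCoords, mul_one, mul_inv_cancel₀ hb] at h2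
    refine Eq.trans ?_ h2.symm
    congr 1
    funext i
    fin_cases i
    · exact Prod.ext rfl (map_zero _).symm
    · exact Prod.ext rfl (map_zero _).symm

/-- Under `q ↦ a q b⁻¹` the form `q⁻¹ dq` loses `a` and is conjugated by `b`; the equivariance of
the moment map absorbs the conjugation. -/
theorem pullback_leftMul_transgression (hφ : ∀ g : SU2, pullback (fun x : M => g • x) σ = σ)
    (a b : SU2) {p : TotalSpace M} (hp : p ∈ trivSource M) :
    pullback (E := ℍ[ℝ] × E) (leftMul a b) (transgression σ) p = transgression σ p := by
  have ha : (a : ℍ[ℝ]) ≠ 0 := ne_zero_of_mem_unit_sphere a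
  have hb : (b : ℍ[ℝ]) ≠ 0 := ne_zero_of_mem_unit_sphere b
  refine form_one_ext (X := ℍ[ℝ] × E) fun c => ?_
  refine (pullback_leftMul_apply _ a b hp ![c]).trans ?_
  rw [valueAt_transgression, commForm_apply]
  have h1 : ((a : ℍ[ℝ]) * baseCoord p * (b : ℍ[ℝ])⁻¹)⁻¹ * (a * c.1 * (b : ℍ[ℝ])⁻¹) =
      b * ((baseCoord p)⁻¹ * c.1) * (b : ℍ[ℝ])⁻¹ := by
    simp only [mul_inv_rev, inv_inv, mul_assoc, inv_mul_cancel_left₀ ha]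
  refine (congrArg (fun u => -commDual (valueAt (farForm σ) 1 (b • fiberCoord p)) u) h1).trans ?_
  rw [commDual_farForm_conj hφ]
  rfl

theorem cutoff_leftMul (a b : SU2) {p : TotalSpace M} (hp : p ∈ trivSource M) :
    cutoff (leftMul a b p) = cutoff p := by
  rw [cutoff, cutoff, baseCoord_leftMul a b hp]
  simp [norm_mul]

theorem pullback_leftMul_cutForm (hφ : ∀ g : SU2, pullback (fun x : M => g • x) σ = σ)
    (a b : SU2) {p : TotalSpace M} (hp : p ∈ trivSource M) :
    pullback (E := ℍ[ℝ] × E) (leftMul a b) (cutForm (transgression σ)) p =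
      cutForm (transgression σ) p := by
  have h1 : pullback (E := ℍ[ℝ] × E) (leftMul a b) (cutForm (transgression σ)) p =
      cutoff (leftMul a b p) •
        pullback (E := ℍ[ℝ] × E) (leftMul a b) (transgression σ) p := rfl
  rw [h1, cutoff_leftMul a b hp, pullback_leftMul_transgression hφ a b hp]
  rfl

/-- The restriction of `transgression σ` to every fiber vanishes. -/
theorem pullback_mk_cutForm (v : UnitPairs) (hv : v.snd ≠ 0) (x : M) :
    pullback (E := E) (mk v) (cutForm (transgression σ)) x = 0 := by
  have hp : mk v x ∈ trivSource M := hv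
  have h1 := (mdifferentiableAt_of_contMDiffAt (contMDiffAt_mk (E := E) v x)).hasMFDerivAt
  have h2 := (hasMFDerivAt_baseCoord (E := E) hp).comp x h1
  have h3 : HasMFDerivAt 𝓘(ℝ, E) 𝓘(ℝ, ℍ[ℝ]) (baseCoord ∘ mk v) x (0 : E →L[ℝ] ℍ[ℝ]) :=
    hasMFDerivAt_const (v.fst * v.snd⁻¹) x
  have h4 : ∀ c : E, ((mfderiv 𝓘(ℝ, E) 𝓘(ℝ, ℍ[ℝ] × E) (mk v) x c : ℍ[ℝ] × E)).1 = 0 := fun c =>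
    congrArg (fun L : E →L[ℝ] ℍ[ℝ] => L c) (hasMFDerivAt_unique h2 h3)
  refine form_one_ext (X := E) fun c => ?_
  change cutoff (mk v x) * -commDual (valueAt (farForm σ) 1 (fiberCoord (mk v x)))
    ((baseCoord (mk v x))⁻¹ * ((mfderiv 𝓘(ℝ, E) 𝓘(ℝ, ℍ[ℝ] × E) (mk v) x c : ℍ[ℝ] × E)).1) = 0
  rw [h4, mul_zero, map_zero, neg_zero, mul_zero]

variable [FiniteDimensional ℝ E]

/-- The coupling form: an invariant closed extension of the invariant form `σ` from the fibers. -/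
def couplingForm (σ : DForm E M 2) : DForm (ℍ[ℝ] × E) (TotalSpace M) 2 :=
  glue (nearForm σ) (farForm σ) (transgression σ)

theorem isClosedForm_couplingForm (hσ : IsClosedForm σ)
    (hφ : ∀ g : SU2, pullback (fun x : M => g • x) σ = σ) : IsClosedForm (couplingForm σ) := by
  have h0 : ∀ p ∈ trivSource M, SmoothFormAt (nearForm σ) p := fun p hp =>
    smoothFormAt_nearForm hσ.smooth hp
  have hl : ∀ p ∈ overlap M, SmoothFormAt (transgression σ) p := fun p hp =>
    smoothFormAt_transgression hσ.smooth hp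
  have hd : ∀ p ∈ overlap M, extD (transgression σ) p = farForm σ p - nearForm σ p :=
    fun p hp => extD_transgression hσ hφ hp
  refine ⟨isSmoothForm_iff.2 (smoothFormAt_glue h0 (fun p hp => smoothFormAt_farForm hσ.smooth hp)
    hl hd), ?_⟩
  funext p
  by_cases hp : p ∈ trivSource M
  · rw [couplingForm, extD_glue_of_mem h0 hl hp, extD_nearForm hσ hp]; rfl
  · rw [couplingForm, extD_glue_of_notMem hd hp, extD_farForm hσ (swap_mem_of_notMem hp)]; rfl

/-- `leftMul a b` preserves both halves, the norm of `q`, both local extensions and the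
transgression; exterior differentiation commutes with its pullback. -/
theorem pullback_leftMul_couplingForm (hσ : IsClosedForm σ)
    (hφ : ∀ g : SU2, pullback (fun x : M => g • x) σ = σ) (a b : SU2) :
    pullback (E := ℍ[ℝ] × E) (leftMul a b) (couplingForm σ) = couplingForm σ := by
  funext p
  by_cases hp : p ∈ trivSource M
  · have hs : ∀ p ∈ trivSource M, SmoothFormAt (cutForm (transgression σ)) p := fun p hp =>
      smoothFormAt_cutForm (fun p hp => smoothFormAt_transgression hσ.smooth hp) hp
    have hq : leftMul a b p ∈ trivSource M := (leftMul_mem a b).2 hp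
    have h1 : pullback (E := ℍ[ℝ] × E) (leftMul a b) (couplingForm σ) p =
        pullback (E := ℍ[ℝ] × E) (leftMul a b) (nearForm σ) p +
          pullback (E := ℍ[ℝ] × E) (leftMul a b) (extD (cutForm (transgression σ))) p :=
      (pullback_congr_form (η' := nearForm σ + extD (cutForm (transgression σ)))
        (glue_of_mem _ _ _ hq)).trans rfl
    have h2 : extD (pullback (E := ℍ[ℝ] × E) (leftMul a b) (cutForm (transgression σ))) p =
        extD (cutForm (transgression σ)) p := by
      refine extD_congr ?_
      filter_upwards [trivSource_mem_nhds hp] with p' hp'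
      exact pullback_leftMul_cutForm hφ a b hp'
    rw [h1, pullback_leftMul_nearForm hφ a b hp,
      ← extD_pullback (hs _ hq) (contMDiffAt_leftMul a b p), h2]
    exact (glue_of_mem _ _ _ hp).symm
  · have hq : leftMul a b p ∉ trivSource M := fun h => hp ((leftMul_mem a b).1 h)
    rw [pullback_congr_form (η := couplingForm σ) (η' := farForm σ) (glue_of_notMem _ _ _ hq),
      pullback_leftMul_farForm hφ a b (swap_mem_of_notMem hp)]
    exact (glue_of_notMem _ _ _ hp).symm

theorem pullback_mk_couplingForm (hσ : IsClosedForm σ)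
    (hφ : ∀ g : SU2, pullback (fun x : M => g • x) σ = σ) (v : UnitPairs) :
    pullback (E := E) (mk v) (couplingForm σ) = σ := by
  funext x
  have hmk := mdifferentiableAt_of_contMDiffAt (contMDiffAt_mk (E := E) v x)
  have hsmul : ∀ g : SU2, pullback (E := E) (fun x : M => g • x) σ x = σ x := fun g => by rw [hφ]
  by_cases hv : v.snd = 0
  · have hp : mk v x ∉ trivSource M := not_not.2 hv
    have h := pullback_comp_apply (g := fun p : TotalSpace M => fiberCoord (swap p)) (f := mk v)
      (mdifferentiableAt_of_contMDiffAt (contMDiffAt_fiberCoord_swap (E := E)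
        (swap_mem_of_notMem hp))) hmk σ
    rw [pullback_congr_form (η := couplingForm σ) (η' := farForm σ) (glue_of_notMem _ _ _ hp)]
    -- On this fiber the far coordinate of `[v, x]` is `phase v.swap • x`, and the action preserves
    -- `σ`.
    exact h.symm.trans (hsmul (phase v.swap))
  · have hp : mk v x ∈ trivSource M := hv
    have hs : SmoothFormAt (cutForm (transgression σ)) (mk v x) :=
      smoothFormAt_cutForm (fun p hp => smoothFormAt_transgression hσ.smooth hp) hp
    have h := pullback_comp_apply (g := fiberCoord) (f := mk v)
      (mdifferentiableAt_of_contMDiffAt (contMDiffAt_fiberCoord (E := E) hp)) hmk σ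
    have h1 : pullback (E := E) (mk v) (couplingForm σ) x =
        pullback (E := E) (mk v) (nearForm σ) x +
          pullback (E := E) (mk v) (extD (cutForm (transgression σ))) x :=
      (pullback_congr_form (η' := nearForm σ + extD (cutForm (transgression σ)))
        (glue_of_mem _ _ _ hp)).trans rfl
    -- `q` is constant on a fiber, so the transgression restricts to zero there, and so does its
    -- exterior derivative.
    have h2 : pullback (E := E) (mk v) (cutForm (transgression σ)) = 0 :=
      funext (pullback_mk_cutForm v hv)
    rw [h1, ← extD_pullback hs (contMDiffAt_mk v x), h2, extD_zero_form, Pi.zero_apply, add_zero]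
    exact h.symm.trans (hsmul (phase v))

theorem cohomologous_of_pullback_mk_eq {τ τ' : DForm (ℍ[ℝ] × E) (TotalSpace M) 2}
    (hτ : IsClosedForm τ) (hτ' : IsClosedForm τ')
    (h : ∀ v : UnitPairs, pullback (E := E) (mk v) τ' = pullback (E := E) (mk v) τ) :
    Cohomologous τ' τ := by
  have hs := isSmoothForm_iff.1 hτ.smooth
  have hs' := isSmoothForm_iff.1 hτ'.smooth
  refine exists_primitive_of_fiberwise_zero ⟨isSmoothForm_iff.2 fun p => (hs' p).sub (hs p), ?_⟩
    fun v => ?_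
  · funext p
    rw [extD_sub (hs' p) (hs p), hτ.closed, hτ'.closed]
    simp
  · have h1 : pullback (E := E) (mk v) (τ' - τ) =
        pullback (E := E) (mk v) τ' - pullback (E := E) (mk v) τ := rfl
    rw [h1, h, sub_self]

end Invariance

end TotalSpace

end

end SU2Bundle

theorem mainTheorem4 (n : ℕ) {M : Type*} [TopologicalSpace M] [T2Space M] [CompactSpace M]
    [ChartedSpace (EuclideanSpace ℝ (Fin (2 * n))) M]
    [IsManifold 𝓘(ℝ, EuclideanSpace ℝ (Fin (2 * n))) ∞ M]
    (σ : DForm (EuclideanSpace ℝ (Fin (2 * n))) M 2) (hσ : IsSymplecticForm σ)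
    [MulAction SU2 M] [ContinuousSMul SU2 M]
    [ContMDiffSMul (𝓡 3) 𝓘(ℝ, EuclideanSpace ℝ (Fin (2 * n))) ∞ SU2 M]
    (hφ : ∀ g : SU2, pullback (fun x : M => g • x) σ = σ) :
    ∃ τ : DForm (ℍ[ℝ] × EuclideanSpace ℝ (Fin (2 * n))) (TotalSpace M) 2,
      IsClosedForm τ ∧
      (∀ h : SU2, pullback (TotalSpace.su2Act h) τ = τ) ∧
      (∀ z : Circle, pullback (TotalSpace.circleAct z) τ = τ) ∧
      (∀ z : Circle, pullback (TotalSpace.circleAct' z) τ = τ) ∧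
      (∀ v : UnitPairs, pullback (TotalSpace.mk v) τ = σ) ∧
      ∀ τ' : DForm (ℍ[ℝ] × EuclideanSpace ℝ (Fin (2 * n))) (TotalSpace M) 2,
        IsClosedForm τ' → (∀ v : UnitPairs, pullback (TotalSpace.mk v) τ' = σ) →
          Cohomologous τ' τ := by
  have hc : IsClosedForm σ := hσ.toIsClosedForm
  refine ⟨TotalSpace.couplingForm σ, TotalSpace.isClosedForm_couplingForm hc hφ,
    -- All three actions are by maps `leftMul a b`, so one invariance statement covers them.
    fun h => TotalSpace.pullback_leftMul_couplingForm hc hφ _ _,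
    fun z => TotalSpace.pullback_leftMul_couplingForm hc hφ _ _,
    fun z => TotalSpace.pullback_leftMul_couplingForm hc hφ _ _,
    TotalSpace.pullback_mk_couplingForm hc hφ, fun τ' hτ' hv => ?_⟩
  refine TotalSpace.cohomologous_of_pullback_mk_eq (TotalSpace.isClosedForm_couplingForm hc hφ) hτ'
    fun v => ?_
  rw [hv, TotalSpace.pullback_mk_couplingForm hc hφ]
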